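/- Let $S\subseteq\mathbb{N}=\{0,1,2,\dots\}$ be nonempty and let $X_S\subseteq\{0,1\}^{\mathbb{Z}}$ be the $S$-gap shift, i.e. the subshift whose language (the set of finite words occurring in its points) consists of all subwords of finite concatenations of words from $\{01^n : n\in S\}$. Call a subshift $X$ (a closed shift-invariant subset of $A^{\mathbb{Z}}$, $A$ finite) sofic if its language $L(X)$ is regular, and transitive if for all $u,v\in L(X)$ there is $w\in L(X)$ with $uwv\in L(X)$; let $\mathrm{Aut}(X)$ be the group, under composition, of all bijective cellular automata $X\to X$, a cellular automaton being a map $F$ for which there are integers $m\le a$ and a function $f:A^{a-m+1}\to A$ with $F(x)[i]=f(x[i+m],\dots,x[i+a])$ for all $x\in X$, $i\in\mathbb{Z}$. If $X_S$ is not sofic, then for every transitive sofic subshift $Z$ (over any finite alphabet) the groups $\mathrm{Aut}(X_S)$ and $\mathrm{Aut}(Z)$ are not isomorphic as abstract groups. -/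

import Mathlib

namespace SoficAut

open SymbolicDynamics.FullShift

section General

variable {A : Type*} [TopologicalSpace A]

/-- The language `L(X)` of a subshift `X ⊆ A^ℤ`: all finite words (the empty one included) that
occur in some point of `X`. -/
def language (X : Subshift A ℤ) : Language A :=
  {w : List A | ∃ x ∈ X.carrier, ∃ i : ℤ, ∀ (k : ℕ) (hk : k < w.length), x (i + k) = w[k]}

/-- A subshift is transitive if any two words of its language can be joined inside it. -/
def IsTransitive (X : Subshift A ℤ) : Prop :=
  ∀ u ∈ language X, ∀ v ∈ language X, ∃ w ∈ language X, u ++ w ++ v ∈ language X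

/-- A subshift is sofic if its language is regular. -/
def IsSofic (X : Subshift A ℤ) : Prop :=
  (language X).IsRegular

/-- A cellular automaton on `X`: a map `F : X → X` for which there are integers `m ≤ a` (memory
and anticipation) and a local rule `f` with `F(x)[i] = f(x[i+m], …, x[i+a])`. -/
def IsCellularAutomaton (X : Subshift A ℤ) (F : X.carrier → X.carrier) : Prop :=
  ∃ m a : ℤ, m ≤ a ∧ ∃ f : (Set.Icc m a → A) → A,
    ∀ (x : X.carrier) (i : ℤ), (F x).1 i = f (fun j => x.1 (i + j))

/-- The shift map restricted to `X`, by an arbitrary amount. -/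
def shiftOn (X : Subshift A ℤ) (g : ℤ) (x : X.carrier) : X.carrier :=
  ⟨shift g x.1, X.mapsTo g x.2⟩

theorem isCellularAutomaton_id (X : Subshift A ℤ) : IsCellularAutomaton X id :=
  ⟨0, 0, le_rfl, fun p => p ⟨0, by simp⟩, fun x i => by simp⟩

theorem IsCellularAutomaton.comp {X : Subshift A ℤ} {F G : X.carrier → X.carrier}
    (hF : IsCellularAutomaton X F) (hG : IsCellularAutomaton X G) :
    IsCellularAutomaton X (F ∘ G) := by
  obtain ⟨m, a, hma, f, hf⟩ := hF
  obtain ⟨n, b, hnb, g, hg⟩ := hG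
  refine ⟨m + n, a + b, by omega, fun p => f fun j => g fun k => p ⟨j.1 + k.1, ?_⟩, ?_⟩
  · have hj := j.2
    have hk := k.2
    simp only [Set.mem_Icc] at hj hk ⊢
    omega
  · intro x i
    simp only [Function.comp, hf, hg]
    simp only [add_assoc]

theorem IsCellularAutomaton.shift_comm {X : Subshift A ℤ} {F : X.carrier → X.carrier}
    (hF : IsCellularAutomaton X F) (g : ℤ) (x : X.carrier) :
    F (shiftOn X g x) = shiftOn X g (F x) := by
  obtain ⟨m, a, hma, f, hf⟩ := hF
  ext i
  simp only [shiftOn, shift_apply, hf, add_assoc]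

theorem IsCellularAutomaton.continuous [DiscreteTopology A] {X : Subshift A ℤ}
    {F : X.carrier → X.carrier} (hF : IsCellularAutomaton X F) : Continuous F := by
  obtain ⟨m, a, hma, f, hf⟩ := hF
  refine Continuous.subtype_mk (f := fun x => (F x).1) (continuous_pi fun i => ?_) _
  simp only [hf]
  have : Finite (Set.Icc m a) := (Set.finite_Icc m a).to_subtype
  refine (continuous_of_discreteTopology (f := f)).comp (continuous_pi fun j => ?_)
  exact (continuous_apply (i + j.1)).comp continuous_subtype_val

/-- The nontrivial direction of the Curtis–Hedlund–Lyndon theorem. -/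
theorem isCellularAutomaton_of_continuous [DiscreteTopology A] [Finite A] {X : Subshift A ℤ}
    {F : X.carrier → X.carrier} (hc : Continuous F)
    (hs : ∀ g x, F (shiftOn X g x) = shiftOn X g (F x)) : IsCellularAutomaton X F := by
  classical
  have : CompactSpace X.carrier := isCompact_iff_compactSpace.mp X.isClosed.isCompact
  have h0 : Continuous fun x : X.carrier => (F x).1 0 :=
    (continuous_apply (0 : ℤ)).comp (continuous_subtype_val.comp hc)
  let K : ℕ → Set (X.carrier × X.carrier) := fun n =>
    {p | (∀ j ∈ Set.Icc (-(n : ℤ)) n, p.1.1 j = p.2.1 j) ∧ (F p.1).1 0 ≠ (F p.2).1 0}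
  have hK : ∀ n, IsClosed (K n) := by
    intro n
    have h1 : IsClosed {p : X.carrier × X.carrier |
        ∀ j ∈ Set.Icc (-(n : ℤ)) n, p.1.1 j = p.2.1 j} := by
      simp only [Set.ofPred_forall]
      refine isClosed_iInter fun j => isClosed_iInter fun _ => ?_
      exact isClosed_eq
        ((continuous_apply j).comp (continuous_subtype_val.comp continuous_fst))
        ((continuous_apply j).comp (continuous_subtype_val.comp continuous_snd))
    have h2 : IsClosed {p : X.carrier × X.carrier | (F p.1).1 0 ≠ (F p.2).1 0} := by
      have h3 : Continuous fun p : X.carrier × X.carrier => ((F p.1).1 0, (F p.2).1 0) :=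
        (h0.comp continuous_fst).prodMk (h0.comp continuous_snd)
      exact (isClosed_discrete {q : A × A | q.1 ≠ q.2}).preimage h3
    exact h1.inter h2
  have hdir : Directed (· ⊇ ·) K := by
    refine directed_of_isDirected_le fun n k hnk p hp => ⟨fun j hj => hp.1 j ?_, hp.2⟩
    simp only [Set.mem_Icc] at hj ⊢
    omega
  have hemp : (Set.univ ∩ ⋂ n, K n) = ∅ := by
    refine Set.eq_empty_iff_forall_notMem.mpr ?_
    rintro ⟨x, y⟩ ⟨-, hp⟩
    rw [Set.mem_iInter] at hp
    refine (hp 0).2 ?_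
    have : x = y := by
      ext j
      exact (hp j.natAbs).1 j (by simp only [Set.mem_Icc]; omega)
    simp only [this]
  obtain ⟨n, hn⟩ := isCompact_univ.elim_directed_family_closed K hK hemp hdir
  have key : ∀ x y : X.carrier, (∀ j ∈ Set.Icc (-(n : ℤ)) n, x.1 j = y.1 j) →
      (F x).1 0 = (F y).1 0 := by
    intro x y hxy
    by_contra hne
    have : (x, y) ∈ Set.univ ∩ K n := ⟨trivial, hxy, hne⟩
    rw [hn] at this
    exact this
  refine ⟨-n, n, by omega, fun p =>
    if h : ∃ y : X.carrier, ∀ j : Set.Icc (-(n : ℤ)) n, y.1 j = p j then (F h.choose).1 0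
    else p ⟨0, by simp⟩, fun x i => ?_⟩
  have h : ∃ y : X.carrier, ∀ j : Set.Icc (-(n : ℤ)) n, y.1 j = x.1 (i + j) :=
    ⟨shiftOn X i x, fun j => rfl⟩
  beta_reduce
  rw [dif_pos h]
  have e1 : (F x).1 i = (F (shiftOn X i x)).1 0 := by
    rw [hs]
    simp [shiftOn]
  rw [e1]
  refine key _ _ fun j hj => ?_
  exact (h.choose_spec ⟨j, hj⟩).symm

/-- `Aut(X)`: the group, under composition, of all bijective cellular automata on `X`. -/
def Aut [DiscreteTopology A] [Finite A] (X : Subshift A ℤ) : Subgroup (Equiv.Perm X.carrier) where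
  carrier := {F | IsCellularAutomaton X F}
  one_mem' := isCellularAutomaton_id X
  mul_mem' := by
    intro F G hF hG
    exact IsCellularAutomaton.comp (X := X) (F := F) (G := G) hF hG
  inv_mem' := by
    intro F hF
    have : CompactSpace X.carrier := isCompact_iff_compactSpace.mp X.isClosed.isCompact
    refine isCellularAutomaton_of_continuous ?_ fun g x => ?_
    · exact (Continuous.homeoOfEquivCompactToT2 (f := F)
        (IsCellularAutomaton.continuous hF)).symm.continuous
    · apply F.injective
      rw [IsCellularAutomaton.shift_comm hF]
      simp

/-- `X` is the coded subshift generated by `L`: its language consists of all subwords of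
elements of `L^*`. (A subshift is determined by its language.) -/
def IsCodedBy (X : Subshift A ℤ) (L : Language A) : Prop :=
  language X = {w : List A | ∃ u ∈ KStar.kstar L, w <:+: u}

/-- The points all of whose finite subwords are subwords of elements of `L^*`. -/
def codedSubshift [DiscreteTopology A] (L : Language A) : Subshift A ℤ where
  carrier := {x | ∀ (i : ℤ) (n : ℕ), ∃ u ∈ KStar.kstar L,
    List.ofFn (fun k : Fin n => x (i + (k : ℕ))) <:+: u}
  isClosed := by
    simp only [Set.ofPred_forall]
    refine isClosed_iInter fun i => isClosed_iInter fun n => ?_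
    have h : Continuous fun x : ℤ → A => fun k : Fin n => x (i + (k : ℕ)) :=
      continuous_pi fun k => continuous_apply _
    exact (isClosed_discrete
      {p : Fin n → A | ∃ u ∈ KStar.kstar L, List.ofFn p <:+: u}).preimage h
  mapsTo := by
    intro g x hx i n
    simpa [add_assoc] using hx (g + i) n

/-- If `L` contains a word and no empty word, then `codedSubshift L` is the coded subshift
generated by `L`. -/
theorem codedSubshift_isCodedBy [DiscreteTopology A] {L : Language A} (hne : ∃ l, l ∈ L)
    (hnil : [] ∉ L) : IsCodedBy (codedSubshift L) L := by
  refine Set.Subset.antisymm ?_ ?_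
  · rintro w ⟨x, hx, i, hw⟩
    have h : List.ofFn (fun k : Fin w.length => x (i + (k : ℕ))) = w := by
      refine List.ext_getElem (by simp) fun k h1 h2 => ?_
      simpa using hw k h2
    have h2 := hx i w.length
    rw [h] at h2
    exact h2
  · rintro w ⟨u, hu, hwu⟩
    obtain ⟨v, hv, hv0, hwv⟩ : ∃ v ∈ KStar.kstar L, v ≠ [] ∧ w <:+: v := by
      by_cases h : u = []
      · subst h
        obtain ⟨l, hl⟩ := hne
        have hl0 : l ≠ [] := fun h => hnil (h ▸ hl)
        rw [List.infix_nil] at hwu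
        subst hwu
        exact ⟨l, Language.mem_kstar.2 ⟨[l], by simp, by simpa using hl⟩, hl0, List.nil_infix⟩
      · exact ⟨u, hu, h, hwu⟩
    have hpos : 0 < v.length := List.length_pos_iff.2 hv0
    have hmod : ∀ i : ℤ, (i % (v.length : ℤ)).toNat < v.length := by
      intro i
      have h1 := Int.emod_nonneg i (b := (v.length : ℤ)) (by omega)
      have h2 := Int.emod_lt_of_pos i (b := (v.length : ℤ)) (by omega)
      omega
    let x : ℤ → A := fun i => v[(i % (v.length : ℤ)).toNat]'(hmod i)
    have hx : ∀ k : ℕ, ∀ h : k < v.length, x k = v[k] := by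
      intro k h
      have : ((k : ℤ) % (v.length : ℤ)).toNat = k := by
        rw [Int.emod_eq_of_lt (by omega) (by omega)]
        simp
      simp only [x, this]
    have hxper : ∀ i c : ℤ, x (i + v.length * c) = x i := by
      intro i c
      simp only [x, Int.add_mul_emod_self_left]
    have hrep : ∀ c : ℕ, List.ofFn (fun k : Fin (c * v.length) => x (k : ℕ)) ∈ KStar.kstar L := by
      intro c
      induction c with
      | zero => simpa using Language.nil_mem_kstar L
      | succ c ih =>
        have e : List.ofFn (fun k : Fin ((c + 1) * v.length) => x (k : ℕ)) =
            List.ofFn (fun k : Fin (c * v.length) => x (k : ℕ)) ++ v := by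
          refine List.ext_getElem (by simp; ring) fun k h1 h2 => ?_
          rw [List.getElem_append]
          split_ifs with h3
          · simp
          · simp only [List.length_ofFn, not_lt] at h3
            simp only [List.length_append, List.length_ofFn] at h2
            simp only [List.getElem_ofFn, List.length_ofFn]
            rw [← hx (k - c * v.length) (by omega), ← hxper ((k - c * v.length : ℕ) : ℤ) c]
            congr 1
            push_cast [h3]
            ring
        rw [e]
        obtain ⟨P, hP, hPL⟩ := Language.mem_kstar.1 ih
        obtain ⟨Q, hQ, hQL⟩ := Language.mem_kstar.1 hv
        refine Language.mem_kstar.2 ⟨P ++ Q, by rw [hP, hQ, List.flatten_append], ?_⟩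
        intro y hy
        rcases List.mem_append.1 hy with h | h
        · exact hPL y h
        · exact hQL y h
    refine ⟨x, ?_, ?_⟩
    · intro i n
      refine ⟨_, hrep (1 + n), ?_⟩
      set r := (i % (v.length : ℤ)).toNat with hr
      have hrl : r < v.length := hmod i
      have hir : ∀ k : ℕ, x (i + k) = x ((r + k : ℕ) : ℤ) := by
        intro k
        rw [← hxper ((r + k : ℕ) : ℤ) (i / v.length)]
        congr 1
        have h1 := Int.emod_nonneg i (b := (v.length : ℤ)) (by omega)
        have h2 := Int.emod_add_mul_ediv i (v.length : ℤ)
        have h3 : (r : ℤ) = i % (v.length : ℤ) := by omega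
        push_cast
        rw [h3]
        linarith
      have hlen : r + n ≤ (1 + n) * v.length := by nlinarith
      have e : List.ofFn (fun k : Fin n => x (i + (k : ℕ))) =
          ((List.ofFn fun k : Fin ((1 + n) * v.length) => x (k : ℕ)).drop r).take n := by
        refine List.ext_getElem (by simp; omega) fun k h1 h2 => ?_
        simp [hir]
      rw [e]
      exact (List.take_prefix _ _).isInfix.trans (List.drop_suffix _ _).isInfix
    · obtain ⟨p, q, hpq⟩ := hwv
      refine ⟨p.length, fun k hk => ?_⟩
      have hlt : p.length + k < v.length := by
        rw [← hpq]
        simp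
        omega
      have h1 := hx (p.length + k) hlt
      push_cast at h1
      rw [h1]
      simp only [← hpq]
      simp [hk]

end General

/-- The word `0 1^n`. -/
def gapWord (n : ℕ) : List (Fin 2) :=
  0 :: List.replicate n 1

/-- The `S`-gap shift: the coded subshift over `{0, 1}` generated by `{0 1^n | n ∈ S}`. -/
def gapShift (S : Set ℕ) : Subshift (Fin 2) ℤ :=
  codedSubshift {w : List (Fin 2) | ∃ n ∈ S, w = gapWord n}

theorem gapShift_isCodedBy {S : Set ℕ} (hS : S.Nonempty) :
    IsCodedBy (gapShift S) {w : List (Fin 2) | ∃ n ∈ S, w = gapWord n} := by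
  obtain ⟨n, hn⟩ := hS
  refine codedSubshift_isCodedBy ⟨gapWord n, n, hn, rfl⟩ ?_
  rintro ⟨m, -, h⟩
  simp [gapWord] at h

end SoficAut

/-! The groups differ in how large the centralizer of a finite set of elements must be. If `Z` is
infinite, transitive and sofic, some finite subset of `Aut Z` has a centralizer without elements of
large prime order (`exists_finite_centralizer`). If `X_S` is not sofic, every finite subset of `Aut
X_S` commutes, for each `ℓ ≥ 2`, with some `a ≠ 1` such that `a ^ ℓ = 1` (`exists_pow_eq_one`). An
isomorphism would carry one property to the other. If `Z` is finite, so is `Aut Z`, while `Aut X_S`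
has elements of every prime order.

Both sides use gates: given a family of exchangeable words that overlap at most in their end markers
(`Code`), a reversible rule on the sequence of their indices induces an automorphism (`Rule.gate`).

Sofic side. A word with minimal follower set is synchronizing; in an infinite transitive shift it
has two different return words, and these encode any finite alphabet in freely concatenable blocks
(`exists_code`, `MarkerCode`). Take the alphabet `ZMod M × ZMod M`, two tracks. Let `a` have large
prime order and commute with the letter permutations, the conveyor belt, the gate acting on ends of
runs, and all two-word swaps of bounded length. Periodic points of one fixed period are too few to
be moved by `a`, so `a` fixes the zero point. The gates force `a` to act additively and identically
on both tracks of finitely supported coded points, hence as a power of the shift (`exists_shift`),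
which is trivial because `a` has finite order. So `a` fixes all concatenations of blocks. Points
with a finite uncoded gap are fixed by induction on the gap: by soficity a stretch of bounded length
at the edge of the gap can be exchanged for one with the same followers that starts with a block
(`fix_refill`), once the belt has carried the disturbing letters away (`fix_of_forall_refill`). Such
points are dense.

Gap side. Non-soficity means that `S` is not eventually periodic, so no nonzero translation maps the
large elements of `S` into `S` (`eq_zero_of_add_mem`). An automorphism would translate long runs of
ones if it moved their two ends by different amounts; hence it moves all long runs rigidly by one
common shift (`exists_shift_run_iff`). A gate whose code words consist of sufficiently long runs
therefore commutes with any given finite set, and rotating `ℓ` such words has order `ℓ`. -/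

namespace SoficAut

open SymbolicDynamics.FullShift

/-! ### Occurrences of words and membership in a subshift -/

section Words

variable {A : Type*}

/-- The word `w` occurs in `x` at position `i`. -/
def At (x : ℤ → A) (i : ℤ) (w : List A) : Prop :=
  ∀ (k : ℕ) (hk : k < w.length), x (i + k) = w[k]

theorem at_nil (x : ℤ → A) (i : ℤ) : At x i [] := fun k hk => by simp at hk

theorem at_append {x : ℤ → A} {i : ℤ} {u v : List A} :
    At x i (u ++ v) ↔ At x i u ∧ At x (i + u.length) v := by
  constructor
  · intro h
    refine ⟨fun k hk => ?_, fun k hk => ?_⟩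
    · rw [h k (by simp; omega), List.getElem_append_left hk]
    · have := h (u.length + k) (by simp; omega)
      rw [List.getElem_append_right (by omega)] at this
      simp only [Nat.add_sub_cancel_left] at this
      rw [← this]
      push_cast
      rw [add_assoc]
  · rintro ⟨h1, h2⟩ k hk
    by_cases h : k < u.length
    · rw [List.getElem_append_left h, h1 k h]
    · rw [List.getElem_append_right (by omega), ← h2 (k - u.length) (by simp at hk; omega)]
      congr 1
      omega

theorem At.congr {x y : ℤ → A} {i : ℤ} {w : List A} (h : At x i w)
    (hxy : ∀ p, i ≤ p → p < i + w.length → y p = x p) : At y i w := by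
  intro k hk
  rw [hxy _ (by omega) (by omega), h k hk]

theorem At.unique {x : ℤ → A} {i : ℤ} {u v : List A} (hu : At x i u) (hv : At x i v)
    (h : u.length = v.length) : u = v :=
  List.ext_getElem h fun k h1 h2 => by rw [← hu k h1, ← hv k h2]

theorem At.eq {x y : ℤ → A} {i j : ℤ} {w : List A} (hx : At x i w) (hy : At y j w) {a : ℤ}
    (h0 : 0 ≤ a) (h1 : a < w.length) : x (i + a) = y (j + a) := by
  lift a to ℕ using h0
  rw [hx a (by omega), hy a (by omega)]

/-- The word of length `n` at position `i`. -/
def window (x : ℤ → A) (i : ℤ) (n : ℕ) : List A := List.ofFn fun k : Fin n => x (i + (k : ℕ))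

@[simp] theorem length_window (x : ℤ → A) (i : ℤ) (n : ℕ) : (window x i n).length = n := by
  simp [window]

theorem at_window (x : ℤ → A) (i : ℤ) (n : ℕ) : At x i (window x i n) := fun k hk => by
  simp [window]

theorem At.eq_window {x : ℤ → A} {i : ℤ} {w : List A} (h : At x i w) : w = window x i w.length :=
  h.unique (at_window _ _ _) (by simp)

theorem window_add (x : ℤ → A) (i : ℤ) (m n : ℕ) :
    window x i (m + n) = window x i m ++ window x (i + m) n := by
  refine At.unique (at_window x i _) (at_append.2 ⟨at_window x i m, ?_⟩) (by simp)
  simpa using at_window x (i + m) n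

theorem at_shift {x : ℤ → A} {s i : ℤ} {w : List A} :
    At (shift s x) i w ↔ At x (s + i) w := by
  simp [At, add_assoc]

end Words

section Language

variable {A : Type*} [TopologicalSpace A] {X : Subshift A ℤ}

theorem mem_language {w : List A} : w ∈ language X ↔ ∃ x ∈ X.carrier, ∃ i, At x i w := Iff.rfl

theorem mem_language_mid {u v w : List A} (h : u ++ v ++ w ∈ language X) : v ∈ language X := by
  obtain ⟨x, hx, i, hi⟩ := h
  exact ⟨x, hx, _, (at_append.1 (at_append.1 hi).1).2⟩

theorem mem_language_left {u v : List A} (h : u ++ v ∈ language X) : u ∈ language X :=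
  mem_language_mid (u := []) (w := v) (by simpa using h)

theorem mem_language_right {u v : List A} (h : u ++ v ∈ language X) : v ∈ language X :=
  mem_language_mid (u := u) (w := []) (by simpa using h)

theorem window_mem_language {x : ℤ → A} (hx : x ∈ X.carrier) (i : ℤ) (n : ℕ) :
    window x i n ∈ language X := ⟨x, hx, i, at_window x i n⟩

theorem mem_carrier_of_agree {x : ℤ → A}
    (h : ∀ N : ℕ, ∃ y ∈ X.carrier, ∀ p : ℤ, -N ≤ p → p ≤ N → y p = x p) : x ∈ X.carrier := by
  choose y hy hyx using h
  refine X.isClosed.mem_of_tendsto (f := y) (b := Filter.atTop) ?_ (Filter.Eventually.of_forall hy)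
  rw [tendsto_pi_nhds]
  intro p
  refine tendsto_const_nhds.congr' ?_
  filter_upwards [Filter.eventually_ge_atTop p.natAbs] with N hN
  exact (hyx N p (by omega) (by omega)).symm

theorem mem_carrier_of_window {x : ℤ → A} (i : ℤ) (m : ℕ)
    (h : ∀ N : ℕ, window x (i - N) (N + m + N) ∈ language X) : x ∈ X.carrier := by
  refine mem_carrier_of_agree fun N => ?_
  set M : ℕ := N + i.natAbs + 1 with hM
  obtain ⟨y, hy, j, hj⟩ := mem_language.1 (h M)
  refine ⟨shift (j - (i - M)) y, X.mapsTo _ hy, fun p h1 h2 => ?_⟩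
  have := hj.eq (at_window x (i - M) (M + m + M)) (a := p - (i - M)) (by omega)
    (by simp; omega)
  rw [shift_apply]
  convert this using 2 <;> ring

/-- By closedness it suffices to look at windows around the replaced word, and for these the
exchange is possible in the language. This turns exchangeability of finite words into
exchangeability in points. -/
theorem mem_carrier_of_replace {x y : ℤ → A} (hx : x ∈ X.carrier) {i : ℤ} {u v : List A}
    (hu : At x i u) (hv : At y i v) (huv : u.length = v.length)
    (hoff : ∀ p, p < i ∨ i + u.length ≤ p → y p = x p)
    (h : ∀ a b, a ++ u ++ b ∈ language X → a ++ v ++ b ∈ language X) : y ∈ X.carrier := by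
  refine mem_carrier_of_window i u.length fun N => ?_
  have e : ∀ z : ℤ → A, ∀ w : List A, At z i w → w.length = u.length →
      window z (i - N) (N + u.length + N) =
        window z (i - N) N ++ w ++ window z (i + u.length) N := by
    intro z w hw hl
    rw [window_add, window_add, hw.eq_window, hl]
    congr 2
    · congr 1
      ring
    · push_cast
      ring
  have e2 : ∀ j : ℤ, (∀ p, j ≤ p → p < j + N → y p = x p) → window y j N = window x j N := by
    intro j hj
    refine At.unique (at_window y j N) ?_ (by simp)
    exact (at_window x j N).congr (by simpa using hj)
  rw [e y v hv huv.symm, e2 _ fun p h1 h2 => hoff p (by omega),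
    e2 _ fun p h1 h2 => hoff p (by omega)]
  apply h
  rw [← e x u hu rfl]
  exact window_mem_language hx _ _

end Language

/-! ### Local maps and automorphisms -/

section Local

variable {A : Type*} [TopologicalSpace A] {X : Subshift A ℤ}

/-- The value of `F x` at a position depends only on `x` within distance `R` of it. -/
def IsLocal (R : ℕ) (F : X.carrier → X.carrier) : Prop :=
  ∀ (x y : X.carrier) (p : ℤ), (∀ q, p - R ≤ q → q ≤ p + R → x.1 q = y.1 q) →
    (F x).1 p = (F y).1 p

theorem IsCellularAutomaton.exists_isLocal {F : X.carrier → X.carrier}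
    (h : IsCellularAutomaton X F) : ∃ R, IsLocal R F := by
  obtain ⟨m, a, hma, f, hf⟩ := h
  refine ⟨m.natAbs + a.natAbs, fun x y p hxy => ?_⟩
  rw [hf, hf]
  congr 1
  funext j
  have := j.2
  simp only [Set.mem_Icc] at this
  exact hxy _ (by omega) (by omega)

theorem IsLocal.mono {R R' : ℕ} {F : X.carrier → X.carrier} (h : IsLocal R F) (hR : R ≤ R') :
    IsLocal R' F := fun x y p hxy => h x y p fun q h1 h2 => hxy q (by omega) (by omega)

theorem IsLocal.isCellularAutomaton {R : ℕ} {F : X.carrier → X.carrier} (h : IsLocal R F)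
    (hs : ∀ g x, F (shiftOn X g x) = shiftOn X g (F x)) : IsCellularAutomaton X F := by
  classical
  refine ⟨-R, R, by omega, fun p =>
    if h : ∃ y : X.carrier, ∀ j : Set.Icc (-(R : ℤ)) R, y.1 j = p j then (F h.choose).1 0
    else p ⟨0, by simp⟩, fun x i => ?_⟩
  have h' : ∃ y : X.carrier, ∀ j : Set.Icc (-(R : ℤ)) R, y.1 j = x.1 (i + j) :=
    ⟨shiftOn X i x, fun j => rfl⟩
  beta_reduce
  rw [dif_pos h']
  have e1 : (F x).1 i = (F (shiftOn X i x)).1 0 := by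
    rw [hs]
    simp [shiftOn]
  rw [e1]
  refine h _ _ _ fun q h1 h2 => ?_
  exact (h'.choose_spec ⟨q, by simp; omega⟩).symm

variable [DiscreteTopology A] [Finite A]

/-- The automorphism given by a local, shift-commuting map with an inverse. -/
def mkAut {R : ℕ} (F G : X.carrier → X.carrier) (hF : IsLocal R F)
    (hs : ∀ g x, F (shiftOn X g x) = shiftOn X g (F x)) (hGF : ∀ x, G (F x) = x)
    (hFG : ∀ x, F (G x) = x) : Aut X :=
  ⟨⟨F, G, hGF, hFG⟩, hF.isCellularAutomaton hs⟩

theorem Aut.exists_isLocal (a : Aut X) : ∃ R, IsLocal R a.1 :=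
  IsCellularAutomaton.exists_isLocal a.2

theorem Aut.shift_comm (a : Aut X) (g : ℤ) (x : X.carrier) :
    a.1 (shiftOn X g x) = shiftOn X g (a.1 x) :=
  IsCellularAutomaton.shift_comm a.2 g x

end Local

/-! ### Exchangeable code words with controlled overlaps -/

/-- A family of words `k ++ m ℓ ++ z` of the same length that can be exchanged for each other in
words of `L`, and two occurrences of which overlap at most in an end part `z` and an initial
part `k`. -/
structure Code {B : Type*} (L : Language B) (Λ : Type*) where
  k : List B
  z : List B
  m : Λ → List B
  n : ℕ
  length_m : ∀ ℓ, (m ℓ).length = n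
  length_z : z.length = k.length
  inj : Function.Injective m
  sep : ∀ (x : ℤ → B) (i j : ℤ) (ℓ ℓ' : Λ), At x i (k ++ m ℓ ++ z) → At x j (k ++ m ℓ' ++ z) →
    i < j → i + k.length + n ≤ j
  swap : ∀ (a b : List B) (ℓ ℓ' : Λ), a ++ (k ++ m ℓ ++ z) ++ b ∈ L → a ++ (k ++ m ℓ' ++ z) ++ b ∈ L

namespace Code

variable {B : Type*} {L : Language B} {Λ : Type*} (C : Code L Λ)

/-- The code words. -/
def cw (ℓ : Λ) : List B := C.k ++ C.m ℓ ++ C.z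

theorem length_cw (ℓ : Λ) : (C.cw ℓ).length = C.k.length + C.n + C.k.length := by
  simp [cw, C.length_m, C.length_z, add_assoc]

theorem cw_inj {x : ℤ → B} {i : ℤ} {ℓ ℓ' : Λ} (h : At x i (C.cw ℓ)) (h' : At x i (C.cw ℓ')) :
    ℓ = ℓ' := by
  have := h.unique h' (by rw [C.length_cw, C.length_cw])
  refine C.inj ?_
  simpa [cw] using this

open Classical in
/-- The index of the code word that occurs in `x` at position `i`, if any. -/
noncomputable def ty (x : ℤ → B) (i : ℤ) : Option Λ :=
  if h : ∃ ℓ, At x i (C.cw ℓ) then some h.choose else none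

theorem ty_eq_some {x : ℤ → B} {i : ℤ} {ℓ : Λ} : C.ty x i = some ℓ ↔ At x i (C.cw ℓ) := by
  unfold ty
  split_ifs with h
  · constructor
    · intro e
      rw [← Option.some.inj e]
      exact h.choose_spec
    · intro e
      rw [C.cw_inj h.choose_spec e]
  · simp only [false_iff]
    exact fun e => h ⟨ℓ, e⟩

theorem isSome_ty {x : ℤ → B} {i : ℤ} : (C.ty x i).isSome ↔ ∃ ℓ, At x i (C.cw ℓ) := by
  simp [Option.isSome_iff_exists, ty_eq_some]

theorem ty_congr {x y : ℤ → B} {i : ℤ}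
    (h : ∀ p, i ≤ p → p < i + C.k.length + C.n + C.k.length → y p = x p) : C.ty y i = C.ty x i := by
  refine Option.ext fun ℓ => ?_
  rw [ty_eq_some, ty_eq_some]
  have hl := C.length_cw ℓ
  exact ⟨fun e => e.congr fun p h1 h2 => (h p h1 (by omega)).symm,
    fun e => e.congr fun p h1 h2 => h p h1 (by omega)⟩

theorem ty_shift (x : ℤ → B) (s : ℤ) : C.ty (shift s x) = shift s (C.ty x) := by
  funext i
  refine Option.ext fun ℓ => ?_
  rw [ty_eq_some, at_shift, shift_apply, ty_eq_some]

theorem sep' {x : ℤ → B} {i j : ℤ} (hi : (C.ty x i).isSome) (hj : (C.ty x j).isSome)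
    (hij : i < j) : i + C.k.length + C.n ≤ j := by
  obtain ⟨ℓ, hi⟩ := C.isSome_ty.1 hi
  obtain ⟨ℓ', hj⟩ := C.isSome_ty.1 hj
  exact C.sep x i j ℓ ℓ' hi hj hij

/-- The position `p` belongs to the middle part of the code word at `i`. -/
def Mid (x : ℤ → B) (i p : ℤ) : Prop :=
  (C.ty x i).isSome ∧ i + C.k.length ≤ p ∧ p < i + C.k.length + C.n

variable {C}

theorem Mid.unique {x : ℤ → B} {i j p : ℤ} (hi : C.Mid x i p) (hj : C.Mid x j p) : i = j := by
  obtain ⟨hi, h1, h2⟩ := hi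
  obtain ⟨hj, h3, h4⟩ := hj
  rcases lt_trichotomy i j with h | h | h
  · have := C.sep' hi hj h
    omega
  · exact h
  · have := C.sep' hj hi h
    omega

variable (C)

open Classical in
/-- Replace the middle parts of the code words in `x` as prescribed by `t`. -/
noncomputable def put (x : ℤ → B) (t : ℤ → Option Λ) (p : ℤ) : B :=
  if h : ∃ i, C.Mid x i p then
    (t h.choose).elim (x p) fun ℓ => (C.m ℓ).getD (p - h.choose - C.k.length).toNat (x p)
  else x p

variable {C}

theorem put_off {x : ℤ → B} {t : ℤ → Option Λ} {p : ℤ} (h : ∀ i, ¬ C.Mid x i p) :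
    C.put x t p = x p := by
  rw [put, dif_neg (by simpa using h)]

theorem put_of_mid {x : ℤ → B} {t : ℤ → Option Λ} {i p : ℤ} (h : C.Mid x i p) :
    C.put x t p =
      (t i).elim (x p) fun ℓ => (C.m ℓ).getD (p - i - C.k.length).toNat (x p) := by
  have h' : ∃ i, C.Mid x i p := ⟨i, h⟩
  rw [put, dif_pos h', h'.choose_spec.unique h]

theorem put_mid {x : ℤ → B} {t : ℤ → Option Λ} {i p : ℤ} {ℓ : Λ} (h : C.Mid x i p)
    (ht : t i = some ℓ) (a : ℕ) (ha : a < (C.m ℓ).length) (hp : p = i + C.k.length + a) :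
    C.put x t p = (C.m ℓ)[a] := by
  rw [put_of_mid h, ht]
  have : (p - i - C.k.length).toNat = a := by omega
  simp [this, ha]

theorem put_congr {x : ℤ → B} {t t' : ℤ → Option Λ} {p : ℤ}
    (h : ∀ i, C.Mid x i p → t i = t' i) : C.put x t p = C.put x t' p := by
  by_cases h' : ∃ i, C.Mid x i p
  · obtain ⟨i, hi⟩ := h'
    rw [put_of_mid hi, put_of_mid hi, h i hi]
  · rw [put_off (by simpa using h'), put_off (by simpa using h')]

theorem put_congr' {x y : ℤ → B} {t t' : ℤ → Option Λ} {p : ℤ}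
    (h : ∀ i, p - C.k.length - C.n ≤ i → i ≤ p →
      ((C.ty x i).isSome ↔ (C.ty y i).isSome) ∧ t i = t' i) (hp : x p = y p) :
    C.put x t p = C.put y t' p := by
  have hm : ∀ i, C.Mid x i p ↔ C.Mid y i p := by
    intro i
    by_cases hi : p - C.k.length - C.n ≤ i ∧ i ≤ p
    · simp only [Mid, h i hi.1 hi.2]
    · simp only [Mid]
      constructor <;> rintro ⟨-, h1, h2⟩ <;> omega
  by_cases h' : ∃ i, C.Mid x i p
  · obtain ⟨i, hi⟩ := h'
    rw [put_of_mid hi, put_of_mid ((hm i).1 hi), hp,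
      (h i (by have := hi.2; omega) (by have := hi.2; omega)).2]
  · rw [put_off (by simpa using h'), put_off (by simpa [hm] using h'), hp]

theorem put_self (x : ℤ → B) : C.put x (C.ty x) = x := by
  funext p
  by_cases h' : ∃ i, C.Mid x i p
  · obtain ⟨i, hi⟩ := h'
    obtain ⟨ℓ, hℓ⟩ := Option.isSome_iff_exists.1 hi.1
    have h2 := hi.2
    have hl := C.length_m ℓ
    rw [put_mid hi hℓ (p - i - C.k.length).toNat (by omega) (by omega)]
    have := (at_append.1 (at_append.1 (C.ty_eq_some.1 hℓ)).1).2 (p - i - C.k.length).toNat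
      (by omega)
    rw [← this]
    congr 1
    omega
  · rw [put_off (by simpa using h')]

theorem at_put {x : ℤ → B} {t : ℤ → Option Λ} {i : ℤ} {ℓ : Λ} (hi : (C.ty x i).isSome)
    (ht : t i = some ℓ) : At (C.put x t) i (C.cw ℓ) := by
  obtain ⟨ℓ₀, h0⟩ := C.isSome_ty.1 hi
  have hz := C.length_z
  have hm := C.length_m
  rw [cw, at_append, at_append] at h0 ⊢
  refine ⟨⟨h0.1.1.congr fun p h1 h2 => put_off fun j hj => ?_, fun a ha => ?_⟩,
    ?_⟩
  · obtain ⟨hj, h3, h4⟩ := hj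
    rcases lt_trichotomy i j with h | h | h
    · omega
    · omega
    · have := C.sep' hj hi h
      omega
  · exact put_mid ⟨hi, by omega, by have := hm ℓ; omega⟩ ht a ha rfl
  · have h2 := h0.2
    have e : (i + ((C.k ++ C.m ℓ).length : ℕ) : ℤ) = i + (C.k ++ C.m ℓ₀).length := by
      simp [hm]
    rw [e]
    refine h2.congr fun p h1 h2 => put_off fun j hj => ?_
    obtain ⟨hj, h3, h4⟩ := hj
    simp only [List.length_append, hm, hz] at h1 h2
    push_cast at h1 h2
    rcases lt_trichotomy i j with h | h | h
    · have := C.sep' hi hj h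
      omega
    · omega
    · have := C.sep' hj hi h
      omega

/-- `t` is defined exactly at the occurrences of code words. -/
def Fits (C : Code L Λ) (x : ℤ → B) (t : ℤ → Option Λ) : Prop :=
  ∀ i, (t i).isSome ↔ (C.ty x i).isSome

/-- Recoding creates no new code words. One that meets a rewritten middle part would overlap the
code word now present there more than `sep` allows; one that meets none was already in `x`. Hence
recodings compose like the index sequences. -/
theorem ty_put {x : ℤ → B} {t : ℤ → Option Λ} (ht : C.Fits x t) : C.ty (C.put x t) = t := by
  funext i
  by_cases hi : (t i).isSome
  · obtain ⟨ℓ, hℓ⟩ := Option.isSome_iff_exists.1 hi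
    rw [hℓ, ty_eq_some]
    exact at_put ((ht i).1 hi) hℓ
  · have hi' := hi
    rw [Option.not_isSome_iff_eq_none] at hi
    rw [hi]
    by_contra hne
    have hs : (C.ty (C.put x t) i).isSome := Option.isSome_iff_ne_none.2 hne
    by_cases hmid : ∃ p j, i ≤ p ∧ p < i + C.k.length + C.n + C.k.length ∧ C.Mid x j p
    · obtain ⟨p, j, h1, h2, hj⟩ := hmid
      have hj' : (C.ty (C.put x t) j).isSome := by
        obtain ⟨ℓ, hℓ⟩ := Option.isSome_iff_exists.1 ((ht j).2 hj.1)
        exact C.isSome_ty.2 ⟨ℓ, at_put hj.1 hℓ⟩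
      have h3 := hj.2
      rcases lt_trichotomy i j with h | h | h
      · have := C.sep' hs hj' h
        omega
      · subst h
        exact hi' ((ht i).2 hj.1)
      · have := C.sep' hj' hs h
        omega
    · push Not at hmid
      rw [C.ty_congr fun p h1 h2 => put_off fun j => hmid p j h1 h2] at hs
      exact hi' ((ht i).2 hs)

theorem fits_ty (x : ℤ → B) : C.Fits x (C.ty x) := fun _ => Iff.rfl

theorem put_put {x : ℤ → B} {t t' : ℤ → Option Λ} (ht : C.Fits x t) (ht' : C.Fits x t') :
    C.put (C.put x t) t' = C.put x t' := by
  have hmid : ∀ i p, C.Mid (C.put x t) i p ↔ C.Mid x i p := by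
    intro i p
    rw [Mid, Mid, ty_put ht, ht i]
  funext p
  by_cases h' : ∃ i, C.Mid x i p
  · obtain ⟨i, hi⟩ := h'
    obtain ⟨ℓ, hℓ⟩ := Option.isSome_iff_exists.1 ((ht' i).2 hi.1)
    have h2 := hi.2
    have hl := C.length_m ℓ
    rw [put_mid hi hℓ (p - i - C.k.length).toNat (by omega) (by omega),
      put_mid ((hmid i p).2 hi) hℓ (p - i - C.k.length).toNat (by omega) (by omega)]
  · rw [put_off (by simpa [hmid] using h'), put_off (by simpa using h'),
      put_off (by simpa using h')]

theorem put_shift (x : ℤ → B) (t : ℤ → Option Λ) (s : ℤ) :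
    C.put (shift s x) (shift s t) = shift s (C.put x t) := by
  have hmid : ∀ i p, C.Mid (shift s x) i p ↔ C.Mid x (s + i) (s + p) := by
    intro i p
    rw [Mid, Mid, ty_shift, shift_apply]
    constructor
    · rintro ⟨h1, h2, h3⟩
      exact ⟨h1, by omega, by omega⟩
    · rintro ⟨h1, h2, h3⟩
      exact ⟨h1, by omega, by omega⟩
  funext p
  rw [shift_apply]
  by_cases h' : ∃ i, C.Mid x i (s + p)
  · obtain ⟨i, hi⟩ := h'
    have hi' : C.Mid (shift s x) (i - s) p := by
      rw [hmid]
      simpa using hi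
    rw [put_of_mid hi', put_of_mid hi]
    have e1 : s + (i - s) = i := by ring
    have e2 : p - (i - s) - C.k.length = s + p - i - C.k.length := by ring
    simp only [shift_apply, e1, e2]
  · rw [put_off (x := shift s x) fun i hi => h' ⟨_, (hmid i p).1 hi⟩,
      put_off (x := x) (by simpa using h'), shift_apply]

section Carrier

variable [TopologicalSpace B] {X : Subshift B ℤ} {C : Code (language X) Λ}

/-- Exchange the code words one at a time at finitely many positions, then pass to the limit, as `X`
is closed. -/
theorem put_mem {x : ℤ → B} {t : ℤ → Option Λ} (hx : x ∈ X.carrier) (ht : C.Fits x t) :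
    C.put x t ∈ X.carrier := by
  classical
  let tS : Finset ℤ → ℤ → Option Λ := fun S j => if j ∈ S then t j else C.ty x j
  have hfit : ∀ S, C.Fits x (tS S) := by
    intro S i
    simp only [tS]
    split_ifs
    · exact ht i
    · rfl
  have key : ∀ S, C.put x (tS S) ∈ X.carrier := by
    intro S
    induction S using Finset.induction_on with
    | empty =>
      have : tS ∅ = C.ty x := by funext j; simp [tS]
      rw [this, put_self]
      exact hx
    | insert i S hiS ih =>
      by_cases hi : (C.ty x i).isSome
      · obtain ⟨ℓ, hℓ⟩ := Option.isSome_iff_exists.1 ((hfit S i).2 hi)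
        obtain ⟨ℓ', hℓ'⟩ := Option.isSome_iff_exists.1 ((hfit (insert i S) i).2 hi)
        refine mem_carrier_of_replace ih (at_put hi hℓ) (at_put hi hℓ')
          (by rw [C.length_cw, C.length_cw]) ?_ fun a b h => C.swap a b ℓ ℓ' h
        intro p hp
        rw [C.length_cw] at hp
        refine put_congr fun j hj => ?_
        have : j ≠ i := by
          rintro rfl
          have := hj.2
          omega
        simp [tS, this]
      · convert ih using 2
        funext j
        simp only [tS, Finset.mem_insert]
        by_cases hj : j = i
        · subst hj
          have h1 : t j = none := by
            rw [← Option.not_isSome_iff_eq_none, ht j]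
            exact hi
          have h2 : C.ty x j = none := by
            rwa [← Option.not_isSome_iff_eq_none]
          simp [h1, h2]
        · simp [hj]
  refine mem_carrier_of_agree fun N => ⟨_, key (Finset.Icc (-(N + C.k.length + C.n : ℕ)) N), ?_⟩
  intro p h1 h2
  refine put_congr fun i hi => ?_
  have := hi.2
  simp only [tS]
  rw [if_pos]
  rw [Finset.mem_Icc]
  push_cast
  constructor <;> omega

end Carrier

end Code

/-! ### Automorphisms induced by rules on code words -/

/-- A reversible shift-commuting local rule that recodes partially defined sequences. -/
structure Rule (Λ : Type*) where
  f : (ℤ → Option Λ) → ℤ → Option Λ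
  g : (ℤ → Option Λ) → ℤ → Option Λ
  gf : ∀ t, g (f t) = t
  fg : ∀ t, f (g t) = t
  dom : ∀ t i, (f t i).isSome ↔ (t i).isSome
  comm : ∀ s t, f (shift s t) = shift s (f t)
  r : ℕ
  loc : ∀ (t t' : ℤ → Option Λ) (i : ℤ), (∀ j, i - r ≤ j → j ≤ i + r → t j = t' j) → f t i = f t' i

namespace Rule

variable {Λ : Type*} (ρ : Rule Λ)

theorem dom_g (t : ℤ → Option Λ) (i : ℤ) : (ρ.g t i).isSome ↔ (t i).isSome := by
  conv_rhs => rw [← ρ.fg t]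
  rw [ρ.dom]

section Gate

variable {B : Type*} [TopologicalSpace B] {X : Subshift B ℤ} (C : Code (language X) Λ)

theorem fits_f (x : ℤ → B) : C.Fits x (ρ.f (C.ty x)) := fun i => ρ.dom _ i

theorem fits_g (x : ℤ → B) : C.Fits x (ρ.g (C.ty x)) := fun i => ρ.dom_g _ i

variable [DiscreteTopology B] [Finite B]

/-- The automorphism that recodes the code words by the rule `ρ`. -/
noncomputable def gate : Aut X :=
  -- A letter is affected by code words starting at most one word length to its left, the rule looks
  -- `ρ.r` further, and recognizing a code word takes another word length.
  mkAut (R := 2 * (C.k.length + C.n + C.k.length) + ρ.r)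
    (fun x => ⟨C.put x.1 (ρ.f (C.ty x.1)), Code.put_mem x.2 (ρ.fits_f C x.1)⟩)
    (fun x => ⟨C.put x.1 (ρ.g (C.ty x.1)), Code.put_mem x.2 (ρ.fits_g C x.1)⟩)
    (by
      intro x y p hxy
      refine Code.put_congr' (fun i h1 h2 => ?_) (hxy p (by omega) (by omega))
      have hty : ∀ j, i - ρ.r ≤ j → j ≤ i + ρ.r → C.ty x.1 j = C.ty y.1 j := by
        intro j h3 h4
        refine C.ty_congr fun q h5 h6 => hxy q ?_ ?_ <;> push_cast <;> omega
      exact ⟨by rw [hty i (by omega) (by omega)], ρ.loc _ _ _ hty⟩)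
    (by
      intro s x
      apply Subtype.ext
      simp only [shiftOn, C.ty_shift, ρ.comm, Code.put_shift])
    (by
      intro x
      apply Subtype.ext
      simp only [Code.ty_put (ρ.fits_f C x.1), ρ.gf]
      rw [Code.put_put (ρ.fits_f C x.1) (Code.fits_ty _), Code.put_self])
    (by
      intro x
      apply Subtype.ext
      simp only [Code.ty_put (ρ.fits_g C x.1), ρ.fg]
      rw [Code.put_put (ρ.fits_g C x.1) (Code.fits_ty _), Code.put_self])

theorem gate_apply (x : X.carrier) : ((ρ.gate C).1 x).1 = C.put x.1 (ρ.f (C.ty x.1)) := rfl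

theorem gate_put {x : ℤ → B} {t : ℤ → Option Λ} (ht : C.Fits x t) (y : X.carrier)
    (hy : y.1 = C.put x t) : ((ρ.gate C).1 y).1 = C.put x (ρ.f t) := by
  have h : C.Fits x (ρ.f t) := fun i => by rw [ρ.dom, ht i]
  rw [gate_apply, hy, Code.ty_put ht, Code.put_put ht h]

theorem ty_gate (x : X.carrier) : C.ty ((ρ.gate C).1 x).1 = ρ.f (C.ty x.1) := by
  rw [gate_apply, Code.ty_put (ρ.fits_f C x.1)]

end Gate

end Rule

/-! ### Synchronizing words and return words -/

/-- A synchronizing word: what may precede it and what may follow it are independent. -/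
def Sync {B : Type*} (L : Language B) (g : List B) : Prop :=
  ∀ a b, a ++ g ∈ L → g ++ b ∈ L → a ++ g ++ b ∈ L

section Sync

variable {B : Type*} [TopologicalSpace B] {X : Subshift B ℤ}

theorem Sync.append_right {g : List B} (h : Sync (language X) g) (v : List B) :
    Sync (language X) (g ++ v) := by
  intro a b ha hb
  have := h a (v ++ b) (mem_language_left (v := v) (by simpa using ha)) (by simpa using hb)
  simpa using this

theorem Sync.append_left {g : List B} (h : Sync (language X) g) (v : List B) :
    Sync (language X) (v ++ g) := by
  intro a b ha hb
  have := h (a ++ v) b (by simpa using ha) (mem_language_right (u := v) (by simpa using hb))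
  simpa using this

/-- Soficity gives finitely many follower sets, so some `w` has a minimal one. Extending `w` to the
left can only shrink its follower set, hence leaves it unchanged, which is synchronization. -/
theorem exists_sync (hs : IsSofic X) (hne : X.carrier.Nonempty) :
    ∃ g ∈ language X, g ≠ [] ∧ Sync (language X) g := by
  obtain ⟨x, hx⟩ := hne
  have hfin : ((language X).leftQuotient '' {w | w ∈ language X}).Finite :=
    (Language.IsRegular.finite_range_leftQuotient hs).subset (Set.image_subset_range _ _)
  obtain ⟨M, hM⟩ := hfin.exists_minimal
    ⟨_, Set.mem_image_of_mem _ (window_mem_language hx 0 0)⟩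
  obtain ⟨⟨w, hw, rfl⟩, hmin⟩ := hM
  have hsync : Sync (language X) w := by
    intro a b ha hb
    have hle : (language X).leftQuotient (a ++ w) ≤ (language X).leftQuotient w := by
      intro y hy
      have hy' : a ++ w ++ y ∈ language X := hy
      exact mem_language_right (u := a) (by simpa using hy')
    exact hmin (Set.mem_image_of_mem _ ha) hle hb
  obtain ⟨y, hy, i, hi⟩ := mem_language.1 hw
  -- One more letter is appended only to make the word nonempty; synchronization survives.
  refine ⟨w ++ window y (i + w.length) 1, ⟨y, hy, i, at_append.2 ⟨hi, at_window _ _ _⟩⟩, ?_,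
    hsync.append_right _⟩
  intro h
  have := congrArg List.length h
  simp at this

end Sync

/-- `r` is a return word of `u`: `r ++ u` is a word of `L` that starts with `u` and in which `u`
occurs at the two ends only. -/
structure IsReturn {B : Type*} (L : Language B) (u r : List B) : Prop where
  ne : r ≠ []
  mem : r ++ u ∈ L
  pre : u <+: r ++ u
  next : ∀ (x : ℤ → B) (i j : ℤ), At x i (r ++ u) → At x j u → i < j → i + r.length ≤ j

theorem At.of_prefix {B : Type*} {x : ℤ → B} {i : ℤ} {v w : List B} (h : At x i w) (hv : v <+: w) :
    At x i v := by
  obtain ⟨s, rfl⟩ := hv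
  exact (at_append.1 h).1

section Return

variable {B : Type*} [TopologicalSpace B] {X : Subshift B ℤ} {u : List B}

theorem exists_isReturn {y : ℤ → B} (hy : y ∈ X.carrier) {i j : ℤ} (hi : At y i u)
    (hj : At y j u) (hij : i < j) :
    ∃ r, IsReturn (language X) u r ∧ At y i (r ++ u) ∧ i + r.length ≤ j := by
  classical
  have hex : ∃ d : ℕ, 0 < d ∧ At y (i + d) u :=
    ⟨(j - i).toNat, by omega, by rwa [show i + ((j - i).toNat : ℤ) = j by omega]⟩
  obtain ⟨hd0, hd⟩ := Nat.find_spec hex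
  have hmin := fun m => Nat.find_min hex (m := m)
  have hdj : Nat.find hex ≤ (j - i).toNat :=
    Nat.find_min' hex ⟨by omega, by rwa [show i + ((j - i).toNat : ℤ) = j by omega]⟩
  set d := Nat.find hex
  have hat : At y i (window y i d ++ u) := at_append.2 ⟨at_window y i d, by simpa using hd⟩
  refine ⟨window y i d, ⟨?_, ⟨y, hy, i, hat⟩, ?_, ?_⟩, hat, by simp; omega⟩
  · intro h
    have := congrArg List.length h
    simp at this
    omega
  · have h1 : window y i d ++ u = window y i u.length ++ window y (i + u.length) d := by
      rw [← window_add, hat.eq_window]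
      simp [add_comm]
    rw [h1, ← hi.eq_window]
    exact List.prefix_append _ _
  · intro x i' j' hx hj' hlt
    by_contra hcon
    simp only [length_window, not_le] at hcon
    refine hmin (j' - i').toNat (by omega) ⟨by omega, fun k hk => ?_⟩
    have := hx.eq hat (a := j' - i' + k) (by omega) (by simp; omega)
    rw [← hj' k hk]
    rw [show i + ((j' - i').toNat : ℤ) + k = i + (j' - i' + k) by omega, ← this]
    congr 1
    ring

/-- With a single return word `r`, everything between two occurrences of `u` has period `r.length`.
By transitivity every word lies between two occurrences of `u`, so all points share this period and
there are finitely many. -/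
theorem finite_of_unique_return [Finite B] (hX : IsTransitive X) (hu : u ∈ language X)
    (huniq : ∀ r r', IsReturn (language X) u r → IsReturn (language X) u r' → r = r') :
    X.carrier.Finite ∨ u = [] := by
  by_cases hu0 : u = []
  · exact Or.inr hu0
  left
  obtain ⟨w, -, hw⟩ := hX u hu u hu
  obtain ⟨y, hy, i, hi⟩ := mem_language.1 hw
  have h1 := (at_append.1 (at_append.1 hi).1).1
  have h2 := (at_append.1 hi).2
  have hpos : 0 < u.length := List.length_pos_iff.2 hu0
  obtain ⟨r, hr, -, -⟩ := exists_isReturn hy h1 h2 (by simp; omega)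
  have hr0 : 0 < r.length := List.length_pos_iff.2 hr.ne
  have hper : ∀ n : ℕ, ∀ y ∈ X.carrier, ∀ i j : ℤ, At y i u → At y j u → i ≤ j → j < i + n →
      ∀ p, i ≤ p → p + r.length < j + u.length → y p = y (p + r.length) := by
    intro n
    induction n with
    | zero => intro y hy i j hi hj h1 h2; omega
    | succ n ih =>
      intro y hy i j hi hj hij hn p hp hpj
      rcases hij.lt_or_eq with hlt | rfl
      · obtain ⟨r', hr', hat, hle⟩ := exists_isReturn hy hi hj hlt
        obtain rfl := huniq r r' hr hr'
        have hat2 := (at_append.1 hat).2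
        by_cases hp1 : p < i + u.length
        · have := hi.eq hat2 (a := p - i) (by omega) (by omega)
          convert this using 2 <;> ring
        · by_cases hp2 : p < i + r.length
          · obtain ⟨r', hr', hat', hle'⟩ := exists_isReturn hy hat2 hj (by omega)
            obtain rfl := huniq r r' hr hr'
            have := hat.eq hat' (a := p - i) (by omega) (by simp; omega)
            convert this using 2 <;> ring
          · exact ih y hy _ j hat2 hj hle (by omega) p (by omega) hpj
      -- Only one occurrence of `u` is left: `u` itself has period `r.length`, being a prefix of `r
      -- ++ u`.
      · obtain ⟨z, hz, q, hq⟩ := mem_language.1 hr.mem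
        have h3 := hq.of_prefix hr.pre
        have h4 := (at_append.1 hq).2
        have e1 := h3.eq hi (a := p + r.length - i) (by omega) (by omega)
        have e2 := h4.eq hi (a := p - i) (by omega) (by omega)
        rw [show q + (p + r.length - i) = q + r.length + (p - i) by ring, e2] at e1
        convert e1 using 2 <;> ring
  have hperX : ∀ x ∈ X.carrier, ∀ p, x p = x (p + r.length) := by
    intro x hx p
    obtain ⟨a, -, ha⟩ := hX u hu _ (window_mem_language hx p (r.length + 1))
    obtain ⟨b, -, hb⟩ := hX _ ha u hu
    obtain ⟨y, hy, i, hi⟩ := mem_language.1 hb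
    have h3 := (at_append.1 hi).2
    have h4 := (at_append.1 (at_append.1 hi).1).1
    have h5 := (at_append.1 (at_append.1 h4).1).1
    have h6 := (at_append.1 h4).2
    have h7 := hper ((u ++ a ++ window x p (r.length + 1) ++ b).length + 1) y hy _ _ h5 h3
      (by omega) (by push_cast; omega) (i + (u ++ a).length) (by omega) (by
        simp only [List.length_append, length_window]
        omega)
    have e0 := h6.eq (at_window x p (r.length + 1)) (a := 0) (by omega) (by simp)
    have e1 := h6.eq (at_window x p (r.length + 1)) (a := r.length) (by omega) (by simp)
    simp only [add_zero] at e0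
    rw [← e0, ← e1, h7]
  refine Set.Finite.of_injOn (f := fun x : ℤ → B => fun k : Fin r.length => x (k : ℕ))
    (Set.mapsTo_univ _ _) ?_ Set.finite_univ
  · intro x hx y hy hxy
    have hmul : ∀ x ∈ X.carrier, ∀ (n : ℤ) p, x p = x (p + n * r.length) := by
      intro x hx n
      induction n with
      | zero => simp
      | succ n ih =>
        intro p
        rw [ih p, hperX x hx]
        congr 1
        ring
      | pred n ih =>
        intro p
        rw [ih p, hperX x hx (p + (-(n : ℤ) - 1) * r.length)]
        congr 1
        ring
    funext p
    have h0 : (r.length : ℤ) ≠ 0 := by omega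
    have hlt := Int.emod_lt_of_pos p (b := (r.length : ℤ)) (by omega)
    have hnn := Int.emod_nonneg p h0
    have e : p + -(p / r.length) * r.length = ((p % r.length).toNat : ℤ) := by
      rw [Int.toNat_of_nonneg hnn, Int.emod_def]
      ring
    rw [hmul x hx (-(p / r.length)) p, hmul y hy (-(p / r.length)) p, e]
    exact congrFun hxy ⟨(p % r.length).toNat, by omega⟩

theorem exists_two_returns [Finite B] (hX : IsTransitive X) (hinf : X.carrier.Infinite)
    (hu : u ∈ language X) (hu0 : u ≠ []) :
    ∃ r : Bool → List B, Function.Injective r ∧ ∀ b, IsReturn (language X) u (r b) := by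
  by_contra hcon
  rcases finite_of_unique_return hX hu fun r r' hr hr' => by
    by_contra hne
    refine hcon ⟨fun b => if b then r else r', ?_, ?_⟩
    · intro b b' h
      cases b <;> cases b' <;> simp_all [eq_comm]
    · intro b
      cases b <;> simpa with h | h
  · exact hinf h
  · exact hu0 h

end Return

/-! ### Encoding an arbitrary finite alphabet by return words -/

section BoolWords

/-- A word of `true, true` followed by a single `true` among `K + 1` times `false`. -/
def headWord (K e : ℕ) : List Bool :=
  [true, true] ++ List.replicate (e + 1) false ++ [true] ++ List.replicate (K - e) false

theorem length_headWord {K e : ℕ} (he : e < K) : (headWord K e).length = K + 4 := by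
  simp [headWord]
  omega

theorem headWord_inj {K e e' : ℕ} (h : headWord K e = headWord K e') : e = e' := by
  by_contra hne
  wlog hlt : e < e' generalizing e e'
  · exact this h.symm (Ne.symm hne) (by omega)
  have := congrArg (fun l => l[e + 3]?) h
  simp [headWord, List.getElem?_append, List.getElem?_replicate] at this
  grind

/-- The single `true` is surrounded by `false` on both sides because `e < K`, so `true, true` occurs
at the two ends only. This makes the blocks self-delimiting. -/
theorem headWord_factor {K e : ℕ} {t t' : List Bool} (he : e < K)
    (h : headWord K e ++ [true, true] = t ++ [true, true] ++ t') :
    t = [] ∨ K + 4 ≤ t.length := by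
  by_contra hcon
  push Not at hcon
  obtain ⟨h0, h1⟩ := hcon
  have hpos := List.length_pos_iff.2 h0
  have e1 := congrArg (fun l => l[t.length]?) h
  have e2 := congrArg (fun l => l[t.length + 1]?) h
  have hl := length_headWord he
  simp only [List.append_assoc, List.cons_append, List.nil_append, headWord,
    List.getElem?_append, List.getElem?_replicate, List.length_replicate,
    List.getElem?_cons, List.getElem?_nil] at e1 e2
  grind

end BoolWords

section ReturnWord

variable {B : Type*} {u : List B} {r : Bool → List B}

/-- The concatenation of the words `r b` followed by `u`. -/
def returnWord (u : List B) (r : Bool → List B) (t : List Bool) : List B :=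
  (t.map r).flatten ++ u

theorem returnWord_append (s t : List Bool) :
    returnWord u r (s ++ t) = (s.map r).flatten ++ returnWord u r t := by
  simp [returnWord]

theorem returnWord_cons (b : Bool) (t : List Bool) :
    returnWord u r (b :: t) = r b ++ returnWord u r t := by
  simp [returnWord]

theorem length_flatten_headWord {K e : ℕ} (he : e < K) :
    ((headWord K e).map r).flatten.length = 3 * (r true).length + (K + 1) * (r false).length := by
  have h : K + 1 = (e + 1) + (K - e) := by omega
  conv_rhs => rw [h, add_mul]
  simp [headWord]
  ring

end ReturnWord

section Returns

variable {B : Type*} [TopologicalSpace B] {X : Subshift B ℤ} {u : List B} {r : Bool → List B}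

variable (hr : ∀ b, IsReturn (language X) u (r b))

include hr

theorem prefix_returnWord (t : List Bool) : u <+: returnWord u r t := by
  induction t with
  | nil => simp [returnWord]
  | cons b t ih =>
    rw [returnWord_cons]
    obtain ⟨s, hs⟩ := ih
    rw [← hs, ← List.append_assoc]
    exact (hr b).pre.trans (List.prefix_append _ _)

theorem at_returnWord_of_append {x : ℤ → B} {i : ℤ} {s t : List Bool}
    (h : At x i (returnWord u r (s ++ t))) : At x i (returnWord u r s) := by
  rw [returnWord_append, at_append] at h
  rw [returnWord, at_append]
  exact ⟨h.1, h.2.of_prefix (prefix_returnWord hr t)⟩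

theorem returnWord_mem (hu : u ∈ language X) (hs : Sync (language X) u) (t : List Bool) :
    returnWord u r t ∈ language X := by
  induction t with
  | nil => simpa [returnWord] using hu
  | cons b t ih =>
    rw [returnWord_cons]
    obtain ⟨s, hs'⟩ := prefix_returnWord hr t
    rw [← hs'] at ih ⊢
    rw [← List.append_assoc]
    exact hs _ _ (hr b).mem ih

/-- Since `u` does not occur strictly inside a return word, every occurrence of `u` lies on a
boundary of the factorization. -/
theorem exists_split_of_at {x : ℤ → B} {i j : ℤ} {t : List Bool} (h : At x i (returnWord u r t))
    (hj : At x j u) (h1 : i ≤ j) (h2 : j ≤ i + (t.map r).flatten.length) :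
    ∃ s s', t = s ++ s' ∧ j = i + (s.map r).flatten.length := by
  induction t generalizing i with
  | nil => exact ⟨[], [], rfl, by simpa using le_antisymm (by simpa using h2) h1⟩
  | cons b t ih =>
    rcases h1.eq_or_lt with rfl | hlt
    · exact ⟨[], _, rfl, by simp⟩
    · rw [returnWord_cons, at_append] at h
      have h3 := (hr b).next x i j
        (at_append.2 ⟨h.1, h.2.of_prefix (prefix_returnWord hr t)⟩) hj hlt
      obtain ⟨s, s', rfl, hs⟩ := ih h.2 h3 (by simp at h2 ⊢; omega)
      exact ⟨b :: s, s', rfl, by simp at hs ⊢; omega⟩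

/-- Unique decoding: both first return words end at the next occurrence of `u`, so they have the
same length and coincide. -/
theorem prefix_of_at (hinj : Function.Injective r) {x : ℤ → B} {i : ℤ} {s t : List Bool}
    (ht : At x i (returnWord u r t)) (hs : At x i (returnWord u r s)) (hl : s.length ≤ t.length) :
    s <+: t := by
  induction s generalizing i t with
  | nil => exact List.nil_prefix
  | cons b s ih =>
    cases t with
    | nil => simp at hl
    | cons c t =>
      rw [returnWord_cons, at_append] at ht hs
      have h1 := at_append.2 ⟨ht.1, ht.2.of_prefix (prefix_returnWord hr t)⟩
      have h2 := at_append.2 ⟨hs.1, hs.2.of_prefix (prefix_returnWord hr s)⟩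
      have hb := List.length_pos_iff.2 (hr b).ne
      have hc := List.length_pos_iff.2 (hr c).ne
      have h3 := (hr c).next x i _ h1 (at_append.1 h2).2 (by omega)
      have h4 := (hr b).next x i _ h2 (at_append.1 h1).2 (by omega)
      have h5 : (r b).length = (r c).length := by omega
      obtain rfl := hinj (hs.1.unique ht.1 h5)
      rw [List.cons_prefix_cons]
      exact ⟨rfl, ih ht.2 hs.2 (by simpa using hl)⟩

/-- A letter becomes a head word followed by the marker `g`, with `true` and `false` read as the two
return words. An illegal overlap would decode to a `true, true` inside a head word, contradicting
`headWord_factor`. Exchangeability holds since `g` ends in `u` and so is synchronizing. -/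
theorem exists_code {Λ : Type*} [Finite Λ] (hu : u ∈ language X) (hs : Sync (language X) u)
    (hu0 : u ≠ []) (hinj : Function.Injective r) :
    ∃ C : Code (language X) Λ, C.z = C.k ∧ Sync (language X) C.k ∧ C.k ≠ [] ∧
      ∀ ℓ, C.cw ℓ ∈ language X := by
  classical
  obtain ⟨N, ⟨e⟩⟩ := Finite.exists_equiv_fin Λ
  -- The summand `N` leaves room for all letters; the summand `u.length` makes each encoded head
  -- word at least as long as the marker `g`, so that `g` is a prefix of it.
  set K := N + u.length with hK
  have he : ∀ ℓ, (e ℓ : ℕ) < K := fun ℓ => by have := (e ℓ).2; omega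
  set g := returnWord u r [true, true] with hg
  set hd : Λ → List B := fun ℓ => ((headWord K (e ℓ)).map r).flatten with hhd
  set P := 3 * (r true).length + (K + 1) * (r false).length with hP
  have hlen : ∀ ℓ, (hd ℓ).length = P := fun ℓ => length_flatten_headWord (he ℓ)
  have hgl : g.length = 2 * (r true).length + u.length := by
    simp [hg, returnWord]
    ring
  have hf0 := List.length_pos_iff.2 (hr false).ne
  have hgP : g.length ≤ P := by
    rw [hgl, hP]
    nlinarith
  have hpre : ∀ ℓ, g <+: hd ℓ := by
    intro ℓ
    refine List.prefix_of_prefix_length_le (l₃ := hd ℓ ++ g) ?_ (List.prefix_append _ _)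
      (by rw [hlen]; exact hgP)
    have : hd ℓ ++ g = returnWord u r ([true, true] ++
        (List.replicate (e ℓ + 1) false ++ [true] ++ List.replicate (K - e ℓ) false ++
          [true, true])) := by
      simp [hd, hg, headWord, returnWord]
    rw [this, returnWord_append, hg, returnWord]
    exact (List.prefix_append_right_inj _).2 (prefix_returnWord hr _)
  have hW : ∀ ℓ, hd ℓ ++ g = returnWord u r (headWord K (e ℓ) ++ [true, true]) := by
    intro ℓ
    rw [returnWord_append]
  have hsplit : ∀ ℓ, g ++ (hd ℓ).drop g.length = hd ℓ := by
    intro ℓ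
    obtain ⟨s, hs⟩ := hpre ℓ
    rw [← hs, List.drop_left]
  have hcw : ∀ ℓ, g ++ (hd ℓ).drop g.length ++ g =
      returnWord u r (headWord K (e ℓ) ++ [true, true]) := by
    intro ℓ
    rw [hsplit, hW]
  have hgs : Sync (language X) g := hs.append_left _
  have hmem : ∀ ℓ, g ++ (hd ℓ).drop g.length ++ g ∈ language X := by
    intro ℓ
    rw [hcw]
    exact returnWord_mem hr hu hs _
  refine ⟨⟨g, g, fun ℓ => (hd ℓ).drop g.length, P - g.length, fun ℓ => by simp [hlen], rfl,
    ?_, ?_, ?_⟩, rfl, hgs, ?_, hmem⟩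
  · intro ℓ ℓ' h
    have h1 : hd ℓ ++ g = hd ℓ' ++ g := by
      rw [← hsplit ℓ, ← hsplit ℓ']
      simp only at h
      rw [h]
    rw [hW, hW] at h1
    -- Unique decoding is stated for occurrences in a configuration, so the word is padded to one;
    -- the padding letter is irrelevant.
    obtain ⟨x, hx⟩ : ∃ x, At x 0 (returnWord u r (headWord K (e ℓ) ++ [true, true])) :=
      ⟨fun p => (returnWord u r (headWord K (e ℓ) ++ [true, true])).getD p.toNat
        ((r true ++ u).head (by simp [hu0])), fun k hk => by simp [hk]⟩
    have h2 := prefix_of_at hr hinj hx (h1 ▸ hx) (by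
      simp [length_headWord (he _)])
    have h3 := h2.eq_of_length (by simp [length_headWord (he _)])
    have h4 := headWord_inj (List.append_cancel_right h3)
    exact e.injective (Fin.ext h4.symm)
  · intro x i j ℓ ℓ' hi hj hij
    rw [hcw] at hi hj
    by_contra hlt
    have hju := hj.of_prefix (prefix_returnWord hr _)
    obtain ⟨s, s', hss, hjs⟩ := exists_split_of_at hr hi hju hij.le (by
      have h1 : ((headWord K (e ℓ)).map r).flatten.length = P := hlen ℓ
      rw [List.map_append, List.flatten_append, List.length_append, h1]
      push_cast
      omega)
    have hl : s.length + s'.length = K + 6 := by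
      rw [← List.length_append, ← hss]
      simp [length_headWord (he ℓ)]
    have hs4 : s.length < K + 4 := by
      by_contra hge
      have h1 : headWord K (e ℓ) <+: s := by
        refine List.prefix_of_prefix_length_le (l₃ := headWord K (e ℓ) ++ [true, true])
          (List.prefix_append _ _) ?_ (by rw [length_headWord (he ℓ)]; omega)
        rw [hss]
        exact List.prefix_append _ _
      obtain ⟨q, rfl⟩ := h1
      simp only [List.map_append, List.flatten_append, List.length_append,
        length_flatten_headWord (he ℓ)] at hjs
      omega
    have hs' : At x j (returnWord u r s') := by
      rw [hss, returnWord_append, at_append, ← hjs] at hi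
      exact hi.2
    have h2 : At x j (returnWord u r [true, true]) := by
      refine at_returnWord_of_append hr (t := (List.replicate (e ℓ' + 1) false ++ [true] ++
        List.replicate (K - e ℓ') false ++ [true, true])) ?_
      simpa [headWord] using hj
    obtain ⟨q, rfl⟩ := prefix_of_at hr hinj hs' h2 (by simp; omega)
    rcases headWord_factor (t := s) (t' := q) (he ℓ) (by rw [hss, List.append_assoc]) with h | h
    · subst h
      simp at hjs
      omega
    · omega
  · intro a b ℓ ℓ' h
    have h1 : a ++ g ∈ language X :=
      mem_language_left (v := (hd ℓ).drop g.length ++ g ++ b) (by simpa using h)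
    have h2 : g ++ b ∈ language X :=
      mem_language_right (u := a ++ g ++ (hd ℓ).drop g.length) (by simpa using h)
    have h3 := hgs a ((hd ℓ').drop g.length ++ g) h1 (by simpa using hmem ℓ')
    have h4 := hgs (a ++ g ++ (hd ℓ').drop g.length) b (by simpa using h3) h2
    simpa using h4
  · intro h
    simp only at h
    rw [h] at hgl
    have := List.length_pos_iff.2 hu0
    simp at hgl
    omega

end Returns

/-! ### The rules: letter permutations, ends of runs, conveyor belt -/

section Rules

variable {Λ Γ : Type*}

/-- Apply a permutation to all letters. -/
def permRule (π : Equiv.Perm Λ) : Rule Λ where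
  f t i := (t i).map π
  g t i := (t i).map π.symm
  gf t := by funext i; simp [Function.comp_def]
  fg t := by funext i; simp [Function.comp_def]
  dom t i := by simp
  comm s t := by funext i; simp
  r := 0
  loc t t' i h := by rw [h i (by simp) (by simp)]

/-- Apply a permutation to the last letter of each run of step `P`. -/
def endRule (P : ℕ) (π : Equiv.Perm Λ) : Rule Λ where
  f t i := (t (i + P)).elim ((t i).map π) fun _ => t i
  g t i := (t (i + P)).elim ((t i).map π.symm) fun _ => t i
  gf t := by
    funext i
    rcases h1 : t (i + P) with _ | l1 <;> rcases h2 : t (i + P + P) with _ | l2 <;>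
      simp [h1, h2, Function.comp_def]
  fg t := by
    funext i
    rcases h1 : t (i + P) with _ | l1 <;> rcases h2 : t (i + P + P) with _ | l2 <;>
      simp [h1, h2, Function.comp_def]
  dom t i := by
    rcases t (i + P) with _ | l1 <;> simp
  comm s t := by
    funext i
    simp [add_assoc]
  r := P
  loc t t' i h := by
    rw [h i (by omega) (by omega), h (i + P) (by omega) (by omega)]

/-- On each run of step `P`, move the first components to the left and the second components to
the right, with reflection at the ends of the run. -/
def beltRule (P : ℕ) : Rule (Γ × Γ) where
  f t i := (t i).map fun l =>
    ((t (i + P)).elim l.2 Prod.fst, (t (i - P)).elim l.1 Prod.snd)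
  g t i := (t i).map fun l =>
    ((t (i - P)).elim l.2 Prod.fst, (t (i + P)).elim l.1 Prod.snd)
  gf t := by
    funext i
    rcases h0 : t i with _ | l
    · simp [h0]
    · rcases h1 : t (i + P) with _ | l1 <;> rcases h2 : t (i - P) with _ | l2 <;>
        simp [h0, h1, h2]
  fg t := by
    funext i
    rcases h0 : t i with _ | l
    · simp [h0]
    · rcases h1 : t (i + P) with _ | l1 <;> rcases h2 : t (i - P) with _ | l2 <;>
        simp [h0, h1, h2]
  dom t i := by simp
  comm s t := by
    funext i
    simp [add_assoc, add_sub_assoc]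
  r := P
  loc t t' i h := by
    rw [h i (by omega) (by omega), h (i + P) (by omega) (by omega),
      h (i - P) (by omega) (by omega)]

end Rules

/-! ### Periodic points and gluing along a synchronizing word -/

section Periodic

variable {B : Type*}

/-- The periodic configuration with period word `w`. -/
def periodic (w : List B) (hw : w ≠ []) (p : ℤ) : B :=
  w[(p % w.length).toNat]'(by
    have h := List.length_pos_iff.2 hw
    have h1 := Int.emod_nonneg p (b := (w.length : ℤ)) (by omega)
    have h2 := Int.emod_lt_of_pos p (b := (w.length : ℤ)) (by omega)
    omega)

theorem periodic_add (w : List B) (hw : w ≠ []) (p c : ℤ) :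
    periodic w hw (p + c * w.length) = periodic w hw p := by
  simp [periodic]

theorem at_periodic (w : List B) (hw : w ≠ []) (c : ℤ) : At (periodic w hw) (c * w.length) w := by
  intro k hk
  rw [add_comm, periodic_add, periodic]
  congr 1
  rw [Int.emod_eq_of_lt (by omega) (by omega)]
  simp

theorem at_periodic_append (w v : List B) (hw : w ≠ []) (hv : v <+: w) (c : ℤ) :
    At (periodic w hw) (c * w.length) (w ++ v) := by
  refine at_append.2 ⟨at_periodic w hw c, ?_⟩
  have := (at_periodic w hw (c + 1)).of_prefix hv
  rwa [add_mul, one_mul] at this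

variable [TopologicalSpace B] {X : Subshift B ℤ}

theorem periodic_mem {w g : List B} (hw : w ≠ []) (hg : g <+: w) (hs : Sync (language X) g)
    (hmem : w ++ g ∈ language X) : periodic w hw ∈ X.carrier := by
  have hpow : ∀ n : ℕ, ((List.replicate (n + 1) w).flatten ++ g) ∈ language X := by
    intro n
    induction n with
    | zero => simpa using hmem
    | succ n ih =>
      rw [List.replicate_succ, List.flatten_cons]
      have h1 : g <+: (List.replicate (n + 1) w).flatten ++ g := by
        rw [List.replicate_succ, List.flatten_cons, List.append_assoc]
        exact hg.trans (List.prefix_append _ _)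
      obtain ⟨s, hs'⟩ := h1
      rw [← hs'] at ih
      rw [List.append_assoc, ← hs', ← List.append_assoc]
      exact hs _ _ hmem ih
  have hat : ∀ (n : ℕ) (c : ℤ), At (periodic w hw) (c * w.length) (List.replicate n w).flatten := by
    intro n
    induction n with
    | zero => intro c; exact at_nil _ _
    | succ n ih =>
      intro c
      rw [List.replicate_succ, List.flatten_cons]
      refine at_append.2 ⟨at_periodic w hw c, ?_⟩
      have := ih (c + 1)
      rwa [add_mul, one_mul] at this
  have hpos := List.length_pos_iff.2 hw
  refine mem_carrier_of_agree fun N => ?_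
  obtain ⟨y, hy, i, hi⟩ := mem_language.1 (mem_language_left (hpow (2 * N)))
  have h2 := hat (2 * N + 1) (-N)
  refine ⟨shift (i + N * w.length) y, X.mapsTo _ hy, fun p h3 h4 => ?_⟩
  have h5 : (N : ℤ) ≤ N * w.length := by nlinarith
  have hlen : ((List.replicate (2 * N + 1) w).flatten.length : ℤ) =
      2 * (N * w.length) + w.length := by
    simp
    ring
  have := hi.eq h2 (a := N * w.length + p) (by omega) (by rw [hlen]; omega)
  rw [shift_apply]
  convert this using 2 <;> ring

/-- Two points of `X` that contain the synchronizing word `g` at the same place can be glued. -/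
theorem glue_mem {g : List B} (hs : Sync (language X) g) {x y : ℤ → B} (hx : x ∈ X.carrier)
    (hy : y ∈ X.carrier) {i : ℤ} (hxi : At x i g) (hyi : At y i g) :
    (fun p => if p < i then x p else y p) ∈ X.carrier := by
  set z : ℤ → B := fun p => if p < i then x p else y p with hz
  refine mem_carrier_of_window i g.length fun N => ?_
  have h1 : At z (i - N) (window x (i - N) N ++ g ++ window y (i + g.length) N) := by
    refine at_append.2 ⟨at_append.2 ⟨(at_window x _ N).congr fun p h1 h2 => ?_,
      ?_⟩, ?_⟩
    · simp only [length_window] at h2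
      simp [hz, show p < i by omega]
    · simp only [length_window, sub_add_cancel]
      exact hyi.congr fun p h1 h2 => by simp [hz, show ¬ p < i by omega]
    · simp only [List.length_append, length_window, Nat.cast_add]
      rw [show i - N + (N + g.length : ℤ) = i + g.length by ring]
      exact (at_window y _ N).congr fun p h1 h2 => by simp [hz, show ¬ p < i by omega]
  have h2 := h1.eq_window
  simp only [List.length_append, length_window] at h2
  rw [← h2]
  refine hs _ _ ?_ ?_
  · refine ⟨x, hx, i - N, at_append.2 ⟨at_window _ _ _, by simpa using hxi⟩⟩
  · exact ⟨y, hy, i, at_append.2 ⟨hyi, at_window _ _ _⟩⟩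

end Periodic

/-! ### Marker codes and the points they encode -/

/-- A code whose words are delimited by a synchronizing word. -/
structure MarkerCode {B : Type*} [TopologicalSpace B] (X : Subshift B ℤ) (Λ : Type*) extends
    Code (language X) Λ where
  z_eq : z = k
  k_ne : k ≠ []
  sync : Sync (language X) k
  mem : ∀ ℓ, k ++ m ℓ ++ z ∈ language X

namespace MarkerCode

variable {B : Type*} [TopologicalSpace B] {X : Subshift B ℤ} {Λ : Type*} (D : MarkerCode X Λ)

/-- The distance of adjacent code words. -/
def P : ℕ := D.k.length + D.n

theorem k_pos : 0 < D.k.length := List.length_pos_iff.2 D.k_ne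

theorem P_pos : 0 < D.P := by have := D.k_pos; unfold P; omega

theorem k_le_P : D.k.length ≤ D.P := by unfold P; omega

theorem length_cw (ℓ : Λ) : (D.cw ℓ).length = D.P + D.k.length := D.toCode.length_cw ℓ

theorem cw_eq (ℓ : Λ) : D.cw ℓ = D.k ++ D.m ℓ ++ D.k := by
  rw [Code.cw, D.z_eq]

theorem at_k {x : ℤ → B} {i : ℤ} (h : (D.ty x i).isSome) : At x i D.k := by
  obtain ⟨ℓ, h⟩ := D.isSome_ty.1 h
  rw [cw_eq, List.append_assoc, at_append] at h
  exact h.1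

theorem at_k_succ {x : ℤ → B} {i : ℤ} (h : (D.ty x i).isSome) : At x (i + D.P) D.k := by
  obtain ⟨ℓ, h⟩ := D.isSome_ty.1 h
  rw [cw_eq, at_append] at h
  have := h.2
  rwa [List.length_append, D.length_m] at this

theorem sep_P {x : ℤ → B} {i j : ℤ} (hi : (D.ty x i).isSome) (hj : (D.ty x j).isSome)
    (hij : i < j) : i + D.P ≤ j := by
  have := D.sep' hi hj hij
  unfold P
  push_cast
  omega

theorem eq_of_ty {x y : ℤ → B} {i : ℤ} (h : (D.ty x i).isSome) (hxy : D.ty x i = D.ty y i) {p : ℤ}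
    (h1 : i ≤ p) (h2 : p < i + D.P + D.k.length) : x p = y p := by
  obtain ⟨ℓ, hℓ⟩ := Option.isSome_iff_exists.1 h
  have hx := D.ty_eq_some.1 hℓ
  have hy := D.ty_eq_some.1 (hxy ▸ hℓ)
  have := hx.eq hy (a := p - i) (by omega) (by rw [D.length_cw]; push_cast; omega)
  simpa using this

/-- The sequence that is given by `t` on the multiples of `P`. -/
def emb (t : ℤ → Λ) (i : ℤ) : Option Λ := if (D.P : ℤ) ∣ i then some (t (i / D.P)) else none

theorem emb_mul (t : ℤ → Λ) (i : ℤ) : D.emb t (i * D.P) = some (t i) := by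
  have := D.P_pos
  rw [emb, if_pos (Dvd.intro_left _ rfl), Int.mul_ediv_cancel _ (by omega)]

theorem emb_inj {t t' : ℤ → Λ} (h : D.emb t = D.emb t') : t = t' := by
  funext i
  have := congrFun h (i * D.P)
  rw [emb_mul, emb_mul] at this
  exact Option.some.inj this

theorem emb_ext {s : ℤ → Option Λ} {t : ℤ → Λ} (h : ∀ i, s (i * D.P) = some (t i))
    (h' : ∀ i, ¬ (D.P : ℤ) ∣ i → s i = none) : s = D.emb t := by
  funext i
  by_cases hi : (D.P : ℤ) ∣ i
  · obtain ⟨c, rfl⟩ := hi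
    rw [mul_comm, h, emb_mul]
  · rw [h' i hi, emb, if_neg hi]

theorem ty_none_of_not_dvd {x : ℤ → B} {q i : ℤ} (h : (D.ty x (q * D.P)).isSome)
    (h1 : q * D.P < i) (h2 : i < q * D.P + D.P) : D.ty x i = none := by
  by_contra hne
  have := D.sep_P h (Option.isSome_iff_ne_none.2 hne) h1
  omega

theorem ty_eq_emb {x : ℤ → B} {t : ℤ → Λ} (h : ∀ i, D.ty x (i * D.P) = some (t i)) :
    D.ty x = D.emb t := by
  refine D.emb_ext h fun i hi => ?_
  have hP := D.P_pos
  have h1 := Int.emod_add_mul_ediv i D.P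
  have h2 := Int.emod_nonneg i (b := (D.P : ℤ)) (by omega)
  have h3 := Int.emod_lt_of_pos i (b := (D.P : ℤ)) (by omega)
  have h4 : i % D.P ≠ 0 := fun h0 => hi (Int.dvd_of_emod_eq_zero h0)
  refine D.ty_none_of_not_dvd (q := i / D.P) (by rw [h]; rfl) ?_ ?_ <;>
    rw [mul_comm] <;> omega

theorem div_mul_le (p : ℤ) : p / D.P * D.P ≤ p ∧ p < p / D.P * D.P + D.P := by
  have hP := D.P_pos
  have h1 := Int.emod_add_mul_ediv p D.P
  have h2 := Int.emod_nonneg p (b := (D.P : ℤ)) (by omega)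
  have h3 := Int.emod_lt_of_pos p (b := (D.P : ℤ)) (by omega)
  rw [mul_comm]
  constructor <;> omega

variable [Inhabited Λ]

/-- The point in which only the code word with index `default` occurs. -/
def base : X.carrier :=
  ⟨periodic (D.k ++ D.m default) (by simp [D.k_ne]),
    periodic_mem _ (List.prefix_append _ _) D.sync (by
      have := D.mem default
      rwa [D.z_eq] at this)⟩

theorem ty_base : D.ty D.base.1 = D.emb fun _ => default := by
  refine D.ty_eq_emb fun i => ?_
  rw [Code.ty_eq_some, cw_eq]
  have := at_periodic_append (D.k ++ D.m default) D.k (by simp [D.k_ne])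
    (List.prefix_append _ _) i
  rwa [List.length_append, D.length_m] at this

theorem fits_emb (t : ℤ → Λ) : D.Fits D.base.1 (D.emb t) := by
  intro i
  rw [ty_base, emb, emb]
  split_ifs <;> rfl

/-- The point that is the concatenation of the code words given by `t`. -/
noncomputable def pt (t : ℤ → Λ) : X.carrier :=
  ⟨D.put D.base.1 (D.emb t), Code.put_mem D.base.2 (D.fits_emb t)⟩

theorem ty_pt (t : ℤ → Λ) : D.ty (D.pt t).1 = D.emb t := Code.ty_put (D.fits_emb t)

theorem pt_inj {t t' : ℤ → Λ} (h : D.pt t = D.pt t') : t = t' := by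
  refine D.emb_inj ?_
  rw [← ty_pt, ← ty_pt, h]

theorem eq_pt_apply {x : ℤ → B} {t : ℤ → Λ} {i p : ℤ} (h : D.ty x (i * D.P) = some (t i))
    (h1 : i * D.P ≤ p) (h2 : p < i * D.P + D.P + D.k.length) : x p = (D.pt t).1 p := by
  refine D.eq_of_ty (i := i * D.P) (by rw [h]; rfl) ?_ h1 h2
  rw [ty_pt, emb_mul, h]

theorem eq_pt {x : X.carrier} {t : ℤ → Λ} (h : ∀ i, D.ty x.1 (i * D.P) = some (t i)) :
    x = D.pt t := by
  apply Subtype.ext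
  funext p
  have := D.div_mul_le p
  exact D.eq_pt_apply (h (p / D.P)) this.1 (by omega)

theorem pt_congr {t t' : ℤ → Λ} {p : ℤ} (h : t (p / D.P) = t' (p / D.P)) :
    (D.pt t).1 p = (D.pt t').1 p := by
  have := D.div_mul_le p
  exact D.eq_pt_apply (i := p / D.P) (by rw [ty_pt, emb_mul, h]) this.1 (by omega)

theorem shiftOn_pt (t : ℤ → Λ) (c : ℤ) :
    shiftOn X (c * D.P) (D.pt t) = D.pt fun i => t (c + i) := by
  refine D.eq_pt fun i => ?_
  change D.ty (shift (c * D.P) (D.pt t).1) _ = _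
  rw [Code.ty_shift, shift_apply, ty_pt, ← add_mul, emb_mul]

variable [DiscreteTopology B] [Finite B]

theorem permGate_pt (π : Equiv.Perm Λ) (t : ℤ → Λ) :
    ((permRule π).gate D.toCode).1 (D.pt t) = D.pt fun i => π (t i) := by
  refine D.eq_pt fun i => ?_
  rw [Rule.ty_gate, ty_pt]
  simp [permRule, emb_mul]

theorem endGate_pt (π : Equiv.Perm Λ) (t : ℤ → Λ) :
    ((endRule D.P π).gate D.toCode).1 (D.pt t) = D.pt t := by
  refine D.eq_pt fun i => ?_
  rw [Rule.ty_gate, ty_pt]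
  have : i * (D.P : ℤ) + D.P = (i + 1) * D.P := by ring
  simp [endRule, emb_mul, this]

end MarkerCode

theorem MarkerCode.beltGate_pt {B : Type*} [TopologicalSpace B] [DiscreteTopology B] [Finite B]
    {X : Subshift B ℤ} {Γ : Type*} [Inhabited Γ] (D : MarkerCode X (Γ × Γ)) (t : ℤ → Γ × Γ) :
    ((beltRule D.P).gate D.toCode).1 (D.pt t) = D.pt fun i => ((t (i + 1)).1, (t (i - 1)).2) := by
  refine D.eq_pt fun i => ?_
  rw [Rule.ty_gate, ty_pt]
  have h1 : i * (D.P : ℤ) + D.P = (i + 1) * D.P := by ring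
  have h2 : i * (D.P : ℤ) - D.P = (i - 1) * D.P := by ring
  simp [beltRule, emb_mul, h1, h2]

/-! ### Periodic points and automorphisms of prime order -/

section Periodic

variable {B : Type*} [TopologicalSpace B] {X : Subshift B ℤ}

theorem finite_periodic [Finite B] (P : ℕ) (hP : 0 < P) :
    {x : X.carrier | shiftOn X P x = x}.Finite ∧
      {x : X.carrier | shiftOn X P x = x}.ncard ≤ Nat.card B ^ P := by
  have hinj : Set.InjOn (fun (x : X.carrier) (k : Fin P) => x.1 (k : ℕ))
      {x : X.carrier | shiftOn X P x = x} := by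
    intro x hx y hy hxy
    have hstep : ∀ x : X.carrier, shiftOn X P x = x → ∀ p, x.1 p = x.1 (P + p) := by
      intro x hx p
      conv_lhs => rw [← hx]
      rfl
    have hmul : ∀ x : X.carrier, shiftOn X P x = x → ∀ (n : ℤ) p, x.1 p = x.1 (n * P + p) := by
      intro x hx n
      induction n with
      | zero => simp
      | succ n ih =>
        intro p
        rw [ih p, hstep x hx (n * P + p)]
        exact congrArg x.1 (by ring)
      | pred n ih =>
        intro p
        rw [ih p, hstep x hx ((-(n : ℤ) - 1) * P + p)]
        exact congrArg x.1 (by ring)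
    apply Subtype.ext
    funext p
    have hlt := Int.emod_lt_of_pos p (b := (P : ℤ)) (by omega)
    have hnn := Int.emod_nonneg p (b := (P : ℤ)) (by omega)
    have e : -(p / P) * P + p = ((p % P).toNat : ℤ) := by
      rw [Int.toNat_of_nonneg hnn, Int.emod_def]
      ring
    rw [hmul x hx (-(p / P)) p, hmul y hy (-(p / P)) p, e]
    exact congrFun hxy ⟨(p % P).toNat, by omega⟩
  refine ⟨Set.Finite.of_injOn (Set.mapsTo_univ _ _) hinj Set.finite_univ, ?_⟩
  have := Set.ncard_le_ncard_of_injOn _ (t := Set.univ) (fun _ _ => Set.mem_univ _) hinj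
    Set.finite_univ
  rwa [Set.ncard_univ, Nat.card_fun, Nat.card_fin] at this

/-- A local map fixes a point whose windows all occur in fixed points at the same place. -/
theorem IsLocal.fix {R : ℕ} {F : X.carrier → X.carrier} (hF : IsLocal R F) {x : X.carrier}
    (h : ∀ p : ℤ, ∃ y : X.carrier, F y = y ∧ ∀ q, p - R ≤ q → q ≤ p + R → x.1 q = y.1 q) :
    F x = x := by
  apply Subtype.ext
  funext p
  obtain ⟨y, hy, hxy⟩ := h p
  rw [hF x y p hxy, hy, hxy p (by omega) (by omega)]

end Periodic

section Perm

variable {B : Type*} [TopologicalSpace B] [DiscreteTopology B] [Finite B] {X : Subshift B ℤ}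

theorem Aut.comm_apply {a h : Aut X} (hc : Commute a h) (x : X.carrier) :
    a.1 (h.1 x) = h.1 (a.1 x) := by
  have := congrArg (fun f : Aut X => f.1 x) hc.eq
  exact this

theorem Aut.pow_apply (a : Aut X) (n : ℕ) (x : X.carrier) : (a ^ n).1 x = a.1^[n] x := by
  rw [show (a ^ n).1 = a.1 ^ n from rfl, ← Equiv.Perm.iterate_eq_pow]

/-- Orbits have length 1 or `q`, and a set with fewer than `q` elements has no room for the latter.
-/
theorem Aut.fix_of_prime {a : Aut X} {q : ℕ} (hq : q.Prime) (ha : a ^ q = 1)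
    {S : Set X.carrier} (hfin : S.Finite) (hcard : S.ncard < q) (hS : ∀ x ∈ S, a.1 x ∈ S)
    {x : X.carrier} (hx : x ∈ S) : a.1 x = x := by
  have hper : Function.IsPeriodicPt a.1 q x := by
    change a.1^[q] x = x
    rw [← Aut.pow_apply, ha]
    rfl
  rcases (Nat.dvd_prime hq).1 hper.minimalPeriod_dvd with h | h
  · exact Function.minimalPeriod_eq_one_iff_isFixedPt.1 h
  · exfalso
    have h1 : ((fun n => a.1^[n] x) '' Set.Iio q).ncard = q := by
      rw [Set.InjOn.ncard_image]
      · simp [Set.ncard_eq_toFinset_card']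
      · rw [← h]
        exact Function.iterate_injOn_Iio_minimalPeriod
    have h2 : (fun n => a.1^[n] x) '' Set.Iio q ⊆ S := by
      rintro _ ⟨n, -, rfl⟩
      induction n with
      | zero => exact hx
      | succ n ih =>
        simp only [Function.iterate_succ_apply']
        exact hS _ ih
    have := Set.ncard_le_ncard h2 hfin
    omega

end Perm

/-! ### The centralizer acts on coded points by powers of the shift -/

namespace MarkerCode

section Tracks

variable {B : Type*} [TopologicalSpace B] {X : Subshift B ℤ} {M : ℕ}

/-- The point given by two tracks. -/
noncomputable def pt₂ (D : MarkerCode X (ZMod M × ZMod M)) (s t : ℤ → ZMod M) : X.carrier :=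
  D.pt fun i => (s i, t i)

theorem pt₂_inj {D : MarkerCode X (ZMod M × ZMod M)} {s t s' t' : ℤ → ZMod M}
    (h : D.pt₂ s t = D.pt₂ s' t') : s = s' ∧ t = t' := by
  have := D.pt_inj h
  exact ⟨funext fun i => congrArg Prod.fst (congrFun this i),
    funext fun i => congrArg Prod.snd (congrFun this i)⟩

theorem shiftOn_pt₂ (D : MarkerCode X (ZMod M × ZMod M)) (s t : ℤ → ZMod M) (c : ℤ) :
    shiftOn X (c * D.P) (D.pt₂ s t) = D.pt₂ (fun i => s (c + i)) fun i => t (c + i) :=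
  D.shiftOn_pt _ c

end Tracks

variable {B : Type*} [TopologicalSpace B] [DiscreteTopology B] [Finite B] {X : Subshift B ℤ}
  {M : ℕ}

/-- `a` commutes with the gates given by `D`. -/
structure Centralizes (D : MarkerCode X (ZMod M × ZMod M)) (a : Aut X) : Prop where
  perm : ∀ π, Commute a ((permRule π).gate D.toCode)
  belt : Commute a ((beltRule D.P).gate D.toCode)
  last : ∀ π, Commute a ((endRule D.P π).gate D.toCode)

variable {D : MarkerCode X (ZMod M × ZMod M)} {a : Aut X}

/-- The zero point has period `D.P`, and there are at most `Nat.card B ^ D.P` points with this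
period. This is the only place where the size of the order matters. -/
theorem fix_zero {q : ℕ} (hq : q.Prime) (ha : a ^ q = 1) (hcard : Nat.card B ^ D.P < q) :
    a.1 (D.pt₂ 0 0) = D.pt₂ 0 0 := by
  obtain ⟨h1, h2⟩ := finite_periodic (X := X) D.P D.P_pos
  refine Aut.fix_of_prime hq ha h1 (h2.trans_lt hcard) ?_ ?_
  · intro x hx
    change shiftOn X D.P (a.1 x) = a.1 x
    rw [← Aut.shift_comm, hx]
  · have := D.shiftOn_pt (fun _ => ((0, 0) : ZMod M × ZMod M)) 1
    rw [one_mul] at this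
    exact this

variable (hD : D.Centralizes a) (h0 : a.1 (D.pt₂ 0 0) = D.pt₂ 0 0)

include hD h0

/-- Finitely supported coded points are mapped to such points. -/
theorem exists_pt₂ (hM : 3 ≤ M) (s t : ℤ →₀ ZMod M) :
    ∃ s' t' : ℤ →₀ ZMod M, a.1 (D.pt₂ s t) = D.pt₂ s' t' := by
  classical
  obtain ⟨R, hR⟩ := Aut.exists_isLocal a
  have hP := D.P_pos
  obtain ⟨N, hN⟩ : ∃ N : ℕ, ∀ i : ℤ, N ≤ i.natAbs → s i = 0 ∧ t i = 0 := by
    refine ⟨(s.support ∪ t.support).sup Int.natAbs + 1, fun i hi => ?_⟩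
    by_contra hcon
    have : i ∈ s.support ∪ t.support := by
      simp only [Finset.mem_union, Finsupp.mem_support_iff]
      tauto
    have := Finset.le_sup (f := Int.natAbs) this
    omega
  set y := a.1 (D.pt₂ s t) with hy
  have hfar : ∀ p : ℤ, (N + 1) * D.P + R ≤ p.natAbs → y.1 p = (D.pt₂ 0 0).1 p := by
    intro p hp
    conv_rhs => rw [← h0]
    refine hR _ _ _ fun q h1 h2 => D.pt_congr ?_
    have h3 := D.div_mul_le q
    have : N ≤ (q / D.P).natAbs := by
      by_contra hlt
      have h4 : q / D.P ≤ N := by omega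
      have h5 : -(N : ℤ) ≤ q / D.P := by omega
      have h6 : q / D.P * D.P ≤ N * D.P := mul_le_mul_of_nonneg_right h4 (by omega)
      have h7 : -(N : ℤ) * D.P ≤ q / D.P * D.P := mul_le_mul_of_nonneg_right h5 (by omega)
      have h8 : ((N + 1) * D.P + R : ℤ) ≤ p.natAbs := by exact_mod_cast hp
      rw [add_mul] at h8
      rw [neg_mul] at h7
      omega
    simp [hN _ this]
  have hfar2 : ∀ i : ℤ, N + 3 + R ≤ i.natAbs → D.ty y.1 (i * D.P) = some (0, 0) := by
    intro i hi
    have h1 : D.ty (D.pt₂ 0 0).1 (i * D.P) = some (0, 0) := by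
      rw [pt₂, ty_pt, emb_mul]
      rfl
    rw [← h1]
    refine D.ty_congr fun p h2 h3 => hfar p ?_
    have h4 := D.k_le_P
    have h5 : (i * D.P).natAbs = i.natAbs * D.P := by simp [Int.natAbs_mul]
    have h6 : (N + 3 + R) * D.P ≤ i.natAbs * D.P := Nat.mul_le_mul_right _ hi
    have h7 : R ≤ R * D.P := Nat.le_mul_of_pos_right _ hP
    have h8 : (N + 3 + R) * D.P = (N + 1) * D.P + 2 * D.P + R * D.P := by ring
    have h9 : p.natAbs + (D.k.length + D.n + D.k.length) ≥ (i * D.P).natAbs := by omega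
    have h10 : D.k.length + D.n + D.k.length ≤ 2 * D.P := by unfold P at *; omega
    omega
  -- Otherwise the run of code words coming from the left in the image ends somewhere, and an end
  -- gate changes its last letter. But `a` commutes with that gate, which fixes the original point
  -- because its run has no end.
  have hsome : ∀ i : ℤ, (D.ty y.1 (i * D.P)).isSome := by
    by_contra hcon
    push Not at hcon
    obtain ⟨i₀, hi₀⟩ := hcon
    obtain ⟨m, hm, hmin⟩ : ∃ m : ℤ, ¬ (D.ty y.1 (m * D.P)).isSome ∧
        (D.ty y.1 ((m - 1) * D.P)).isSome := by
      by_contra hall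
      push Not at hall
      have : ∀ n : ℕ, ¬ (D.ty y.1 ((i₀ - n) * D.P)).isSome := by
        intro n
        induction n with
        | zero => simpa using hi₀
        | succ n ih =>
          have := hall _ ih
          push_cast
          rwa [← sub_sub]
      have h1 := this (N + 3 + R + i₀.natAbs)
      rw [hfar2 _ (by omega)] at h1
      exact h1 rfl
    obtain ⟨l, hl⟩ := Option.isSome_iff_exists.1 hmin
    have h1 : l + 1 ≠ l := by
      have : Fact (1 < M) := ⟨by omega⟩
      simp
    have h2 := Aut.comm_apply (hD.last (Equiv.swap l (l + 1))) (D.pt₂ s t)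
    rw [pt₂, endGate_pt, ← pt₂, ← hy] at h2
    have h3 := congrArg (fun x : X.carrier => D.ty x.1 ((m - 1) * D.P)) h2
    simp only [Rule.ty_gate] at h3
    rw [Option.not_isSome_iff_eq_none] at hm
    have h4 : (m - 1) * (D.P : ℤ) + D.P = m * D.P := by ring
    simp [endRule, h4, hm, hl] at h3
    exact h1 (by simpa using h3)
  choose f hf using fun i => Option.isSome_iff_exists.1 (hsome i)
  have hf0 : ∀ i : ℤ, N + 3 + R ≤ i.natAbs → f i = (0, 0) := fun i hi =>
    Option.some.inj ((hf i).symm.trans (hfar2 i hi))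
  have hS : ∀ g : ℤ → ZMod M, (∀ i : ℤ, N + 3 + R ≤ i.natAbs → g i = 0) →
      ∃ g' : ℤ →₀ ZMod M, ⇑g' = g := by
    intro g hg
    refine ⟨Finsupp.onFinset (Finset.Icc (-(N + 3 + R : ℤ)) (N + 3 + R)) g fun i hi => ?_, rfl⟩
    by_contra hcon
    refine hi (hg i ?_)
    rw [Finset.mem_Icc] at hcon
    omega
  obtain ⟨s', hs'⟩ := hS (fun i => (f i).1) fun i hi => by rw [hf0 i hi]
  obtain ⟨t', ht'⟩ := hS (fun i => (f i).2) fun i hi => by rw [hf0 i hi]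
  refine ⟨s', t', ?_⟩
  rw [hs', ht']
  exact D.eq_pt hf

end MarkerCode

namespace MarkerCode

variable {B : Type*} [TopologicalSpace B] [DiscreteTopology B] [Finite B] {X : Subshift B ℤ}
  {M : ℕ}

theorem beltGate_pt₂ (D : MarkerCode X (ZMod M × ZMod M)) (s t : ℤ → ZMod M) :
    ((beltRule D.P).gate D.toCode).1 (D.pt₂ s t) =
      D.pt₂ (fun i => s (i + 1)) fun i => t (i - 1) :=
  D.beltGate_pt _

variable {D : MarkerCode X (ZMod M × ZMod M)} {a : Aut X}

theorem eq_zero_of_periodic {s : ℤ →₀ ZMod M} {c : ℤ} (hc : c ≠ 0) (h : ∀ i, s (i + c) = s i) :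
    s = 0 := by
  by_contra hne
  obtain ⟨i, hi⟩ := Finsupp.ne_iff.1 hne
  have h1 : ∀ n : ℕ, s (i + n * c) = s i := by
    intro n
    induction n with
    | zero => simp
    | succ n ih =>
      rw [← ih, ← h (i + n * c)]
      congr 1
      push_cast
      ring
  have h2 : Set.range (fun n : ℕ => i + n * c) ⊆ s.support := by
    rintro _ ⟨n, rfl⟩
    simp only [Finset.mem_coe, Finsupp.mem_support_iff]
    rwa [h1]
  refine Set.infinite_range_of_injective (f := fun n : ℕ => i + n * c) ?_
    (s.support.finite_toSet.subset h2)
  intro m n hmn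
  have : (m : ℤ) = n := by simpa [hc] using hmn
  exact_mod_cast this

theorem exists_bound (s : ℤ →₀ ZMod M) : ∃ N : ℕ, ∀ i : ℤ, N ≤ i.natAbs → s i = 0 := by
  refine ⟨s.support.sup Int.natAbs + 1, fun i hi => ?_⟩
  by_contra hcon
  have := Finset.le_sup (f := Int.natAbs) (Finsupp.mem_support_iff.2 hcon)
  omega

variable (hM : 3 ≤ M) (hD : D.Centralizes a) (h0 : a.1 (D.pt₂ 0 0) = D.pt₂ 0 0)

include hM hD h0

/-- On points with empty first track the belt acts as a shift by one block, and `a` commutes with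
both, so being concentrated on the second track persists. Swapping the tracks shows that `a` acts on
both in the same way. -/
theorem exists_track (t : ℤ →₀ ZMod M) :
    ∃ t' : ℤ →₀ ZMod M, a.1 (D.pt₂ 0 t) = D.pt₂ 0 t' ∧ a.1 (D.pt₂ t 0) = D.pt₂ t' 0 := by
  obtain ⟨s', t', h⟩ := exists_pt₂ hD h0 hM 0 t
  have h1 := Aut.comm_apply hD.belt (D.pt₂ 0 t)
  have h2 : ((beltRule D.P).gate D.toCode).1 (D.pt₂ 0 t) = shiftOn X (-1 * D.P) (D.pt₂ 0 t) := by
    rw [beltGate_pt₂, shiftOn_pt₂]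
    congr 1
    funext i
    congr 1
    ring
  rw [Finsupp.coe_zero] at h
  rw [h2, Aut.shift_comm, h, beltGate_pt₂, shiftOn_pt₂] at h1
  -- The belt moves the first track against this shift, so equality of the two forces period 2,
  -- impossible for finite nonzero support.
  obtain rfl : s' = 0 := by
    refine eq_zero_of_periodic (c := 2) (by simp) fun i => ?_
    have := congrFun (pt₂_inj h1).1 (i + 1)
    convert this.symm using 2 <;> ring
  refine ⟨t', h, ?_⟩
  have h3 := Aut.comm_apply (hD.perm (Equiv.prodComm _ _)) (D.pt₂ 0 t)
  rw [h, pt₂, pt₂, permGate_pt, permGate_pt] at h3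
  exact h3

/-- `a` acts on both tracks independently and in the same way. -/
theorem exists_track_map : ∃ b : (ℤ →₀ ZMod M) → ℤ →₀ ZMod M,
    ∀ s t : ℤ →₀ ZMod M, a.1 (D.pt₂ s t) = D.pt₂ (b s) (b t) := by
  choose b hb1 hb2 using exists_track hM hD h0
  refine ⟨b, fun s t => ?_⟩
  have hP := D.P_pos
  obtain ⟨R, hR⟩ := Aut.exists_isLocal a
  obtain ⟨N₁, h1⟩ := exists_bound s
  obtain ⟨N₂, h2⟩ := exists_bound t
  obtain ⟨N₃, h3⟩ := exists_bound (b s)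
  obtain ⟨N₄, h4⟩ := exists_bound (b t)
  -- After `n` belt steps the first track and its image live far to the left, the second and its
  -- image far to the right, beyond the radius of `a`.
  set n := N₁ + N₂ + N₃ + N₄ + R + 1 with hn
  set F := (beltRule D.P).gate D.toCode with hF
  have hiter : ∀ (s t : ℤ → ZMod M) (n : ℕ), F.1^[n] (D.pt₂ s t) =
      D.pt₂ (fun i => s (i + n)) fun i => t (i - n) := by
    intro s t n
    induction n with
    | zero => simp
    | succ n ih =>
      rw [Function.iterate_succ_apply', ih, beltGate_pt₂]
      congr 1 <;> funext i <;> congr 1 <;> push_cast <;> ring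
  have hcomm : ∀ (n : ℕ) x, a.1 (F.1^[n] x) = F.1^[n] (a.1 x) := by
    intro n x
    induction n with
    | zero => rfl
    | succ n ih =>
      rw [Function.iterate_succ_apply', Function.iterate_succ_apply', Aut.comm_apply hD.belt, ih]
  refine F.1.injective.iterate n ?_
  rw [← hcomm, hiter, hiter]
  have e1 : a.1 (D.pt₂ (fun i => s (i + n)) 0) = D.pt₂ (fun i => b s (i + n)) 0 := by
    have := hiter s 0 n
    simp only [Pi.zero_apply] at this
    rw [Pi.zero_def, ← this, hcomm, ← Pi.zero_def, hb2, hiter]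
    rfl
  have e2 : a.1 (D.pt₂ 0 (fun i => t (i - n))) = D.pt₂ 0 (fun i => b t (i - n)) := by
    have := hiter 0 t n
    simp only [Pi.zero_apply] at this
    rw [Pi.zero_def, ← this, hcomm, ← Pi.zero_def, hb1, hiter]
    rfl
  apply Subtype.ext
  funext p
  have hdiv : ∀ q : ℤ, ∀ K : ℕ, (q ≤ K → q / D.P ≤ K) ∧ (-(K : ℤ) ≤ q → -(K : ℤ) ≤ q / D.P) := by
    intro q K
    have h5 := D.div_mul_le q
    have hP1 : (1 : ℤ) ≤ D.P := by omega
    constructor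
    · intro h
      by_contra hc
      push Not at hc
      have : q / D.P * 1 ≤ q / D.P * D.P := mul_le_mul_of_nonneg_left hP1 (by omega)
      omega
    · intro h
      by_contra hc
      push Not at hc
      have : (q / D.P + 1) * D.P ≤ (q / D.P + 1) * 1 :=
        mul_le_mul_of_nonpos_left hP1 (by omega)
      rw [add_mul] at this
      omega
  -- Left of the origin `a` sees only the first track, to the right only the second.
  rcases lt_or_ge p 0 with hp | hp
  · rw [hR _ (D.pt₂ (fun i => s (i + n)) 0) p, e1]
    · refine D.pt_congr ?_
      have := (hdiv p 0).1 (by omega)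
      simp [h4 (p / D.P - n) (by omega)]
    · intro q _ hq
      refine D.pt_congr ?_
      have := (hdiv q R).1 (by omega)
      simp [h2 (q / D.P - n) (by omega)]
  · rw [hR _ (D.pt₂ 0 (fun i => t (i - n))) p, e2]
    · refine D.pt_congr ?_
      have := (hdiv p 0).2 (by omega)
      simp [h3 (p / D.P + n) (by omega)]
    · intro q hq _
      refine D.pt_congr ?_
      have := (hdiv q R).2 (by omega)
      simp [h1 (q / D.P + n) (by omega)]

/-- On finitely supported coded points, `a` is a power of the shift. -/
theorem exists_shift : ∃ j : ℤ, ∀ s t : ℤ →₀ ZMod M,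
    a.1 (D.pt₂ s t) = shiftOn X (j * D.P) (D.pt₂ s t) := by
  classical
  have : Fact (1 < M) := ⟨by omega⟩
  obtain ⟨b, hb⟩ := exists_track_map hM hD h0
  have hb0 : b 0 = 0 := by
    have h1 := hb 0 0
    rw [Finsupp.coe_zero, h0] at h1
    exact DFunLike.coe_injective (pt₂_inj h1).1.symm
  have hinj : ∀ t, b t = 0 → t = 0 := by
    intro t ht
    have h1 := hb t t
    have h2 := hb 0 0
    rw [ht, ← hb0, ← h2] at h1
    exact DFunLike.coe_injective (pt₂_inj (a.1.injective h1)).1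
  -- The controlled addition `(x, y) ↦ (x + f y, y)` is a letter permutation for arbitrary `f`.
  -- Commuting with it makes `b` additive and compatible with every letter map fixing 0.
  have hfun : ∀ (f : ZMod M → ZMod M) (hf : f 0 = 0) (s t : ℤ →₀ ZMod M),
      b (s + t.mapRange f hf) = b s + (b t).mapRange f hf := by
    intro f hf s t
    let π : Equiv.Perm (ZMod M × ZMod M) :=
      ⟨fun l => (l.1 + f l.2, l.2), fun l => (l.1 - f l.2, l.2), fun l => by simp,
        fun l => by simp⟩
    have h1 := Aut.comm_apply (hD.perm π) (D.pt₂ s t)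
    have h2 : ∀ s t : ℤ →₀ ZMod M, ((permRule π).gate D.toCode).1 (D.pt₂ s t) =
        D.pt₂ (s + t.mapRange f hf : ℤ →₀ ZMod M) t := by
      intro s t
      rw [pt₂, permGate_pt]
      rfl
    rw [h2, hb, hb, h2] at h1
    exact DFunLike.coe_injective (pt₂_inj h1).1
  have hmap : ∀ (f : ZMod M → ZMod M) (hf : f 0 = 0) (t : ℤ →₀ ZMod M),
      b (t.mapRange f hf) = (b t).mapRange f hf := by
    intro f hf t
    have := hfun f hf 0 t
    rwa [zero_add, hb0, zero_add] at this
  have hadd : ∀ s t, b (s + t) = b s + b t := by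
    intro s t
    have := hfun id rfl s t
    simpa using this
  have hshift : ∀ (i : ℤ) (c : ZMod M) q, b (Finsupp.single i c) q =
      b (Finsupp.single 0 c) (q - i) := by
    intro i c q
    have h1 := Aut.shift_comm a (-i * D.P) (D.pt₂ (Finsupp.single 0 c) (Finsupp.single 0 c))
    have h2 : shiftOn X (-i * D.P) (D.pt₂ (Finsupp.single 0 c) (Finsupp.single 0 c)) =
        D.pt₂ (Finsupp.single i c) (Finsupp.single i c) := by
      rw [shiftOn_pt₂]
      have : (fun k => (Finsupp.single 0 c : ℤ →₀ ZMod M) (-i + k)) = Finsupp.single i c := by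
        funext k
        simp only [Finsupp.single_apply]
        congr 1
        apply propext
        constructor <;> intro h <;> omega
      rw [this]
    rw [h2, hb, hb, shiftOn_pt₂] at h1
    rw [congrFun (pt₂_inj h1).1 q]
    congr 1
    ring
  set u := b (Finsupp.single 0 1) with hu
  have hu0 : u ≠ 0 := fun h => one_ne_zero (Finsupp.single_eq_zero.1 (hinj _ h))
  obtain ⟨j, hj⟩ := Finsupp.ne_iff.1 hu0
  -- The indicator of 1 fixes the unit impulse, hence fixes its image `u`.
  have hval : ∀ q, u q ≠ 0 → u q = 1 := by
    intro q hq
    have h1 := hmap (fun c => if c = 1 then 1 else 0) (by simp) (Finsupp.single 0 1)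
    simp only [Finsupp.mapRange_single, if_true] at h1
    have h2 := DFunLike.congr_fun h1 q
    rw [Finsupp.mapRange_apply, ← hu] at h2
    by_contra h3
    rw [if_neg h3] at h2
    exact hq h2
  -- If `u` were 1 at both `i` and `j`, apply `b` to an impulse `1` at 0 and `-1` at `i - j`: the
  -- values cancel at `i`. Replacing `-1` by `1` through the letter map `f` gives `1 + 1` there, so
  -- `2 = 0`, impossible for `M ≥ 3`.
  have huj : u = Finsupp.single j 1 := by
    ext i
    rw [Finsupp.single_apply]
    split_ifs with hij
    · exact hij ▸ hval j hj
    · by_contra hi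
      have hi1 := hval i hi
      have hj1 := hval j hj
      set d := i - j with hd
      have hd0 : d ≠ 0 := by omega
      let f : ZMod M → ZMod M := fun c => if c = 1 ∨ c = -1 then 1 else 0
      have hf : f 0 = 0 := by simp [f]
      have h1 := hmap f hf (Finsupp.single 0 1 + Finsupp.single d (-1))
      have h2 : (Finsupp.single 0 1 + Finsupp.single d (-1) : ℤ →₀ ZMod M).mapRange f hf =
          Finsupp.single 0 1 + Finsupp.single d 1 := by
        ext q
        simp only [Finsupp.mapRange_apply, Finsupp.add_apply, Finsupp.single_apply]
        by_cases hq0 : 0 = q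
        · simp [← hq0, hd0, f]
        · by_cases hqd : d = q <;> simp [hq0, hqd, f]
      have h3 : b (Finsupp.single d (-1)) = - b (Finsupp.single d 1) := by
        have := hadd (Finsupp.single d (-1)) (Finsupp.single d 1)
        rw [← Finsupp.single_add, neg_add_cancel, Finsupp.single_zero, hb0] at this
        exact eq_neg_of_add_eq_zero_left this.symm
      rw [h2, hadd, hadd, h3] at h1
      have h4 := DFunLike.congr_fun h1 i
      simp only [Finsupp.mapRange_apply, Finsupp.add_apply, Finsupp.neg_apply] at h4
      rw [hshift d, show i - d = j by omega, ← hu, hi1, hj1, add_neg_cancel, hf] at h4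
      have h5 : ((2 : ℕ) : ZMod M) = 0 := by
        rw [← h4]
        norm_num
      rw [ZMod.natCast_eq_zero_iff] at h5
      have := Nat.le_of_dvd (by norm_num) h5
      omega
  have hsingle : ∀ (i : ℤ) (c : ZMod M), b (Finsupp.single i c) = Finsupp.single (i + j) c := by
    intro i c
    have h1 := hmap (fun e => c * e) (by simp) (Finsupp.single 0 1)
    simp only [Finsupp.mapRange_single, mul_one] at h1
    ext q
    rw [hshift, h1, Finsupp.mapRange_apply, ← hu, huj, Finsupp.single_apply, Finsupp.single_apply]
    by_cases h : j = q - i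
    · rw [if_pos h, if_pos (by omega), mul_one]
    · rw [if_neg h, if_neg (by omega), mul_zero]
  have hb' : ∀ (t : ℤ →₀ ZMod M) q, b t q = t (-j + q) := by
    intro t q
    let φ : (ℤ →₀ ZMod M) →+ ZMod M := ⟨⟨fun t => b t q, by simp [hb0]⟩, fun s t => by simp [hadd]⟩
    let ψ : (ℤ →₀ ZMod M) →+ ZMod M := Finsupp.applyAddHom (-j + q)
    have : φ = ψ := by
      refine Finsupp.addHom_ext fun i c => ?_
      change b (Finsupp.single i c) q = (Finsupp.single i c : ℤ →₀ ZMod M) (-j + q)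
      rw [hsingle, Finsupp.single_apply, Finsupp.single_apply]
      congr 1
      apply propext
      constructor <;> intro h <;> omega
    exact DFunLike.congr_fun this t
  refine ⟨-j, fun s t => ?_⟩
  rw [hb, shiftOn_pt₂]
  congr 1 <;> funext q <;> exact hb' _ q

omit h0 in
/-- An automorphism of large prime order that commutes with the gates fixes all coded points. -/
theorem Centralizes.fix_pt {q : ℕ} (hq : q.Prime) (ha : a ^ q = 1)
    (hcard : Nat.card B ^ D.P < q) (t : ℤ → ZMod M × ZMod M) : a.1 (D.pt t) = D.pt t := by
  have : Fact (1 < M) := ⟨by omega⟩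
  obtain ⟨j, hj⟩ := exists_shift hM hD (fix_zero hq ha hcard)
  -- Iterating `q` times shifts a unit impulse by `q * j`, while `a ^ q = 1`.
  have hj0 : j = 0 := by
    have h1 : ∀ n : ℕ, a.1^[n] (D.pt₂ (Finsupp.single 0 1) (Finsupp.single 0 1)) =
        D.pt₂ (fun i => (Finsupp.single 0 1 : ℤ →₀ ZMod M) (n * j + i))
          (fun i => (Finsupp.single 0 1 : ℤ →₀ ZMod M) (n * j + i)) := by
      intro n
      induction n with
      | zero => simp
      | succ n ih =>
        rw [Function.iterate_succ_apply, hj, ← shiftOn_pt₂ _ _ _ ((n + 1 : ℕ) * j)]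
        have hs : ∀ (n : ℕ) c x, a.1^[n] (shiftOn X c x) = shiftOn X c (a.1^[n] x) := by
          intro n c x
          induction n with
          | zero => rfl
          | succ n ih => rw [Function.iterate_succ_apply', ih, Aut.shift_comm,
              Function.iterate_succ_apply']
        rw [hs, ih, shiftOn_pt₂, shiftOn_pt₂]
        congr 1 <;> funext i <;> congr 1 <;> push_cast <;> ring
    have h2 := h1 q
    rw [← Aut.pow_apply, ha] at h2
    have h3 := congrFun (pt₂_inj h2).1 0
    simp only [Finsupp.single_apply, if_true, add_zero] at h3
    by_contra hne
    have hq0 := hq.pos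
    rw [if_neg] at h3
    · exact one_ne_zero h3
    · intro h4
      rcases mul_eq_zero.1 h4.symm with h5 | h5
      · omega
      · exact hne h5
  obtain ⟨R, hR⟩ := Aut.exists_isLocal a
  refine hR.fix fun p => ?_
  have hP := D.P_pos
  have hP1 : (1 : ℤ) ≤ D.P := by omega
  let K : ℤ := p.natAbs + R + 1
  let trunc : (ℤ → ZMod M) → ℤ →₀ ZMod M := fun f => Finsupp.onFinset (Finset.Icc (-K) K)
    (fun i => if -K ≤ i ∧ i ≤ K then f i else 0) fun i hi => by
      by_contra hcon
      rw [Finset.mem_Icc] at hcon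
      rw [if_neg hcon] at hi
      exact hi rfl
  refine ⟨D.pt₂ (trunc fun i => (t i).1) (trunc fun i => (t i).2), ?_, fun r h1 h2 => ?_⟩
  · rw [hj, hj0, zero_mul]
    apply Subtype.ext
    simp [shiftOn]
  · refine D.pt_congr ?_
    have h5 := D.div_mul_le r
    have : -K ≤ r / D.P ∧ r / D.P ≤ K := by
      constructor
      · by_contra hc
        push Not at hc
        have : (r / D.P + 1) * D.P ≤ (r / D.P + 1) * 1 :=
          mul_le_mul_of_nonpos_left hP1 (by omega)
        rw [add_mul] at this
        omega
      · by_contra hc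
        push Not at hc
        have : r / D.P * 1 ≤ r / D.P * D.P := mul_le_mul_of_nonneg_left hP1 (by omega)
        omega
    simp [trunc, this]

end MarkerCode

/-! ### Follower sets and replacing words behind the marker -/

/-- An increasing sequence of subsets of a finite set is eventually constant. -/
theorem exists_eq_succ {α : Type*} {F : Set α} (hF : F.Finite) {R : ℕ → Set α}
    (hR : ∀ n, R n ⊆ F) (hmono : ∀ n, R n ⊆ R (n + 1)) : ∃ n ≤ F.ncard, R n = R (n + 1) := by
  by_contra hcon
  push Not at hcon
  have : ∀ n ≤ F.ncard + 1, n ≤ (R n).ncard := by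
    intro n
    induction n with
    | zero => simp
    | succ n ih =>
      intro hn
      have h1 := Set.ncard_lt_ncard ((hmono n).ssubset_of_ne (hcon n (by omega)))
        (hF.subset (hR _))
      have := ih (by omega)
      omega
  have h1 := this _ le_rfl
  have h2 := Set.ncard_le_ncard (hR (F.ncard + 1)) hF
  omega

section Sync

variable {B : Type*} [TopologicalSpace B] {X : Subshift B ℤ} {k : List B}

theorem Sync.mem_iff (hs : Sync (language X) k) {u b : List B} (hu : u ++ k ∈ language X) :
    u ++ k ++ b ∈ language X ↔ k ++ b ∈ language X :=
  ⟨fun h => mem_language_right (u := u) (by simpa using h), fun h => hs _ _ hu h⟩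

theorem Sync.leftQuotient_append (hs : Sync (language X) k) {u v : List B}
    (hu : u ++ k ∈ language X) :
    (language X).leftQuotient (u ++ (k ++ v)) = (language X).leftQuotient (k ++ v) := by
  ext b
  rw [Language.mem_leftQuotient, Language.mem_leftQuotient]
  have := hs.mem_iff (b := v ++ b) hu
  simpa using this

theorem Sync.leftQuotient_eq (hs : Sync (language X) k) {u v : List B}
    (hu : u ∈ language X) (hv : v ∈ language X) (hku : k <:+ u) (hkv : k <:+ v) :
    (language X).leftQuotient u = (language X).leftQuotient v := by
  obtain ⟨u, rfl⟩ := hku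
  obtain ⟨v, rfl⟩ := hkv
  have h1 := hs.leftQuotient_append (v := []) hu
  have h2 := hs.leftQuotient_append (v := []) hv
  simp only [List.append_nil] at h1 h2
  rw [h1, h2]

theorem Sync.replace (hs : Sync (language X) k) {a w w' b : List B}
    (hq : (language X).leftQuotient (k ++ w) = (language X).leftQuotient (k ++ w'))
    (h : a ++ (k ++ w ++ b) ∈ language X) : a ++ (k ++ w' ++ b) ∈ language X := by
  have h1 : b ∈ (language X).leftQuotient (k ++ w) := by
    rw [Language.mem_leftQuotient]
    exact mem_language_right h
  rw [hq, Language.mem_leftQuotient] at h1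
  have h2 : a ++ k ∈ language X := by
    refine mem_language_left (v := w ++ b) ?_
    simpa using h
  have := hs a (w' ++ b) h2 (by simpa using h1)
  simpa using this

end Sync

namespace MarkerCode

variable {B : Type*} [TopologicalSpace B] {X : Subshift B ℤ} {Λ : Type*} (D : MarkerCode X Λ)

theorem mem_of_cw (ℓ : Λ) {v : List B} (h : D.k ++ v ∈ language X) :
    D.k ++ D.m ℓ ++ (D.k ++ v) ∈ language X := by
  have h1 := D.mem ℓ
  rw [D.z_eq] at h1
  rw [← List.append_assoc]
  exact D.sync _ _ h1 h

/-- In an interval of `d` block lengths at most `d` different letters occur. -/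
theorem ncard_letters (x : ℤ → B) (i₀ : ℤ) (d : ℕ) :
    {ℓ | ∃ i, i₀ ≤ i ∧ i < i₀ + d * D.P ∧ D.ty x i = some ℓ}.Finite ∧
      {ℓ | ∃ i, i₀ ≤ i ∧ i < i₀ + d * D.P ∧ D.ty x i = some ℓ}.ncard ≤ d := by
  classical
  have hP := D.P_pos
  set S := {ℓ | ∃ i, i₀ ≤ i ∧ i < i₀ + d * D.P ∧ D.ty x i = some ℓ} with hS
  let f : Λ → ℕ := fun ℓ => if h : ℓ ∈ S then ((h.choose - i₀) / D.P).toNat else 0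
  have hf : ∀ ℓ ∈ S, f ℓ ∈ Set.Iio d := by
    intro ℓ h
    obtain ⟨h1, h2, h3⟩ := h.choose_spec
    simp only [f, dif_pos h, Set.mem_Iio]
    have h4 : (h.choose - i₀) / D.P < d := Int.ediv_lt_of_lt_mul (by omega) (by omega)
    have h5 : 0 ≤ (h.choose - i₀) / D.P := Int.ediv_nonneg (by omega) (by omega)
    omega
  have hinj : Set.InjOn f S := by
    intro ℓ h ℓ' h' he
    obtain ⟨h1, h2, h3⟩ := h.choose_spec
    obtain ⟨h1', h2', h3'⟩ := h'.choose_spec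
    simp only [f, dif_pos h, dif_pos h'] at he
    have h5 : 0 ≤ (h.choose - i₀) / D.P := Int.ediv_nonneg (by omega) (by omega)
    have h5' : 0 ≤ (h'.choose - i₀) / D.P := Int.ediv_nonneg (by omega) (by omega)
    have he' : (h.choose - i₀) / D.P = (h'.choose - i₀) / D.P := by omega
    have h6 := D.div_mul_le (h.choose - i₀)
    have h7 := D.div_mul_le (h'.choose - i₀)
    rw [he'] at h6
    have h8 : h.choose = h'.choose := by
      rcases lt_trichotomy h.choose h'.choose with hlt | heq | hlt
      · have := D.sep_P (x := x) (by rw [h3]; rfl) (by rw [h3']; rfl) hlt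
        omega
      · exact heq
      · have := D.sep_P (x := x) (by rw [h3']; rfl) (by rw [h3]; rfl) hlt
        omega
    rw [h8, h3'] at h3
    exact (Option.some.inj h3).symm
  refine ⟨Set.Finite.of_injOn hf hinj (Set.finite_Iio d), ?_⟩
  have := Set.ncard_le_ncard_of_injOn f hf hinj (Set.finite_Iio d)
  simpa [Set.ncard_eq_toFinset_card'] using this

/-- Each window contributes at most its length in blocks, so a large alphabet has a letter missing
from all three. Such a letter serves as a signal for the erosion gate. -/
theorem exists_letter (x₀ x₁ : ℤ → B) (i₀ i₁ i₂ : ℤ) (d₀ d₁ d₂ : ℕ) (ℓ₀ : Λ)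
    (hcard : d₀ + d₁ + d₂ + 1 < Nat.card Λ) : ∃ ℓ, ℓ ≠ ℓ₀ ∧
      (∀ i, i₀ ≤ i → i < i₀ + d₀ * D.P → D.ty x₀ i ≠ some ℓ) ∧
      (∀ i, i₁ ≤ i → i < i₁ + d₁ * D.P → D.ty x₁ i ≠ some ℓ) ∧
      (∀ i, i₂ ≤ i → i < i₂ + d₂ * D.P → D.ty x₀ i ≠ some ℓ) := by
  obtain ⟨f0, c0⟩ := D.ncard_letters x₀ i₀ d₀
  obtain ⟨f1, c1⟩ := D.ncard_letters x₁ i₁ d₁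
  obtain ⟨f2, c2⟩ := D.ncard_letters x₀ i₂ d₂
  by_contra hcon
  push Not at hcon
  have hsub : (Set.univ : Set Λ) ⊆
      {ℓ | ∃ i, i₀ ≤ i ∧ i < i₀ + d₀ * D.P ∧ D.ty x₀ i = some ℓ} ∪
      {ℓ | ∃ i, i₁ ≤ i ∧ i < i₁ + d₁ * D.P ∧ D.ty x₁ i = some ℓ} ∪
      {ℓ | ∃ i, i₂ ≤ i ∧ i < i₂ + d₂ * D.P ∧ D.ty x₀ i = some ℓ} ∪ {ℓ₀} := by
    intro ℓ _
    by_contra hℓ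
    simp only [Set.mem_union, Set.mem_singleton_iff, Set.mem_ofPred_eq, not_or, not_exists,
      not_and] at hℓ
    obtain ⟨i, h1, h2, h3⟩ := hcon ℓ hℓ.2 (fun i h1 h2 => hℓ.1.1.1 i h1 h2)
      fun i h1 h2 => hℓ.1.1.2 i h1 h2
    exact hℓ.1.2 i h1 h2 h3
  have h1 := Set.ncard_le_ncard hsub (((f0.union f1).union f2).union (Set.finite_singleton _))
  rw [Set.ncard_univ] at h1
  have h2 := Set.ncard_union_le ({ℓ | ∃ i, i₀ ≤ i ∧ i < i₀ + d₀ * D.P ∧ D.ty x₀ i = some ℓ} ∪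
      {ℓ | ∃ i, i₁ ≤ i ∧ i < i₁ + d₁ * D.P ∧ D.ty x₁ i = some ℓ} ∪
      {ℓ | ∃ i, i₂ ≤ i ∧ i < i₂ + d₂ * D.P ∧ D.ty x₀ i = some ℓ}) {ℓ₀}
  have h3 := Set.ncard_union_le ({ℓ | ∃ i, i₀ ≤ i ∧ i < i₀ + d₀ * D.P ∧ D.ty x₀ i = some ℓ} ∪
      {ℓ | ∃ i, i₁ ≤ i ∧ i < i₁ + d₁ * D.P ∧ D.ty x₁ i = some ℓ})
      {ℓ | ∃ i, i₂ ≤ i ∧ i < i₂ + d₂ * D.P ∧ D.ty x₀ i = some ℓ}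
  have h4 := Set.ncard_union_le {ℓ | ∃ i, i₀ ≤ i ∧ i < i₀ + d₀ * D.P ∧ D.ty x₀ i = some ℓ}
      {ℓ | ∃ i, i₁ ≤ i ∧ i < i₁ + d₁ * D.P ∧ D.ty x₁ i = some ℓ}
  rw [Set.ncard_singleton] at h2
  omega

variable [Inhabited Λ]

/-- Words of some length after the marker can be replaced by words with the same followers that
start with a fixed code word. -/
theorem exists_equiv_word (hs : IsSofic X) :
    ∃ Q, 1 ≤ Q ∧ Q ≤ (Set.range (language X).leftQuotient).ncard + 1 ∧
      ∀ w : List B, w.length = Q * D.P → D.k ++ w ∈ language X → ∃ w' : List B,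
        w'.length = Q * D.P ∧
        (language X).leftQuotient (D.k ++ w) = (language X).leftQuotient (D.k ++ w') ∧
        D.cw default <+: D.k ++ w' ∧
        (D.k <:+ D.k ++ w → D.k ++ w' = window D.base.1 0 (D.k.length + Q * D.P)) := by
  have hfin := Language.IsRegular.finite_range_leftQuotient hs
  -- The follower sets reached from the marker after `n` block lengths. Prepending a block preserves
  -- the follower set because `D.k` synchronizes, so these sets increase and stall at some `n`; at
  -- that point every word of length `(n + 1) * D.P` has an equivalent beginning with a block.
  let R : ℕ → Set (Language B) := fun n =>
    {q | ∃ w : List B, w.length = n * D.P ∧ D.k ++ w ∈ language X ∧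
      (language X).leftQuotient (D.k ++ w) = q}
  have hcw : ∀ {n : ℕ} {w : List B}, w.length = n * D.P → D.k ++ w ∈ language X →
      (D.m default ++ (D.k ++ w)).length = (n + 1) * D.P ∧
      D.k ++ (D.m default ++ (D.k ++ w)) ∈ language X ∧
      (language X).leftQuotient (D.k ++ (D.m default ++ (D.k ++ w))) =
        (language X).leftQuotient (D.k ++ w) := by
    intro n w hw hmem
    refine ⟨?_, by simpa using D.mem_of_cw default hmem, ?_⟩
    · simp only [List.length_append, D.length_m, hw, P]
      ring
    · rw [← List.append_assoc]
      refine D.sync.leftQuotient_append ?_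
      have := D.mem default
      rwa [D.z_eq] at this
  obtain ⟨n, hn, hR⟩ := exists_eq_succ hfin (R := R)
    (by rintro n _ ⟨w, -, -, rfl⟩; exact ⟨_, rfl⟩)
    (by
      rintro n _ ⟨w, hw, hmem, rfl⟩
      exact ⟨_, (hcw hw hmem).1, (hcw hw hmem).2.1, (hcw hw hmem).2.2⟩)
  have hpre : ∀ i : ℤ, At D.base.1 (i * D.P) (D.cw default) := by
    intro i
    rw [← Code.ty_eq_some, ty_base, emb_mul]
  refine ⟨n + 1, by omega, by omega, fun w hw hmem => ?_⟩
  -- If the word ends in the marker, its follower set is that of the marker, and it can be replaced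
  -- by a whole sequence of default blocks. This is needed when the replacement reaches past the
  -- right edge of a gap.
  by_cases hk : D.k <:+ D.k ++ w
  · have h0 : At D.base.1 0 D.k := by
      have := D.at_k (x := D.base.1) (i := 0 * D.P) (by rw [ty_base, emb_mul]; rfl)
      rwa [zero_mul] at this
    have h1 : D.k ++ window D.base.1 D.k.length ((n + 1) * D.P) =
        window D.base.1 0 (D.k.length + (n + 1) * D.P) := by
      rw [window_add, ← h0.eq_window, zero_add]
    refine ⟨window D.base.1 D.k.length ((n + 1) * D.P), by simp, ?_, ?_, fun _ => h1⟩
    · refine D.sync.leftQuotient_eq hmem ?_ hk ?_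
      · rw [h1]
        exact window_mem_language D.base.2 _ _
      · rw [h1, add_comm, window_add]
        have h2 : At D.base.1 ((n + 1 : ℕ) * D.P) D.k := by
          refine D.at_k ?_
          rw [ty_base, emb_mul]
          rfl
        have h3 := h2.eq_window
        rw [zero_add, Nat.cast_mul, ← h3]
        exact List.suffix_append _ _
    · rw [h1]
      have h2 : D.k.length + (n + 1) * D.P = (D.P + D.k.length) + n * D.P := by ring
      rw [h2, window_add, ← D.length_cw default]
      have := (hpre 0).eq_window
      rw [zero_mul] at this
      rw [← this]
      exact List.prefix_append _ _
  · have : (language X).leftQuotient (D.k ++ w) ∈ R n := by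
      rw [hR]
      exact ⟨w, hw, hmem, rfl⟩
    obtain ⟨v, hv, hmem', hq⟩ := this
    refine ⟨_, (hcw hv hmem').1, ?_, ?_, fun h => absurd h hk⟩
    · rw [(hcw hv hmem').2.2, hq]
    · rw [cw_eq, ← List.append_assoc, ← List.append_assoc]
      exact List.prefix_append _ _

end MarkerCode

/-! ### Points with a gap, and eroding the gap from the left -/

namespace MarkerCode

section Gap

variable {B : Type*} [TopologicalSpace B] {X : Subshift B ℤ} {Λ : Type*} (D : MarkerCode X Λ)

/-- `x` consists of code words except for a stretch of `n` block lengths from `0` on. -/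
structure Gapped (n : ℕ) (x : ℤ → B) : Prop where
  left : ∀ i < 0, (D.ty x (i * D.P)).isSome
  right : ∀ i : ℤ, n ≤ i → (D.ty x (i * D.P)).isSome

variable {D} in
theorem Gapped.exists_eq_mul {n : ℕ} {x : ℤ → B} (hx : D.Gapped n x) {p : ℤ}
    (hp : (D.ty x p).isSome) (h : p < 0 ∨ n * D.P ≤ p) :
    ∃ i : ℤ, p = i * D.P ∧ (i < 0 ∨ n ≤ i) := by
  have hP := D.P_pos
  have h1 := D.div_mul_le p
  have h2 : p / D.P < 0 ∨ n ≤ p / D.P := by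
    rcases h with h | h
    · exact Or.inl (Int.ediv_neg_of_neg_of_pos h (by omega))
    · exact Or.inr (Int.le_ediv_of_mul_le (by omega) h)
  refine ⟨p / D.P, ?_, h2⟩
  by_contra hne
  have h3 : (D.ty x (p / D.P * D.P)).isSome := h2.elim (hx.left _) (hx.right _)
  have := D.ty_none_of_not_dvd h3 (i := p) (by omega) (by omega)
  simp [this] at hp

/-- Replace the letters outside of the gap by `s`. -/
noncomputable def edge (n : ℕ) (t : ℤ → Option Λ) (s : ℤ → Λ) (p : ℤ) : Option Λ :=
  (t p).map fun l => if p < 0 ∨ n * D.P ≤ p then s (p / D.P) else l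

theorem edge_mul {n : ℕ} {t : ℤ → Option Λ} (s : ℤ → Λ) {i : ℤ} (hi : i < 0 ∨ n ≤ i)
    (ht : (t (i * D.P)).isSome) : D.edge n t s (i * D.P) = some (s i) := by
  have hP := D.P_pos
  have h : i * D.P < 0 ∨ n * D.P ≤ i * D.P := by
    rcases hi with hi | hi
    · exact Or.inl (mul_neg_of_neg_of_pos hi (by omega))
    · exact Or.inr (mul_le_mul_of_nonneg_right hi (by omega))
  obtain ⟨l, hl⟩ := Option.isSome_iff_exists.1 ht
  rw [edge, hl, Option.map_some, if_pos h, Int.mul_ediv_cancel _ (by omega)]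

theorem edge_gap {n : ℕ} (t : ℤ → Option Λ) (s : ℤ → Λ) {p : ℤ} (h0 : 0 ≤ p) (h1 : p < n * D.P) :
    D.edge n t s p = t p := by
  rw [edge]
  have : ¬ (p < 0 ∨ n * D.P ≤ p) := by omega
  simp [this]

theorem fits_edge (n : ℕ) (x : ℤ → B) (s : ℤ → Λ) : D.Fits x (D.edge n (D.ty x) s) := by
  intro p
  simp [edge]

/-- The point with the letters `s` outside of the gap. -/
noncomputable def refill (n : ℕ) (x : X.carrier) (s : ℤ → Λ) : X.carrier :=
  ⟨D.put x.1 (D.edge n (D.ty x.1) s), Code.put_mem x.2 (D.fits_edge n x.1 s)⟩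

variable {n : ℕ} {x : X.carrier}

theorem ty_refill (s : ℤ → Λ) : D.ty (D.refill n x s).1 = D.edge n (D.ty x.1) s :=
  Code.ty_put (D.fits_edge n x.1 s)

theorem isSome_ty_refill (s : ℤ → Λ) (p : ℤ) :
    (D.ty (D.refill n x s).1 p).isSome ↔ (D.ty x.1 p).isSome := by
  rw [ty_refill]
  exact D.fits_edge n x.1 s p

variable (hx : D.Gapped n x.1)

include hx

theorem gapped_refill (s : ℤ → Λ) : D.Gapped n (D.refill n x s).1 :=
  ⟨fun i hi => (D.isSome_ty_refill s _).2 (hx.left i hi),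
    fun i hi => (D.isSome_ty_refill s _).2 (hx.right i hi)⟩

theorem ty_refill_mul (s : ℤ → Λ) {i : ℤ} (hi : i < 0 ∨ n ≤ i) :
    D.ty (D.refill n x s).1 (i * D.P) = some (s i) := by
  rw [ty_refill]
  exact D.edge_mul s hi (hi.elim (hx.left i) (hx.right i))

theorem refill_congr {s s' : ℤ → Λ} {p : ℤ}
    (h : ∀ i : ℤ, (i < 0 ∨ n ≤ i) → i * D.P ≤ p → p < i * D.P + D.P → s i = s' i) :
    (D.refill n x s).1 p = (D.refill n x s').1 p := by
  refine Code.put_congr fun i hi => ?_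
  have h1 := hi.2
  have h2 : (D.k.length : ℤ) + D.n = D.P := by simp [P]
  by_cases hi' : i < 0 ∨ n * D.P ≤ i
  · obtain ⟨j, rfl, hj⟩ := hx.exists_eq_mul hi.1 hi'
    rw [D.edge_mul s hj hi.1, D.edge_mul s' hj hi.1, h j hj (by omega) (by omega)]
  · rw [D.edge_gap _ _ (by omega) (by omega), D.edge_gap _ _ (by omega) (by omega)]

end Gap

section Erosion

variable {B : Type*} [TopologicalSpace B] {X : Subshift B ℤ} {Λ : Type*} (D : MarkerCode X Λ)

/-- The code that exchanges the words `w` and `w'` with the same followers after a code word. -/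
def erosionCode (ℓ : Λ) (w w' z : List B) (x₀ x₁ : ℤ → B) (N : ℕ) (hw : w.length = N)
    (hw' : w'.length = N) (hz : z.length = D.P + D.k.length) (hne : w ≠ w')
    (hq : (language X).leftQuotient (D.k ++ w) = (language X).leftQuotient (D.k ++ w'))
    (h₀ : At x₀ 0 (D.k ++ w ++ z)) (h₁ : At x₁ 0 (D.k ++ w' ++ z))
    (hℓ : ∀ i : ℤ, 0 ≤ i → i < D.k.length + N → D.ty x₀ i ≠ some ℓ ∧ D.ty x₁ i ≠ some ℓ) :
    Code (language X) Bool where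
  k := D.cw ℓ
  z := z
  m b := if b then w' else w
  n := N
  length_m b := by cases b <;> simpa
  length_z := by rw [hz, D.length_cw]
  inj := by
    intro b b' h
    cases b <;> cases b' <;> simp_all
  sep := by
    intro x i j b b' hi hj hij
    -- An illegally overlapping second occurrence begins with the block of `ℓ`, which would start
    -- inside `D.k ++ w` or `D.k ++ w'`; `z` is one block word long, so that block would lie
    -- entirely in the known word, contradicting the choice of `ℓ`.
    rw [List.append_assoc, at_append, D.length_cw] at hi hj
    by_contra hcon
    rw [D.length_cw] at hcon
    push_cast at hcon
    have h1 := D.sep_P (D.isSome_ty.2 ⟨ℓ, hi.1⟩) (D.isSome_ty.2 ⟨ℓ, hj.1⟩) hij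
    have hi1 : At x (i + D.P) D.k := by
      have := hi.1
      rw [cw_eq, at_append, List.length_append, D.length_m] at this
      exact this.2
    have hi2 : At x (i + D.P) (D.k ++ ((if b then w' else w) ++ z)) := by
      refine at_append.2 ⟨hi1, ?_⟩
      have := hi.2
      push_cast at this
      rwa [← add_assoc] at this
    rw [← List.append_assoc] at hi2
    obtain ⟨y, hy, hyℓ⟩ : ∃ y : ℤ → B, At y 0 (D.k ++ (if b then w' else w) ++ z) ∧
        ∀ i : ℤ, 0 ≤ i → i < D.k.length + N → D.ty y i ≠ some ℓ := by
      cases b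
      · exact ⟨x₀, by simpa using h₀, fun i h1 h2 => (hℓ i h1 h2).1⟩
      · exact ⟨x₁, by simpa using h₁, fun i h1 h2 => (hℓ i h1 h2).2⟩
    refine hyℓ (j - i - D.P) (by omega) (by omega) ?_
    rw [D.ty_eq_some]
    have h2 := hj.1
    have hlen : (D.k ++ (if b then w' else w) ++ z).length =
        D.k.length + N + (D.P + D.k.length) := by
      cases b <;> simp [hw, hw', hz] <;> ring
    intro a ha
    rw [← h2 a ha]
    rw [D.length_cw] at ha
    have := hi2.eq hy (a := j - i - D.P + a) (by omega) (by rw [hlen]; push_cast; omega)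
    rw [zero_add] at this
    rw [← this]
    congr 1
    ring
  swap := by
    intro a b c c' h
    have hq' : (language X).leftQuotient (D.k ++ (if c then w' else w)) =
        (language X).leftQuotient (D.k ++ (if c' then w' else w)) := by
      cases c <;> cases c' <;> simp [hq]
    have := D.sync.replace (a := a ++ D.k ++ D.m ℓ) (b := z ++ b) hq'
      (by simpa [cw_eq] using h)
    simpa [cw_eq] using this

variable [DiscreteTopology B] [Finite B] [Inhabited Λ] {n : ℕ} {x : X.carrier} {a : Aut X}

/-- A gap between simple sequences of letters can be shortened. -/
theorem fix_refill (hs : IsSofic X)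
    (hcard : 3 * (Set.range (language X).leftQuotient).ncard + 9 ≤ Nat.card Λ)
    (hE : ∀ C : Code (language X) Bool,
      C.k.length + C.n ≤ ((Set.range (language X).leftQuotient).ncard + 3) * D.P →
      Commute a ((permRule Equiv.boolNot).gate C))
    (hn : 1 ≤ n) (ih : ∀ y : X.carrier, D.Gapped (n - 1) y.1 → a.1 y = y)
    (hx : D.Gapped n x.1) (h0 : D.ty x.1 0 = none) : ∃ ℓ,
    a.1 (D.refill n x fun i => if i = -1 then ℓ else default) =
      D.refill n x fun i => if i = -1 then ℓ else default := by
  classical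
  obtain ⟨Q, hQ1, hQ2, hQ⟩ := D.exists_equiv_word hs
  have hP := D.P_pos
  have hkP := D.k_le_P
  have hk0 := D.k_pos
  set x₀ := D.refill n x fun _ => default with hx₀
  have hg₀ : D.Gapped n x₀.1 := D.gapped_refill hx _
  have hk₀ : At x₀.1 0 D.k := by
    have := D.at_k_succ (hg₀.left (-1) (by omega))
    rwa [neg_one_mul, neg_add_cancel] at this
  set w := window x₀.1 D.k.length (Q * D.P) with hw
  set z := window x₀.1 (D.k.length + Q * D.P : ℕ) (D.P + D.k.length) with hz
  have hkw : At x₀.1 0 (D.k ++ w) := at_append.2 ⟨hk₀, by simpa using at_window x₀.1 _ _⟩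
  have hwz : At x₀.1 0 (D.k ++ w ++ z) := by
    refine at_append.2 ⟨hkw, ?_⟩
    have : (0 : ℤ) + (D.k ++ w).length = (D.k.length + Q * D.P : ℕ) := by simp [hw]
    rw [this]
    exact at_window _ _ _
  obtain ⟨w', hw'1, hw'2, hw'3, hw'4⟩ := hQ w (by simp [hw]) ⟨x₀.1, x₀.2, 0, hkw⟩
  -- The gap does not begin with a block, whereas `D.k ++ w'` does.
  have hne : w ≠ w' := by
    rintro h
    rw [← h] at hw'3
    have h1 := D.ty_eq_some.2 (hkw.of_prefix hw'3)
    have h2 := (D.isSome_ty_refill (n := n) (x := x) (fun _ => default) 0).1 (by rw [h1]; rfl)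
    simp [h0] at h2
  -- A bookkeeping configuration containing `D.k ++ w' ++ z`; no membership in `X` is needed, only
  -- the list of code words occurring in it.
  set x₁ : ℤ → B := fun p => if h : 0 ≤ p - D.k.length ∧ p - D.k.length < Q * D.P then
    w'[(p - D.k.length).toNat]'(by
      have h1 := h.1
      have h2 := h.2
      zify
      rw [hw'1]
      push_cast
      omega) else x₀.1 p with hx₁
  have hwz' : At x₁ 0 (D.k ++ w' ++ z) := by
    refine at_append.2 ⟨at_append.2 ⟨hk₀.congr fun p h1 h2 => ?_, fun c hc => ?_⟩, ?_⟩
    · rw [hx₁]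
      dsimp only
      rw [dif_neg (by omega)]
    · rw [hw'1] at hc
      rw [hx₁]
      dsimp only
      zify at hc
      rw [dif_pos (by omega)]
      congr 1
      omega
    · have : (0 : ℤ) + (D.k ++ w').length = (D.k.length + Q * D.P : ℕ) := by simp [hw'1]
      rw [this]
      refine (at_window _ _ _).congr fun p h1 h2 => ?_
      rw [hx₁]
      push_cast at h1
      dsimp only
      rw [dif_neg (by omega)]
  -- The first two windows cover `D.k ++ w` and `D.k ++ w'`. The third keeps other occurrences of
  -- the erosion code away from the right edge of the gap. The total `3 * Q + 5` is below the
  -- alphabet size because `Q` exceeds the number of follower sets by at most one.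
  obtain ⟨ℓ, hℓ0, hℓ1, hℓ2, hℓ3⟩ := D.exists_letter x₀.1 x₁ 0 0 (n * D.P - (Q + 2) * D.P) (Q + 1)
    (Q + 1) (Q + 2) default (by omega)
  push_cast at hℓ1 hℓ2 hℓ3
  have hQP : ((Q : ℤ) + 1) * D.P = Q * D.P + D.P := by ring
  have hQP2 : ((Q : ℤ) + 2) * D.P = Q * D.P + 2 * D.P := by ring
  refine ⟨ℓ, ?_⟩
  set s : ℤ → Λ := fun i => if i = -1 then ℓ else default with hs
  set y := D.refill n x s with hy
  have hgy : D.Gapped n y.1 := D.gapped_refill hx _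
  have hyx : ∀ p, 0 ≤ p → y.1 p = x₀.1 p := by
    intro p hp
    refine D.refill_congr hx fun i hi h1 h2 => ?_
    rcases hi with hi | hi
    · have : i * (D.P : ℤ) ≤ -1 * D.P := mul_le_mul_of_nonneg_right (by omega) (by omega)
      omega
    · rw [hs]
      dsimp only
      rw [if_neg (by omega)]
  let C := D.erosionCode ℓ w w' z x₀.1 x₁ (Q * D.P) (by simp [hw]) hw'1 (by simp [hz]) hne hw'2
    hwz hwz' (fun i h1 h2 => by
      push_cast at h2
      exact ⟨hℓ1 i h1 (by omega), hℓ2 i h1 (by omega)⟩)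
  have hCk : (C.k.length : ℤ) = D.P + D.k.length := by
    have := D.length_cw ℓ
    change ((D.cw ℓ).length : ℤ) = _
    omega
  have hCn : (C.n : ℤ) = Q * D.P := by
    change ((Q * D.P : ℕ) : ℤ) = _
    push_cast
    rfl
  have hC : (C.ty y.1 (-D.P)) = some false := by
    rw [C.ty_eq_some]
    change At y.1 (-D.P) (D.cw ℓ ++ w ++ z)
    rw [cw_eq, List.append_assoc, List.append_assoc, at_append]
    have h1 : At y.1 (-D.P) (D.cw ℓ) := by
      have := D.ty_refill_mul hx s (i := -1) (by omega)
      rw [D.ty_eq_some, neg_one_mul] at this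
      simpa [hs] using this
    rw [cw_eq, at_append] at h1
    refine ⟨h1.1, ?_⟩
    rw [← List.append_assoc]
    have : (-D.P + (D.k ++ D.m ℓ).length : ℤ) = 0 := by
      rw [List.length_append, D.length_m]
      simp [P]
    rw [this]
    exact hwz.congr fun p h1 _ => hyx p h1
  -- Outside the gap `ℓ` occurs only at block `-1`; inside, the windows exclude it near both ends.
  -- So the gate acts at `-D.P` and possibly deep inside the gap.
  have hmid : ∀ j, (C.ty y.1 j).isSome →
      j = -D.P ∨ (Q + 1) * D.P ≤ j ∧ j < n * D.P - (Q + 2) * D.P := by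
    intro j hj
    obtain ⟨b, hb⟩ := C.isSome_ty.1 hj
    have hj : D.ty y.1 j = some ℓ := by
      rw [D.ty_eq_some]
      have h2 : At y.1 j (D.cw ℓ ++ (if b then w' else w) ++ z) := hb
      rw [List.append_assoc, at_append] at h2
      exact h2.1
    have hside : j < 0 ∨ n * D.P ≤ j → j = -D.P := by
      intro h
      obtain ⟨i, rfl, hi⟩ := hgy.exists_eq_mul (by rw [hj]; rfl) h
      rw [D.ty_refill_mul hx s hi, Option.some.injEq, hs] at hj
      dsimp only at hj
      split_ifs at hj with h1
      · rw [h1, neg_one_mul]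
      · exact absurd hj.symm hℓ0
    by_cases h : j < 0 ∨ n * D.P ≤ j
    · exact Or.inl (hside h)
    · right
      have hj0 : D.ty x₀.1 j = some ℓ := by
        rw [← hj]
        exact D.ty_congr fun p h1 h2 => (hyx p (by omega)).symm
      constructor
      · by_contra hlt
        exact hℓ1 j (by omega) (by omega) hj0
      · by_contra hlt
        exact hℓ3 j (by omega) (by omega) hj0
  set G := (permRule Equiv.boolNot).gate C with hG
  set y' := G.1 y with hy'
  have hy'1 : y'.1 = C.put y.1 ((permRule Equiv.boolNot).f (C.ty y.1)) := rfl
  have hoff : ∀ p : ℤ, p < D.k.length ∨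
      (D.k.length + Q * D.P ≤ p ∧ n * D.P - D.P + D.k.length ≤ p) →
      y'.1 p = y.1 p := by
    intro p hp
    rw [hy'1]
    refine Code.put_off fun j hj => ?_
    have h1 := hj.2
    rw [hCk, hCn] at h1
    rcases hmid j hj.1 with h | h
    · omega
    · rcases hp with hp | hp <;> omega
  have hat : At y'.1 0 (D.k ++ w') := by
    have h1 : At y'.1 (-D.P) (C.cw true) := by
      rw [hy'1]
      refine Code.at_put (by rw [hC]; rfl) ?_
      simp [permRule, hC, Equiv.boolNot]
    have h2 : At y'.1 (-D.P) (D.cw ℓ ++ w' ++ z) := h1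
    rw [cw_eq, List.append_assoc, List.append_assoc, at_append] at h2
    have h3 := h2.2
    rw [← List.append_assoc, at_append] at h3
    have : (-D.P + (D.k ++ D.m ℓ).length : ℤ) = 0 := by
      rw [List.length_append, D.length_m]
      simp [P]
    rw [this] at h3
    exact h3.1
  -- The gate has planted a default block at position 0, so the gap is one block shorter; the shift
  -- restores its left edge to 0.
  have hgap : D.Gapped (n - 1) (shiftOn X D.P y').1 := by
    have hsh : ∀ i, D.ty (shiftOn X D.P y').1 (i * D.P) = D.ty y'.1 ((i + 1) * D.P) := by
      intro i
      change D.ty (shift (D.P : ℤ) y'.1) _ = _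
      rw [D.ty_shift, shift_apply]
      congr 1
      ring
    refine ⟨fun i hi => ?_, fun i hi => ?_⟩
    · rw [hsh]
      rcases eq_or_lt_of_le (show i + 1 ≤ 0 by omega) with h | h
      · rw [h, zero_mul, D.ty_eq_some.2 (hat.of_prefix hw'3)]
        rfl
      · rw [D.ty_congr (x := y.1)]
        · exact hgy.left _ h
        · intro p h1 h2
          have : (i + 1) * (D.P : ℤ) ≤ -1 * D.P := mul_le_mul_of_nonneg_right (by omega) (by omega)
          refine hoff p (Or.inl ?_)
          unfold P at *
          push_cast at *
          omega
    · rw [hsh]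
      rw [Nat.cast_sub hn] at hi
      have hi' : n ≤ i + 1 := by push_cast at hi; omega
      have hiP : (n : ℤ) * D.P ≤ (i + 1) * D.P := mul_le_mul_of_nonneg_right hi' (by omega)
      -- If `n ≤ Q` the replaced stretch covers the whole gap. It then ends in the marker of a block
      -- to its right, so `w'` consists of default blocks and the alignment is preserved.
      rcases le_or_gt n Q with hnQ | hnQ
      · have hbase : D.k ++ w' = window D.base.1 0 (D.k.length + Q * D.P) := by
          apply hw'4
          have h2 : At x₀.1 (Q * D.P) D.k := D.at_k (hg₀.right Q (by omega))
          have h3 := hkw.eq_window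
          have h4 : (D.k ++ w).length = Q * D.P + D.k.length := by simp [hw]; ring
          rw [h4, window_add, zero_add, Nat.cast_mul, ← h2.eq_window] at h3
          rw [h3]
          exact List.suffix_append _ _
        have hyb : ∀ p : ℤ, 0 ≤ p → p < D.k.length + Q * D.P → y'.1 p = D.base.1 p := by
          intro p h1 h2
          have h3 := hat
          rw [hbase] at h3
          have := h3.eq (at_window D.base.1 0 (D.k.length + Q * D.P)) (a := p) h1
            (by rw [length_window]; push_cast; exact h2)
          simpa using this
        rcases lt_or_ge (i + 1) (Q : ℤ) with hlt | hge
        · rw [D.ty_congr (x := D.base.1)]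
          · rw [ty_base, emb_mul]
            rfl
          · intro p h1 h2
            have h5 : (i + 1 + 1) * (D.P : ℤ) ≤ Q * D.P :=
              mul_le_mul_of_nonneg_right (by omega) (by omega)
            have h6 : (i + 1 + 1) * (D.P : ℤ) = (i + 1) * D.P + D.P := by ring
            have h7 : (0 : ℤ) ≤ n * D.P := by positivity
            refine hyb p (by omega) ?_
            have h8 : (D.k.length : ℤ) + D.n = D.P := by simp [P]
            omega
        · have h5 : (Q : ℤ) * D.P ≤ (i + 1) * D.P := mul_le_mul_of_nonneg_right hge (by omega)
          rw [D.ty_congr (x := y.1)]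
          · exact hgy.right _ hi'
          · intro p h1 h2
            rcases lt_or_ge p (D.k.length + Q * D.P : ℤ) with hp | hp
            · have h7 : (0 : ℤ) ≤ Q * D.P := by positivity
              rw [hyb p (by omega) hp]
              have h8 : At D.base.1 (Q * D.P) D.k := by
                refine D.at_k ?_
                rw [ty_base, emb_mul]
                rfl
              have h9 : At y.1 (Q * D.P) D.k := D.at_k (hgy.right Q (by omega))
              have := h8.eq h9 (a := p - Q * D.P) (by omega) (by omega)
              simpa using this
            · have h7 : (n : ℤ) * D.P ≤ Q * D.P :=
                mul_le_mul_of_nonneg_right (by omega) (by omega)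
              exact hoff p (Or.inr ⟨hp, by omega⟩)
      · have h7 : ((Q : ℤ) + 1) * D.P ≤ n * D.P :=
          mul_le_mul_of_nonneg_right (by omega) (by omega)
        rw [D.ty_congr (x := y.1)]
        · exact hgy.right _ hi'
        · intro p h1 h2
          exact hoff p (Or.inr (by omega))
  have hfix := ih _ hgap
  rw [Aut.shift_comm] at hfix
  have hfix' : a.1 y' = y' := by
    apply Subtype.ext
    funext p
    have := congrArg (fun u : X.carrier => u.1 (p - D.P)) hfix
    simpa [shiftOn] using this
  have hcomm := hE C (by
    have h1 : (Q + 2) * D.P ≤ ((Set.range (language X).leftQuotient).ncard + 3) * D.P :=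
      Nat.mul_le_mul_right _ (by omega)
    have h2 : (Q + 2) * D.P = Q * D.P + 2 * D.P := by ring
    zify at h1 h2 ⊢
    rw [hCk, hCn]
    omega)
  have h1 := Aut.comm_apply hcomm y
  -- `a` fixes `G y` by induction and commutes with `G`, so it fixes `y`.
  rw [← hG, ← hy', hfix', hy'] at h1
  exact (G.1.injective h1).symm

end Erosion

end MarkerCode

/-! ### Iterating the belt next to a gap -/

section Iterate

variable {B : Type*} [TopologicalSpace B] {X : Subshift B ℤ} {Λ : Type*} (ρ : Rule Λ)
  (C : Code (language X) Λ)

theorem Rule.fits_iterate {x : ℤ → B} {t : ℤ → Option Λ} (ht : C.Fits x t) (J : ℕ) :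
    C.Fits x (ρ.f^[J] t) := by
  induction J with
  | zero => exact ht
  | succ J ih =>
    rw [Function.iterate_succ_apply']
    exact fun i => by rw [ρ.dom, ih i]

variable [DiscreteTopology B] [Finite B]

theorem Rule.gate_iterate_put {x : ℤ → B} {t : ℤ → Option Λ} (ht : C.Fits x t) {y : X.carrier}
    (hy : y.1 = C.put x t) (J : ℕ) : ((ρ.gate C).1^[J] y).1 = C.put x (ρ.f^[J] t) := by
  induction J with
  | zero => exact hy
  | succ J ih =>
    rw [Function.iterate_succ_apply', Function.iterate_succ_apply']
    exact ρ.gate_put C (ρ.fits_iterate C ht J) _ ih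

theorem Aut.comm_iterate {a h : Aut X} (hc : Commute a h) (J : ℕ) (x : X.carrier) :
    a.1 (h.1^[J] x) = h.1^[J] (a.1 x) := by
  induction J with
  | zero => rfl
  | succ J ih => rw [Function.iterate_succ_apply', Function.iterate_succ_apply',
      Aut.comm_apply hc, ih]

end Iterate

namespace MarkerCode

theorem le_of_lt_mul_add {P i q : ℤ} {K : ℕ} (hP : 1 ≤ P) (h : q < i * P + P) (hq : -(K : ℤ) ≤ q) :
    -(K : ℤ) ≤ i := by
  by_contra hc
  have : (i + 1) * P ≤ (i + 1) * 1 := mul_le_mul_of_nonpos_left hP (by omega)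
  rw [add_mul] at this
  omega

theorem lt_of_mul_le {P i q : ℤ} {n K : ℕ} (hP : 1 ≤ P) (h : i * P ≤ q) (hq : q < n * P + K) :
    i < n + K := by
  by_contra hc
  have h1 : (n + K) * P ≤ i * P := mul_le_mul_of_nonneg_right (by omega) (by omega)
  have h2 : (K : ℤ) * 1 ≤ K * P := mul_le_mul_of_nonneg_left hP (by omega)
  rw [add_mul] at h1
  omega

section Near

variable {B : Type*} [TopologicalSpace B] {X : Subshift B ℤ} {Λ : Type*} {D : MarkerCode X Λ}
  [DiscreteTopology B] [Finite B] [Inhabited Λ] {n : ℕ} {x : X.carrier} {a : Aut X}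

/-- Every window of radius `R` is seen either in a gapless coded point or, when it meets the gap, in
the point with letters `s₀`. Such windows stay within `2 * R` of the gap, whence the constant. -/
theorem fix_refill_of_near {R : ℕ} (hR : IsLocal R a.1) (hfix : ∀ t, a.1 (D.pt t) = D.pt t)
    (hx : D.Gapped n x.1) {s₀ s : ℤ → Λ} (h₀ : a.1 (D.refill n x s₀) = D.refill n x s₀)
    (hs : ∀ i : ℤ, -(2 * R : ℕ) ≤ i → i < n + (2 * R : ℕ) → s i = s₀ i) :
    a.1 (D.refill n x s) = D.refill n x s := by
  have hP := D.P_pos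
  refine hR.fix fun p => ?_
  by_cases hp : p + R < 0 ∨ n * D.P ≤ p - R
  · refine ⟨D.pt s, hfix s, fun q h1 h2 => ?_⟩
    have h3 := D.div_mul_le q
    refine D.eq_pt_apply (i := q / D.P) (D.ty_refill_mul hx s ?_) h3.1 (by omega)
    rcases hp with hp | hp
    · exact Or.inl (Int.ediv_neg_of_neg_of_pos (by omega) (by omega))
    · exact Or.inr (Int.le_ediv_of_mul_le (by omega) (by omega))
  · refine ⟨D.refill n x s₀, h₀, fun q h1 h2 => ?_⟩
    refine D.refill_congr hx fun i _ h3 h4 => hs i ?_ ?_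
    · exact le_of_lt_mul_add (by omega) h4 (by push_cast; omega)
    · exact lt_of_mul_le (by omega) h3 (by push_cast; omega)

end Near

section Belt

variable {B : Type*} [TopologicalSpace B] {X : Subshift B ℤ} {Γ : Type*}
  {D : MarkerCode X (Γ × Γ)} {n : ℕ} {x : ℤ → B}

/-- The two tracks left of the gap, joined by the reflection at the edge, unfold to one bi-infinite
sequence `c`, on which the belt is a plain translation. Thus all letters near the gap are eventually
carried off to the left. -/
theorem beltRule_left (h0 : D.ty x 0 = none) {t : ℤ → Option (Γ × Γ)} (ht : D.Fits x t)
    {c : ℤ → Γ} (hc : ∀ i < 0, t (i * D.P) = some (c (-i), c (i + 1))) (J : ℕ) :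
    ∀ i < 0, (beltRule D.P).f^[J] t (i * D.P) = some (c (-i - J), c (i + 1 - J)) := by
  induction J with
  | zero => simpa using hc
  | succ J ih =>
    intro i hi
    have hf := (beltRule D.P).fits_iterate D.toCode ht J
    rw [Function.iterate_succ_apply']
    set u := (beltRule D.P).f^[J] t
    have h1 : i * (D.P : ℤ) + D.P = (i + 1) * D.P := by ring
    have h2 : i * (D.P : ℤ) - D.P = (i - 1) * D.P := by ring
    have h3 : (beltRule D.P).f u (i * D.P) = (u (i * D.P)).map fun l =>
        ((u (i * D.P + D.P)).elim l.2 Prod.fst, (u (i * D.P - D.P)).elim l.1 Prod.snd) := rfl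
    rw [h3, ih i hi, h2, ih (i - 1) (by omega), h1]
    rcases eq_or_lt_of_le (show i + 1 ≤ 0 by omega) with h | h
    · have h4 : u ((i + 1) * D.P) = none := by
        rw [h, zero_mul, ← Option.not_isSome_iff_eq_none, hf 0, h0]
        simp
      rw [h4]
      obtain rfl : i = -1 := by omega
      simp only [Option.map_some, Option.elim_none, Option.elim_some]
      push_cast
      ring_nf
    · rw [ih (i + 1) h]
      simp only [Option.map_some, Option.elim_some]
      push_cast
      ring_nf

/-- The mirror image on the right: letters travel inwards on the first track, reflect at the edge of
the gap and leave on the second. -/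
theorem beltRule_right (h1 : D.ty x ((n - 1) * D.P) = none) {t : ℤ → Option (Γ × Γ)}
    (ht : D.Fits x t) {d : ℤ → Γ}
    (hd : ∀ i : ℤ, n ≤ i → t (i * D.P) = some (d (n - i), d (i - n + 1))) (J : ℕ) :
    ∀ i : ℤ, n ≤ i →
      (beltRule D.P).f^[J] t (i * D.P) = some (d (n - i - J), d (i - n + 1 - J)) := by
  induction J with
  | zero => simpa using hd
  | succ J ih =>
    intro i hi
    have hf := (beltRule D.P).fits_iterate D.toCode ht J
    rw [Function.iterate_succ_apply']
    set u := (beltRule D.P).f^[J] t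
    have h2 : i * (D.P : ℤ) + D.P = (i + 1) * D.P := by ring
    have h3 : i * (D.P : ℤ) - D.P = (i - 1) * D.P := by ring
    have h4 : (beltRule D.P).f u (i * D.P) = (u (i * D.P)).map fun l =>
        ((u (i * D.P + D.P)).elim l.2 Prod.fst, (u (i * D.P - D.P)).elim l.1 Prod.snd) := rfl
    rw [h4, ih i hi, h2, ih (i + 1) (by omega), h3]
    rcases eq_or_lt_of_le hi with h | h
    · have h5 : u ((i - 1) * D.P) = none := by
        rw [← h, ← Option.not_isSome_iff_eq_none, hf, h1]
        simp
      rw [h5]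
      subst h
      simp only [Option.map_some, Option.elim_none, Option.elim_some]
      push_cast
      ring_nf
    · rw [ih (i - 1) (by omega)]
      simp only [Option.map_some, Option.elim_some]
      push_cast
      ring_nf

/-- A code word in the gap could be adjacent to an outer block only from position `0` or `(n - 1) *
D.P`, where there is none. So belts inside and outside do not interact. -/
theorem beltRule_gap (hx : D.Gapped n x) (h0 : D.ty x 0 = none) (h1 : D.ty x ((n - 1) * D.P) = none)
    {t t' : ℤ → Option (Γ × Γ)} (ht : D.Fits x t) (ht' : D.Fits x t')
    (h : ∀ p : ℤ, 0 ≤ p → p < n * D.P → t p = t' p) (J : ℕ) : ∀ p : ℤ, 0 ≤ p → p < n * D.P →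
      (beltRule D.P).f^[J] t p = (beltRule D.P).f^[J] t' p := by
  induction J with
  | zero => exact h
  | succ J ih =>
    intro p hp hp'
    have hf := (beltRule D.P).fits_iterate D.toCode ht J
    have hf' := (beltRule D.P).fits_iterate D.toCode ht' J
    rw [Function.iterate_succ_apply', Function.iterate_succ_apply']
    set u := (beltRule D.P).f^[J] t
    set u' := (beltRule D.P).f^[J] t'
    have hP := D.P_pos
    have hF : ∀ u : ℤ → Option (Γ × Γ), (beltRule D.P).f u p = (u p).map fun l =>
        ((u (p + D.P)).elim l.2 Prod.fst, (u (p - D.P)).elim l.1 Prod.snd) := fun _ => rfl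
    rw [hF, hF, ← ih p hp hp']
    by_cases hs : (D.ty x p).isSome
    · have hne0 : p ≠ 0 := by
        rintro rfl
        simp [h0] at hs
      have hne1 : p ≠ (n - 1) * D.P := by
        rintro rfl
        simp [h1] at hs
      rw [sub_mul] at hne1
      have hout : ∀ q, (q = p + D.P ∧ n * D.P ≤ q) ∨ (q = p - D.P ∧ q < 0) →
          ¬ (D.ty x q).isSome := by
        intro q hq hq2
        obtain ⟨i, rfl, hi⟩ := hx.exists_eq_mul hq2 (by tauto)
        rcases hq with ⟨hq, hq'⟩ | ⟨hq, hq'⟩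
        · rcases eq_or_lt_of_le (show (n : ℤ) ≤ i by
            by_contra hcon
            have : (i + 1) * (D.P : ℤ) ≤ n * D.P :=
              mul_le_mul_of_nonneg_right (by omega) (by omega)
            rw [add_mul] at this
            omega) with h | h
          · rw [← h] at hq
            omega
          · have : ((n : ℤ) + 1) * D.P ≤ i * D.P :=
              mul_le_mul_of_nonneg_right (by omega) (by omega)
            rw [add_mul] at this
            omega
        · rcases eq_or_lt_of_le (show i ≤ -1 by
            by_contra hcon
            have : 0 * (D.P : ℤ) ≤ i * D.P := mul_le_mul_of_nonneg_right (by omega) (by omega)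
            omega) with h | h
          · rw [h] at hq
            omega
          · have : (i + 1) * (D.P : ℤ) ≤ -1 * D.P :=
              mul_le_mul_of_nonneg_right (by omega) (by omega)
            rw [add_mul] at this
            omega
      have hnone : ∀ q, ¬ (D.ty x q).isSome → u q = u' q := by
        intro q hq
        have e1 : u q = none := by rwa [← Option.not_isSome_iff_eq_none, hf q]
        have e2 : u' q = none := by rwa [← Option.not_isSome_iff_eq_none, hf' q]
        rw [e1, e2]
      have e1 : u (p + D.P) = u' (p + D.P) := by
        rcases lt_or_ge (p + D.P) (n * D.P : ℤ) with h | h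
        · exact ih _ (by omega) h
        · exact hnone _ (hout _ (Or.inl ⟨rfl, h⟩))
      have e2 : u (p - D.P) = u' (p - D.P) := by
        rcases lt_or_ge (p - D.P) (0 : ℤ) with h | h
        · exact hnone _ (hout _ (Or.inr ⟨rfl, h⟩))
        · exact ih _ h (by omega)
      rw [e1, e2]
    · have e1 : u p = none := by rwa [← Option.not_isSome_iff_eq_none, hf p]
      rw [e1]
      rfl

end Belt

section Fix

variable {B : Type*} [TopologicalSpace B] [DiscreteTopology B] [Finite B] {X : Subshift B ℤ}
  {Γ : Type*} [Inhabited Γ] {D : MarkerCode X (Γ × Γ)} {a : Aut X}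

/-- Letters can be moved away from the gap by the belts. -/
theorem fix_of_forall_refill {n : ℕ} {x : X.carrier}
    (hbelt : Commute a ((beltRule D.P).gate D.toCode)) (hfix : ∀ t, a.1 (D.pt t) = D.pt t)
    (hx : D.Gapped n x.1) (h0 : D.ty x.1 0 = none) (h1 : D.ty x.1 ((n - 1) * D.P) = none)
    (H : ∀ y : X.carrier, D.Gapped n y.1 → D.ty y.1 0 = none →
      ∃ s, a.1 (D.refill n y s) = D.refill n y s) : a.1 x = x := by
  obtain ⟨R, hR⟩ := Aut.exists_isLocal a
  have hP := D.P_pos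
  refine hR.fix fun p => ?_
  set F := (beltRule D.P).gate D.toCode with hF
  set K : ℕ := p.natAbs + R + 1 with hK
  set K₀ : ℕ := 2 * R with hK₀
  -- Write `x = F^J x'` and replace the letters of `x'` within `K₀` blocks of the gap by the fixed
  -- pattern `s₀`. After `J` belt steps the alterations have left the first `K` blocks on either
  -- side, so the fixed point `F^J y` agrees with `x` near `p`.
  set J : ℕ := K + K₀ + 3 with hJ
  obtain ⟨x', hx'⟩ := F.1.surjective.iterate J x
  have hself : x'.1 = D.put x'.1 (D.ty x'.1) := (Code.put_self _).symm
  have hput : x.1 = D.put x'.1 ((beltRule D.P).f^[J] (D.ty x'.1)) := by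
    rw [← hx']
    exact (beltRule D.P).gate_iterate_put D.toCode (Code.fits_ty _) hself J
  have hfitJ := (beltRule D.P).fits_iterate D.toCode (Code.fits_ty x'.1 : D.Fits x'.1 _) J
  have hdom : ∀ i, (D.ty x.1 i).isSome ↔ (D.ty x'.1 i).isSome := by
    intro i
    rw [hput, Code.ty_put hfitJ]
    exact hfitJ i
  have hx'g : D.Gapped n x'.1 :=
    ⟨fun i hi => (hdom _).1 (hx.left i hi), fun i hi => (hdom _).1 (hx.right i hi)⟩
  have h0' : D.ty x'.1 0 = none := by
    rw [← Option.not_isSome_iff_eq_none, ← hdom, h0]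
    simp
  have h1' : D.ty x'.1 ((n - 1) * D.P) = none := by
    rw [← Option.not_isSome_iff_eq_none, ← hdom, h1]
    simp
  obtain ⟨s₀, hs₀⟩ := H x' hx'g h0'
  set s' : ℤ → Γ × Γ := fun i => (D.ty x'.1 (i * D.P)).getD default with hs'
  have hs'1 : ∀ i : ℤ, (i < 0 ∨ n ≤ i) → D.ty x'.1 (i * D.P) = some (s' i) := by
    intro i hi
    obtain ⟨l, hl⟩ := Option.isSome_iff_exists.1 (hi.elim (hx'g.left i) (hx'g.right i))
    simp [hs', hl]
  set s : ℤ → Γ × Γ := fun i => if -(K₀ : ℤ) ≤ i ∧ i < n + K₀ then s₀ i else s' i with hs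
  have hy := fix_refill_of_near hR hfix hx'g (s := s) hs₀ fun i h1 h2 => by
    simp only [hs]
    rw [if_pos ⟨h1, h2⟩]
  set y := D.refill n x' s with hy'
  have hyput : y.1 = D.put x'.1 (D.edge n (D.ty x'.1) s) := rfl
  have hfits := D.fits_edge n x'.1 s
  refine ⟨F.1^[J] y, by rw [Aut.comm_iterate hbelt, hy], fun q hq1 hq2 => ?_⟩
  rw [hput, hF, (beltRule D.P).gate_iterate_put D.toCode hfits hyput J]
  refine Code.put_congr fun i hi => ?_
  have hi2 := hi.2
  have hkn : (D.k.length : ℤ) + D.n = D.P := by simp [P]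
  by_cases hside : i < 0 ∨ n * D.P ≤ i
  · obtain ⟨j, rfl, hj⟩ := hx'g.exists_eq_mul hi.1 hside
    have hj1 : -(K : ℤ) ≤ j :=
      le_of_lt_mul_add (P := D.P) (q := q) (by omega) (by omega) (by omega)
    have hj2 : j < n + K := by
      have : (0 : ℤ) ≤ n * D.P := by positivity
      exact lt_of_mul_le (P := D.P) (q := q) (by omega) (by omega) (by omega)
    have hedge : ∀ i : ℤ, (i < 0 ∨ n ≤ i) → D.edge n (D.ty x'.1) s (i * D.P) = some (s i) :=
      fun i hi => D.edge_mul s hi (by rw [hs'1 i hi]; rfl)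
    rcases hj with hj | hj
    -- The unfolding of the left belt: positive indices carry the outgoing first track, the others
    -- the incoming second track.
    · let c : (ℤ → Γ × Γ) → ℤ → Γ := fun s m => if 1 ≤ m then (s (-m)).1 else (s (m - 1)).2
      have hc : ∀ s : ℤ → Γ × Γ, ∀ i : ℤ, i < 0 → s i = (c s (-i), c s (i + 1)) := by
        intro s i hi
        simp only [c]
        rw [if_pos (by omega), if_neg (by omega)]
        simp
      have hcc : ∀ m : ℤ, m < -K₀ → c s' m = c s m := by
        intro m hm
        simp only [c, hs]
        rw [if_neg (by omega), if_neg (by omega), if_neg (by omega)]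
      rw [beltRule_left h0' (Code.fits_ty _) (c := c s') (fun i hi => by
          rw [hs'1 i (Or.inl hi), ← hc s' i hi]) J j hj,
        beltRule_left h0' hfits (c := c s) (fun i hi => by
          rw [hedge i (Or.inl hi), ← hc s i hi]) J j hj,
        hcc _ (by omega), hcc _ (by omega)]
    · let d : (ℤ → Γ × Γ) → ℤ → Γ := fun s m => if m ≤ 0 then (s (n - m)).1 else (s (n + m - 1)).2
      have hd : ∀ s : ℤ → Γ × Γ, ∀ i : ℤ, n ≤ i → s i = (d s (n - i), d s (i - n + 1)) := by
        intro s i hi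
        simp only [d]
        rw [if_pos (by omega), if_neg (by omega)]
        have e1 : (n : ℤ) - (n - i) = i := by ring
        have e2 : (n : ℤ) + (i - n + 1) - 1 = i := by ring
        rw [e1, e2]
      have hdd : ∀ m : ℤ, m < -K₀ → d s' m = d s m := by
        intro m hm
        simp only [d, hs]
        rw [if_pos (by omega), if_pos (by omega), if_neg (by omega)]
      rw [beltRule_right h1' (Code.fits_ty _) (d := d s') (fun i hi => by
          rw [hs'1 i (Or.inr hi), ← hd s' i hi]) J j hj,
        beltRule_right h1' hfits (d := d s) (fun i hi => by
          rw [hedge i (Or.inr hi), ← hd s i hi]) J j hj,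
        hdd _ (by omega), hdd _ (by omega)]
  · refine beltRule_gap hx'g h0' h1' (Code.fits_ty _) hfits (fun p hp hp' => ?_) J i (by omega)
      (by omega)
    rw [D.edge_gap _ _ hp hp']

/-- Induction on the gap length. If the gap begins or ends with an aligned block it can be declared
shorter; otherwise both edges reflect the belt, and the belt argument reduces to the particular
filling that erosion handles. -/
theorem fix_of_gapped (hs : IsSofic X)
    (hcard : 3 * (Set.range (language X).leftQuotient).ncard + 9 ≤ Nat.card (Γ × Γ))
    (hE : ∀ C : Code (language X) Bool,
      C.k.length + C.n ≤ ((Set.range (language X).leftQuotient).ncard + 3) * D.P →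
      Commute a ((permRule Equiv.boolNot).gate C))
    (hbelt : Commute a ((beltRule D.P).gate D.toCode)) (hfix : ∀ t, a.1 (D.pt t) = D.pt t)
    (n : ℕ) : ∀ x : X.carrier, D.Gapped n x.1 → a.1 x = x := by
  induction n with
  | zero =>
    intro x hx
    have : x = D.pt fun i => (D.ty x.1 (i * D.P)).getD default := by
      refine D.eq_pt fun i => ?_
      obtain ⟨l, hl⟩ := Option.isSome_iff_exists.1
        ((lt_or_ge i 0).elim (hx.left i) fun h => hx.right i (by exact_mod_cast h))
      simp [hl]
    rw [this, hfix]
  | succ n ih =>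
    intro x hx
    by_cases h0 : (D.ty x.1 0).isSome
    · have hsh : ∀ i, D.ty (shiftOn X D.P x).1 (i * D.P) = D.ty x.1 ((i + 1) * D.P) := by
        intro i
        change D.ty (shift (D.P : ℤ) x.1) _ = _
        rw [D.ty_shift, shift_apply]
        congr 1
        ring
      have := ih (shiftOn X D.P x) ⟨fun i hi => by
        rw [hsh]
        rcases eq_or_lt_of_le (show i + 1 ≤ 0 by omega) with h | h
        · rwa [h, zero_mul]
        · exact hx.left _ h, fun i hi => by
        rw [hsh]
        exact hx.right _ (by push_cast; omega)⟩
      rw [Aut.shift_comm] at this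
      apply Subtype.ext
      funext p
      have := congrArg (fun u : X.carrier => u.1 (p - D.P)) this
      simpa [shiftOn] using this
    by_cases h1 : (D.ty x.1 (n * D.P)).isSome
    · refine ih x ⟨hx.left, fun i hi => ?_⟩
      rcases eq_or_lt_of_le hi with h | h
      · rwa [← h]
      · exact hx.right i (by push_cast; omega)
    rw [Option.not_isSome_iff_eq_none] at h0 h1
    refine fix_of_forall_refill hbelt hfix hx h0 ?_ fun y hy hy0 => ?_
    · push_cast
      rwa [add_sub_cancel_right]
    · obtain ⟨ℓ, hℓ⟩ := D.fix_refill (n := n + 1) hs hcard hE (by omega) ih hy hy0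
      exact ⟨_, hℓ⟩

/-- The points with a gap are dense. -/
theorem eq_one_of_gapped (ht : IsTransitive X)
    (hgap : ∀ n, ∀ x : X.carrier, D.Gapped n x.1 → a.1 x = x) : a = 1 := by
  obtain ⟨R, hR⟩ := Aut.exists_isLocal a
  have hP := D.P_pos
  have hkm : D.k ∈ language X := by
    have := D.mem default
    rw [List.append_assoc] at this
    exact mem_language_left this
  have hbk : ∀ i : ℤ, At D.base.1 (i * D.P) D.k := fun i => D.at_k (by rw [ty_base, emb_mul]; rfl)
  apply Subtype.ext
  refine Equiv.ext fun x => ?_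
  change a.1 x = x
  refine hR.fix fun p => ?_
  set v := window x.1 (p - R) (2 * R + 1) with hv
  obtain ⟨u₁, -, h1⟩ := ht D.k hkm v (window_mem_language x.2 _ _)
  obtain ⟨u₂, -, h2⟩ := ht _ h1 D.k hkm
  -- A window `v` of `x` is placed into a periodic stretch with period word `w`, itself beginning
  -- with the marker, and the stretch is glued between two half-lines of default blocks.
  set w := D.k ++ u₁ ++ v ++ u₂ with hw
  have hw0 : w ≠ [] := by simp [hw, D.k_ne]
  have hpre : D.k <+: w := by
    rw [hw, List.append_assoc, List.append_assoc]
    exact List.prefix_append _ _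
  have hwpos := List.length_pos_iff.2 hw0
  have hper := periodic_mem hw0 hpre D.sync h2
  have hpk : ∀ i : ℤ, At (periodic w hw0) (i * w.length) D.k := fun i =>
    (at_periodic w hw0 i).of_prefix hpre
  have hz1 := glue_mem D.sync D.base.2 hper (i := 0) (by simpa using hbk 0) (by simpa using hpk 0)
  set z₁ : ℤ → B := fun p => if p < 0 then D.base.1 p else periodic w hw0 p with hz₁
  -- The stretch has length `w.length * D.P`, a multiple of both the period and the block length, so
  -- markers match at both seams and the blocks on the right are aligned.
  have hN : (0 : ℤ) ≤ w.length * D.P := by positivity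
  have hz1k : At z₁ (w.length * D.P) D.k := by
    have := hpk D.P
    rw [mul_comm]
    refine this.congr fun q h1 _ => ?_
    rw [mul_comm] at h1
    simp [hz₁, show ¬ q < 0 by omega]
  have hz2 := glue_mem D.sync hz1 D.base.2 (i := w.length * D.P) hz1k (hbk _)
  set z₂ : ℤ → B := fun p => if p < w.length * D.P then z₁ p else D.base.1 p with hz₂
  have hg : D.Gapped w.length z₂ := by
    refine ⟨fun i hi => ?_, fun i hi => ?_⟩
    · rw [D.ty_congr (x := D.base.1)]
      · rw [ty_base, emb_mul]
        rfl
      · intro q h3 h4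
        by_cases hq : q < 0
        · simp [hz₂, hz₁, hq, show q < w.length * D.P by omega]
        · have h5 : (i + 1) * (D.P : ℤ) ≤ 0 * D.P :=
            mul_le_mul_of_nonneg_right (by omega) (by omega)
          have h6 : (D.k.length : ℤ) + D.n = D.P := by simp [P]
          rw [add_mul] at h5
          have h7 : (1 : ℤ) * D.P ≤ w.length * D.P :=
            mul_le_mul_of_nonneg_right (by omega) (by omega)
          have h8 := D.k_le_P
          simp only [hz₂, hz₁, hq, show q < w.length * D.P by omega, if_true, if_false]
          have := (hpk 0).eq (hbk 0) (a := q) (by omega) (by omega)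
          simpa using this
    · rw [D.ty_congr (x := D.base.1)]
      · rw [ty_base, emb_mul]
        rfl
      · intro q h3 h4
        have h5 : (w.length : ℤ) * D.P ≤ i * D.P := mul_le_mul_of_nonneg_right hi (by omega)
        simp [hz₂, show ¬ q < w.length * D.P by omega]
  have hfix := hgap _ ⟨z₂, hz2⟩ hg
  have hvat : At z₂ (D.k ++ u₁).length v := by
    have h3 : At (periodic w hw0) 0 (D.k ++ u₁ ++ v ++ u₂) := by
      have := at_periodic w hw0 0
      rwa [zero_mul] at this
    rw [List.append_assoc, at_append, zero_add] at h3
    have h4 := (at_append.1 h3.2).1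
    refine h4.congr fun q h5 h6 => ?_
    have h7 : ((D.k ++ u₁).length : ℤ) + v.length ≤ w.length := by
      rw [hw]
      simp only [List.length_append]
      push_cast
      omega
    have h8 : (w.length : ℤ) * 1 ≤ w.length * D.P :=
      mul_le_mul_of_nonneg_left (by omega) (by omega)
    simp only [hz₂, hz₁, show q < w.length * D.P by omega, show ¬ q < 0 by omega, if_true,
      if_false]
  refine ⟨shiftOn X ((D.k ++ u₁).length - (p - R)) ⟨z₂, hz2⟩, ?_, fun q h3 h4 => ?_⟩
  · rw [Aut.shift_comm, hfix]
  · have := (at_window x.1 (p - R) (2 * R + 1)).eq hvat (a := q - (p - R)) (by omega)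
      (by rw [length_window]; push_cast; omega)
    rw [add_sub_cancel] at this
    rw [this]
    change z₂ _ = z₂ _
    congr 1
    ring

end Fix

end MarkerCode

/-! ### A finite set of automorphisms with small centralizer -/

section

/-- The erosion codes depend on the point, but their length is bounded in terms of `X` and `D`.
Hence all of them together contribute finitely many gates. -/
theorem finite_codes {B : Type*} [Finite B] (L : Language B) (N : ℕ) :
    {C : Code L Bool | C.k.length + C.n ≤ N}.Finite := by
  have hfin := List.finite_length_le B N
  refine Set.Finite.of_injOn (f := fun C : Code L Bool => (C.k, C.z, C.m false, C.m true))
    (t := {l | l.length ≤ N} ×ˢ {l | l.length ≤ N} ×ˢ {l | l.length ≤ N} ×ˢ {l | l.length ≤ N})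
    ?_ ?_ (hfin.prod (hfin.prod (hfin.prod hfin)))
  · intro C hC
    have h1 := C.length_m
    have h2 := C.length_z
    simp only [Set.mem_ofPred_eq] at hC
    simp only [Set.mem_prod, Set.mem_ofPred_eq, h1, h2]
    omega
  · intro C _ C' _ h
    simp only [Prod.mk.injEq] at h
    obtain ⟨hk, hz, h0, h1⟩ := h
    have hm : C.m = C'.m := by
      funext b
      cases b <;> assumption
    have hn : C.n = C'.n := by
      rw [← C.length_m true, ← C'.length_m true, h1]
    obtain ⟨k, z, m, n, _, _, _, _, _⟩ := C
    obtain ⟨k', z', m', n', _, _, _, _, _⟩ := C'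
    simp only at hk hz hm hn
    subst hk hz hm hn
    rfl

variable {B : Type*} [TopologicalSpace B] {X : Subshift B ℤ}

theorem exists_markerCode [Finite B] (ht : IsTransitive X) (hs : IsSofic X)
    (hinf : X.carrier.Infinite) (Λ : Type*) [Finite Λ] : Nonempty (MarkerCode X Λ) := by
  obtain ⟨u, hu, hu0, hus⟩ := exists_sync hs hinf.nonempty
  obtain ⟨r, hinj, hr⟩ := exists_two_returns ht hinf hu hu0
  obtain ⟨C, hz, hsync, hk, hmem⟩ := exists_code (Λ := Λ) hr hu hus hu0 hinj
  exact ⟨{ C with z_eq := hz, k_ne := hk, sync := hsync, mem := hmem }⟩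

variable [DiscreteTopology B] [Finite B]

/-- An infinite transitive sofic shift has a finite set of automorphisms whose centralizer has no
elements of large prime order. -/
theorem exists_finite_centralizer (ht : IsTransitive X) (hs : IsSofic X)
    (hinf : X.carrier.Infinite) : ∃ T : Set (Aut X), T.Finite ∧ ∃ N : ℕ,
      ∀ a : Aut X, (∀ h ∈ T, Commute a h) → ∀ q : ℕ, q.Prime → N < q → a ^ q = 1 → a = 1 := by
  set M₀ := (Set.range (language X).leftQuotient).ncard with hM₀
  have : NeZero (3 * M₀ + 9) := ⟨by omega⟩
  -- The size is chosen for the signal letter in `fix_refill`, and it also gives `M ≥ 3`.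
  obtain ⟨D⟩ := exists_markerCode ht hs hinf (ZMod (3 * M₀ + 9) × ZMod (3 * M₀ + 9))
  refine ⟨Set.range (fun π => (permRule π).gate D.toCode) ∪ {(beltRule D.P).gate D.toCode} ∪
    Set.range (fun π => (endRule D.P π).gate D.toCode) ∪
    (fun C => (permRule Equiv.boolNot).gate C) ''
      {C : Code (language X) Bool | C.k.length + C.n ≤ (M₀ + 3) * D.P},
    (((Set.finite_range _).union (Set.finite_singleton _)).union (Set.finite_range _)).union
      ((finite_codes _ _).image _), Nat.card B ^ D.P, fun a hT q hq hN ha => ?_⟩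
  have hD : D.Centralizes a :=
    ⟨fun π => hT _ (Or.inl (Or.inl (Or.inl ⟨π, rfl⟩))), hT _ (Or.inl (Or.inl (Or.inr rfl))),
      fun π => hT _ (Or.inl (Or.inr ⟨π, rfl⟩))⟩
  refine MarkerCode.eq_one_of_gapped (D := D) ht fun n =>
    MarkerCode.fix_of_gapped hs ?_ (fun C hC => hT _ (Or.inr ⟨C, hC, rfl⟩)) hD.belt
      (MarkerCode.Centralizes.fix_pt (by omega) hD hq ha hN) n
  rw [Nat.card_prod, Nat.card_zmod]
  nlinarith

theorem finite_aut (hfin : X.carrier.Finite) : Finite (Aut X) := by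
  have := hfin.to_subtype
  exact Subtype.finite

end

/-! ### The language of a gap shift and its soficity -/

section Language

variable (S : Set ℕ)

/-- `w` can be read after `n` ones, which are preceded by a zero if `b` is true. -/
def Reads : Bool → ℕ → List (Fin 2) → Prop
  | _, n, [] => ∃ m ∈ S, n ≤ m
  | b, n, 0 :: w => (∃ m ∈ S, n ≤ m ∧ (b = true → n = m)) ∧ Reads true 0 w
  | b, n, 1 :: w => Reads b (n + 1) w

/-- The words generating the gap shift. -/
def gapWords : Language (Fin 2) := {w | ∃ n ∈ S, w = gapWord n}

variable {S}

theorem reads_zero {b : Bool} {n : ℕ} {w : List (Fin 2)} :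
    Reads S b n (0 :: w) ↔ (∃ m ∈ S, n ≤ m ∧ (b = true → n = m)) ∧ Reads S true 0 w := Iff.rfl

theorem reads_one {b : Bool} {n : ℕ} {w : List (Fin 2)} :
    Reads S b n (1 :: w) ↔ Reads S b (n + 1) w := Iff.rfl

theorem reads_true_zero {n : ℕ} {w : List (Fin 2)} :
    Reads S true n (0 :: w) ↔ n ∈ S ∧ Reads S true 0 w := by
  rw [reads_zero]
  refine and_congr_left fun _ => ⟨?_, fun h => ⟨n, h, le_rfl, fun _ => rfl⟩⟩
  rintro ⟨m, hm, -, h⟩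
  rwa [h rfl]

theorem reads_replicate {b : Bool} {n k : ℕ} {w : List (Fin 2)} :
    Reads S b n (List.replicate k 1 ++ w) ↔ Reads S b (n + k) w := by
  induction k generalizing n with
  | zero => simp
  | succ k ih =>
    rw [List.replicate_succ, List.cons_append, reads_one, ih]
    simp only [add_assoc, add_comm 1 k]

theorem eq_zero_or_one (c : Fin 2) : c = 0 ∨ c = 1 := by fin_cases c <;> simp

theorem Reads.nil {b : Bool} {n : ℕ} {w : List (Fin 2)} (h : Reads S b n w) : ∃ m ∈ S, n ≤ m := by
  induction w generalizing n with
  | nil => exact h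
  | cons c w ih =>
    rcases eq_zero_or_one c with rfl | rfl
    · obtain ⟨⟨m, hm, hnm, -⟩, -⟩ := h
      exact ⟨m, hm, hnm⟩
    · obtain ⟨m, hm, hnm⟩ := ih h
      exact ⟨m, hm, by omega⟩

theorem Reads.of_append {b : Bool} {n : ℕ} {u v : List (Fin 2)} (h : Reads S b n (u ++ v)) :
    Reads S b n u := by
  induction u generalizing b n with
  | nil => exact h.nil
  | cons c u ih =>
    rcases eq_zero_or_one c with rfl | rfl
    · exact ⟨h.1, ih h.2⟩
    · exact ih (n := n + 1) h

theorem Reads.mono {b : Bool} {n n' : ℕ} {w : List (Fin 2)} (h : Reads S b n w) (hn : n' ≤ n) :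
    Reads S false n' w := by
  induction w generalizing n n' with
  | nil =>
    obtain ⟨m, hm, hnm⟩ := h
    exact ⟨m, hm, by omega⟩
  | cons c w ih =>
    rcases eq_zero_or_one c with rfl | rfl
    · obtain ⟨⟨m, hm, hnm, -⟩, h⟩ := h
      exact ⟨⟨m, hm, by omega, by simp⟩, h⟩
    · exact ih (n := n + 1) (n' := n' + 1) h (by omega)

theorem Reads.of_append_right {b : Bool} {n : ℕ} {u v : List (Fin 2)} (h : Reads S b n (u ++ v)) :
    Reads S false 0 v := by
  induction u generalizing b n with
  | nil => exact h.mono (Nat.zero_le _)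
  | cons c u ih =>
    rcases eq_zero_or_one c with rfl | rfl
    · exact ih h.2
    · exact ih (n := n + 1) h

theorem Reads.replace {w w' : List (Fin 2)} (H : ∀ b n, Reads S b n w → Reads S b n w') {b : Bool}
    {n : ℕ} {u : List (Fin 2)} (h : Reads S b n (u ++ w)) : Reads S b n (u ++ w') := by
  induction u generalizing b n with
  | nil => exact H _ _ h
  | cons c u ih =>
    rcases eq_zero_or_one c with rfl | rfl
    · exact ⟨h.1, ih h.2⟩
    · exact ih (n := n + 1) h

theorem append_mem_kstar {L : Language (Fin 2)} {u v : List (Fin 2)} (hu : u ∈ L)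
    (hv : v ∈ KStar.kstar L) : u ++ v ∈ KStar.kstar L := by
  obtain ⟨P, rfl, hP⟩ := Language.mem_kstar.1 hv
  refine Language.mem_kstar.2 ⟨u :: P, rfl, ?_⟩
  simpa using ⟨hu, hP⟩

/-- Completing the last, possibly unfinished block gives a word of the generated monoid. -/
theorem Reads.exists_kstar {n : ℕ} {w : List (Fin 2)} (h : Reads S true n w) :
    ∃ v, gapWord n ++ w ++ v ∈ KStar.kstar (gapWords S) := by
  induction w generalizing n with
  | nil =>
    obtain ⟨m, hm, hnm⟩ := h
    refine ⟨List.replicate (m - n) 1, ?_⟩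
    have : gapWord n ++ [] ++ List.replicate (m - n) 1 = gapWord m ++ [] := by
      simp [gapWord, Nat.add_sub_cancel' hnm]
    rw [this]
    exact append_mem_kstar ⟨m, hm, rfl⟩ (Language.nil_mem_kstar _)
  | cons c w ih =>
    rcases eq_zero_or_one c with rfl | rfl
    · obtain ⟨hn, h⟩ := reads_true_zero.1 h
      obtain ⟨v, hv⟩ := ih h
      refine ⟨v, ?_⟩
      have := append_mem_kstar (L := gapWords S) ⟨n, hn, rfl⟩ hv
      simpa [gapWord] using this
    · obtain ⟨v, hv⟩ := ih (n := n + 1) h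
      refine ⟨v, ?_⟩
      simpa [gapWord, List.replicate_succ'] using hv

theorem Reads.exists_infix {k : ℕ} {w : List (Fin 2)} (h : Reads S false k w) :
    ∃ u ∈ KStar.kstar (gapWords S), List.replicate k 1 ++ w <:+: u := by
  induction w generalizing k with
  | nil =>
    obtain ⟨m, hm, hnm⟩ := h
    refine ⟨gapWord m ++ [], append_mem_kstar ⟨m, hm, rfl⟩ (Language.nil_mem_kstar _),
      0 :: List.replicate (m - k) 1, [], ?_⟩
    simp [gapWord, Nat.sub_add_cancel hnm]
  | cons c w ih =>
    rcases eq_zero_or_one c with rfl | rfl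
    · obtain ⟨⟨m, hm, hkm, -⟩, h⟩ := h
      obtain ⟨v, hv⟩ := h.exists_kstar
      refine ⟨_, append_mem_kstar (L := gapWords S) ⟨m, hm, rfl⟩ hv,
        0 :: List.replicate (m - k) 1, v, ?_⟩
      obtain ⟨d, rfl⟩ := Nat.exists_eq_add_of_le' hkm
      simp only [gapWord, Nat.add_sub_cancel, List.replicate_add, List.replicate_zero,
        List.cons_append, List.append_assoc, List.nil_append]
    · obtain ⟨u, hu, h2⟩ := ih (k := k + 1) h
      refine ⟨u, hu, ?_⟩
      simpa [List.replicate_succ'] using h2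

theorem reads_of_mem_kstar {u : List (Fin 2)} (hu : u ∈ KStar.kstar (gapWords S)) {n : ℕ}
    (hn : n ∈ S) : Reads S true n u := by
  obtain ⟨P, rfl, hP⟩ := Language.mem_kstar.1 hu
  clear hu
  induction P generalizing n with
  | nil => exact ⟨n, hn, le_rfl⟩
  | cons w P ih =>
    obtain ⟨m, hm, rfl⟩ := hP w (by simp)
    rw [List.flatten_cons, gapWord, List.cons_append, reads_true_zero, reads_replicate, zero_add]
    exact ⟨hn, ih hm fun y hy => hP y (by simp [hy])⟩

theorem mem_language_gapShift (hS : S.Nonempty) {w : List (Fin 2)} :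
    w ∈ language (gapShift S) ↔ Reads S false 0 w := by
  rw [gapShift_isCodedBy hS]
  constructor
  · rintro ⟨u, hu, p, q, rfl⟩
    obtain ⟨n, hn⟩ := hS
    have h := (reads_of_mem_kstar hu hn).of_append
    exact h.of_append_right
  · intro h
    obtain ⟨u, hu, h2⟩ := h.exists_infix
    exact ⟨u, hu, by simpa using h2⟩

/-- The state after reading `u`. -/
def stateAfter : Bool × ℕ → List (Fin 2) → Bool × ℕ
  | s, [] => s
  | _, 0 :: w => stateAfter (true, 0) w
  | s, 1 :: w => stateAfter (s.1, s.2 + 1) w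

theorem reads_append {s : Bool × ℕ} {u v : List (Fin 2)} :
    Reads S s.1 s.2 (u ++ v) ↔
      Reads S s.1 s.2 u ∧ Reads S (stateAfter s u).1 (stateAfter s u).2 v := by
  induction u generalizing s with
  | nil =>
    exact ⟨fun h => ⟨h.nil, h⟩, fun h => h.2⟩
  | cons c u ih =>
    rcases eq_zero_or_one c with rfl | rfl
    · rw [List.cons_append, reads_zero, reads_zero, ih (s := (true, 0)), and_assoc]
      rfl
    · rw [List.cons_append, reads_one, reads_one]
      exact ih (s := (s.1, s.2 + 1))

/-- The count of ones is tested for membership in `S` only at the next zero, and by periodicity both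
counts give the same answer. -/
theorem reads_add_iff {n₀ c : ℕ} (h : ∀ n, n₀ ≤ n → (n ∈ S ↔ n + c ∈ S)) {b : Bool} {n : ℕ}
    (hn : n₀ ≤ n) {w : List (Fin 2)} : Reads S b n w ↔ Reads S b (n + c) w := by
  have hex : ∀ n, n₀ ≤ n → ((∃ m ∈ S, n ≤ m) ↔ ∃ m ∈ S, n + c ≤ m) := by
    intro n hn
    constructor
    · rintro ⟨m, hm, hnm⟩
      exact ⟨m + c, (h m (by omega)).1 hm, by omega⟩
    · rintro ⟨m, hm, hnm⟩
      exact ⟨m, hm, by omega⟩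
  induction w generalizing n with
  | nil => exact hex n hn
  | cons d w ih =>
    rcases eq_zero_or_one d with rfl | rfl
    · rw [reads_zero, reads_zero]
      refine and_congr_left fun _ => ?_
      cases b
      · simpa using hex n hn
      · have := h n hn
        constructor
        · rintro ⟨m, hm, -, hnm⟩
          have := hnm rfl
          subst this
          exact ⟨n + c, (h n hn).1 hm, le_rfl, fun _ => rfl⟩
        · rintro ⟨m, hm, -, hnm⟩
          have := hnm rfl
          subst this
          exact ⟨n, (h n hn).2 hm, le_rfl, fun _ => rfl⟩
    · have := ih (n := n + 1) (by omega)
      rwa [add_right_comm] at this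

/-- The gap shift of an eventually periodic set is sofic. -/
theorem isSofic_gapShift (hS : S.Nonempty) {n₀ c : ℕ} (hc : 0 < c)
    (h : ∀ n, n₀ ≤ n → (n ∈ S ↔ n + c ∈ S)) : IsSofic (gapShift S) := by
  -- Counters reduce modulo the period, so only finitely many states, hence left quotients, remain;
  -- Myhill–Nerode gives regularity.
  have hred : ∀ n, ∃ n' < n₀ + c, ∀ b w, Reads S b n w ↔ Reads S b n' w := by
    intro n
    induction n using Nat.strong_induction_on with
    | _ n ih =>
      rcases lt_or_ge n (n₀ + c) with hn | hn
      · exact ⟨n, hn, fun _ _ => Iff.rfl⟩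
      · obtain ⟨n', hn', h'⟩ := ih (n - c) (by omega)
        refine ⟨n', hn', fun b w => ?_⟩
        rw [← h', reads_add_iff h (n := n - c) (by omega), Nat.sub_add_cancel (by omega)]
  refine Language.IsRegular.of_finite_range_leftQuotient ?_
  refine (((Set.finite_univ (α := Prop × Bool)).prod (Set.finite_lt_nat (n₀ + c))).image
    fun q : (Prop × Bool) × ℕ => ({v | q.1.1 ∧ Reads S q.1.2 q.2 v} : Language (Fin 2))).subset ?_
  rintro _ ⟨u, rfl⟩
  obtain ⟨n', hn', h'⟩ := hred (stateAfter (false, 0) u).2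
  refine ⟨((Reads S false 0 u, (stateAfter (false, 0) u).1), n'), ⟨Set.mem_univ _, hn'⟩, ?_⟩
  refine Set.ext fun v => ?_
  change _ ↔ u ++ v ∈ language (gapShift S)
  rw [mem_language_gapShift hS]
  have := reads_append (S := S) (s := (false, 0)) (u := u) (v := v)
  dsimp only at this
  rw [this, h']
  rfl

theorem infinite_of_not_isSofic (hS : S.Nonempty) (hX : ¬ IsSofic (gapShift S)) : S.Infinite := by
  intro hfin
  obtain ⟨n₀, hn₀⟩ := hfin.bddAbove
  refine hX (isSofic_gapShift hS (n₀ := n₀ + 1) (c := 1) one_pos fun n hn => ?_)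
  constructor
  · intro h
    have := hn₀ h
    omega
  · intro h
    have := hn₀ h
    omega

theorem isSofic_of_stable (hS : S.Nonempty) {N c j : ℕ} (hc : 0 < c)
    (h : ∀ m, j ≤ m → {r : Fin c | N + j * c + r ∈ S} = {r : Fin c | N + m * c + r ∈ S}) :
    IsSofic (gapShift S) := by
  refine isSofic_gapShift hS (n₀ := N + j * c) hc fun n hn => ?_
  have h1 := Nat.mod_add_div (n - N) c
  have h2 := Nat.mod_lt (n - N) hc
  have h3 : j ≤ (n - N) / c := (Nat.le_div_iff_mul_le hc).2 (by omega)
  have h4 := (h _ h3).symm.trans (h ((n - N) / c + 1) (by omega))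
  have h5 := Set.ext_iff.1 h4 ⟨(n - N) % c, h2⟩
  simp only [Set.mem_ofPred_eq] at h5
  rw [add_mul, one_mul, mul_comm _ c] at h5
  convert h5 using 2 <;> omega

/-- If the gap shift of `S` is not sofic, then no nonzero translation maps the large elements of
`S` into `S`. -/
theorem eq_zero_of_add_mem (hS : S.Nonempty) (hX : ¬ IsSofic (gapShift S)) {d : ℤ} {N : ℕ}
    (h : ∀ n ∈ S, N ≤ n → (n + d).toNat ∈ S) : d = 0 := by
  by_contra hd
  refine hX ?_
  rcases lt_or_gt_of_ne hd with hd | hd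
  · obtain ⟨c, rfl⟩ : ∃ c : ℕ, d = -c := ⟨d.natAbs, by omega⟩
    -- Cut `S` beyond `N` into blocks of length `c`. Invariance makes the patterns decrease
    -- (increase for positive `d`) inside a finite set, so they stabilize and `S` is eventually
    -- periodic.
    have hA : Monotone fun j : ℕ => {r : Fin c | N + j * c + r ∈ S}ᶜ := by
      refine monotone_nat_of_le_succ fun j => Set.compl_subset_compl.2 fun r hr => ?_
      simp only [Set.mem_ofPred_eq] at hr ⊢
      have := h _ hr (by rw [add_assoc]; omega)
      have e : ((N + (j + 1) * c + r : ℕ) + -(c : ℤ)).toNat = N + j * c + r := by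
        rw [add_mul]
        omega
      rwa [e] at this
    obtain ⟨j, hj⟩ := WellFoundedGT.monotone_chain_condition ⟨_, hA⟩
    exact isSofic_of_stable hS (by omega) fun m hm => compl_injective (hj m hm)
  · obtain ⟨c, rfl⟩ : ∃ c : ℕ, d = c := ⟨d.natAbs, by omega⟩
    have hA : Monotone fun j : ℕ => {r : Fin c | N + j * c + r ∈ S} := by
      refine monotone_nat_of_le_succ fun j r hr => ?_
      simp only [Set.mem_ofPred_eq] at hr ⊢
      have := h _ hr (by rw [add_assoc]; omega)
      have e : ((N + j * c + r : ℕ) + (c : ℤ)).toNat = N + (j + 1) * c + r := by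
        rw [add_mul]
        omega
      rwa [e] at this
    obtain ⟨j, hj⟩ := WellFoundedGT.monotone_chain_condition ⟨_, hA⟩
    exact isSofic_of_stable hS (by omega) hj

end Language

/-! ### Points of a gap shift in terms of runs of ones -/

section Run

/-- A maximal block of `n` ones after the zero at position `i`. -/
def Run (x : ℤ → Fin 2) (i : ℤ) (n : ℕ) : Prop :=
  x i = 0 ∧ (∀ p, i < p → p ≤ i + n → x p = 1) ∧ x (i + n + 1) = 0

variable {S : Set ℕ}

theorem reads_of_at (hS : S.Infinite) {x : ℤ → Fin 2} (h : ∀ i n, Run x i n → n ∈ S)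
    {w : List (Fin 2)} {i : ℤ} (hw : At x i w) {b : Bool} {n : ℕ}
    (hb : b = true → x (i - n - 1) = 0 ∧ ∀ p, i - n - 1 < p → p < i → x p = 1) :
    Reads S b n w := by
  have hex : ∀ n : ℕ, ∃ m ∈ S, n ≤ m := fun n => by
    obtain ⟨m, hm, hnm⟩ := hS.exists_gt n
    exact ⟨m, hm, hnm.le⟩
  induction w generalizing i b n with
  | nil => exact hex n
  | cons c w ih =>
    have hw' : At x (i + 1) w := (at_append (u := [c]).1 hw).2
    have hi : x i = c := by
      have := hw 0 (by simp)
      rw [Nat.cast_zero, add_zero] at this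
      exact this
    rcases eq_zero_or_one c with rfl | rfl
    · refine ⟨?_, ih hw' fun _ => ?_⟩
      · cases b
        · simpa using hex n
        · obtain ⟨h1, h2⟩ := hb rfl
          refine ⟨n, h (i - n - 1) n ⟨h1, fun p h3 h4 => h2 p h3 (by omega), ?_⟩, le_rfl,
            fun _ => rfl⟩
          rw [← hi]
          congr 1
          ring
      · refine ⟨by rw [← hi]; congr 1; simp, fun p h1 h2 => ?_⟩
        push_cast at h1
        omega
    · refine ih hw' fun hb' => ?_
      obtain ⟨h1, h2⟩ := hb hb'
      refine ⟨by rw [← h1]; congr 1; push_cast; ring, fun p h3 h4 => ?_⟩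
      push_cast at h3
      rcases eq_or_lt_of_le (show p ≤ i by omega) with rfl | h5
      · exact hi
      · exact h2 p (by omega) h5

/-- Only blocks bounded by zeros on both sides are constrained: since `S` is unbounded, a block of
ones cut off by the end of a window can always be completed. -/
theorem mem_gapShift (hS : S.Infinite) {x : ℤ → Fin 2} :
    x ∈ (gapShift S).carrier ↔ ∀ i n, Run x i n → n ∈ S := by
  constructor
  · rintro hx i n ⟨h0, h1, h2⟩
    have : At x i (0 :: (List.replicate n 1 ++ [0])) := by
      refine (at_append (u := [0])).2 ⟨by simpa [At] using h0, at_append.2 ⟨fun k hk => ?_, ?_⟩⟩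
      · simp only [List.length_replicate] at hk
        simp only [List.getElem_replicate]
        exact h1 _ (by simp; omega) (by simp; omega)
      · intro k hk
        simp only [List.length_singleton] at hk
        obtain rfl : k = 0 := by omega
        simp only [List.getElem_singleton, List.length_replicate, List.length_singleton]
        rw [← h2]
        congr 1
        push_cast
        ring
    have h3 := (mem_language_gapShift hS.nonempty).1 ⟨x, hx, i, this⟩
    rw [reads_zero, reads_replicate, zero_add, reads_true_zero] at h3
    exact h3.2.1
  · intro h
    refine mem_carrier_of_window 0 0 fun N => ?_
    rw [mem_language_gapShift hS.nonempty]
    exact reads_of_at hS h (at_window _ _ _) (by simp)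

end Run

/-! ### Automorphisms of a non-sofic gap shift move long runs rigidly -/

section

section Ends

/-- The last zero of `x` is at `ρ`. -/
def EndsAt (x : ℤ → Fin 2) (ρ : ℤ) : Prop := x ρ = 0 ∧ ∀ p, ρ < p → x p = 1

/-- The first zero of `x` is at `ρ`. -/
def StartsAt (x : ℤ → Fin 2) (ρ : ℤ) : Prop := x ρ = 0 ∧ ∀ p, p < ρ → x p = 1

theorem EndsAt.unique {x : ℤ → Fin 2} {ρ ρ' : ℤ} (h : EndsAt x ρ) (h' : EndsAt x ρ') : ρ = ρ' := by
  rcases lt_trichotomy ρ ρ' with hlt | heq | hlt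
  · have := h.2 _ hlt
    rw [h'.1] at this
    simp at this
  · exact heq
  · have := h'.2 _ hlt
    rw [h.1] at this
    simp at this

theorem exists_endsAt {x : ℤ → Fin 2} {b p₀ : ℤ} (h : ∀ p, b < p → x p = 1) (h0 : x p₀ = 0) :
    ∃ ρ, EndsAt x ρ ∧ p₀ ≤ ρ ∧ ρ ≤ b := by
  have hle : ∀ p, x p = 0 → p ≤ b := by
    intro p hp
    by_contra hlt
    have := h p (by omega)
    rw [hp] at this
    simp at this
  obtain ⟨ρ, hρ, hmax⟩ := Int.exists_greatest_of_bdd ⟨b, hle⟩ ⟨p₀, h0⟩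
  refine ⟨ρ, ⟨hρ, fun p hp => (eq_zero_or_one (x p)).resolve_left fun h => ?_⟩, hmax _ h0, hle _ hρ⟩
  have := hmax p h
  omega

theorem exists_startsAt {x : ℤ → Fin 2} {b p₀ : ℤ} (h : ∀ p, p < b → x p = 1) (h0 : x p₀ = 0) :
    ∃ ρ, StartsAt x ρ ∧ ρ ≤ p₀ ∧ b ≤ ρ := by
  have hle : ∀ p, x p = 0 → b ≤ p := by
    intro p hp
    by_contra hlt
    have := h p (by omega)
    rw [hp] at this
    simp at this
  obtain ⟨ρ, hρ, hmin⟩ := Int.exists_least_of_bdd ⟨b, hle⟩ ⟨p₀, h0⟩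
  refine ⟨ρ, ⟨hρ, fun p hp => (eq_zero_or_one (x p)).resolve_left fun h => ?_⟩, hmin _ h0, hle _ hρ⟩
  have := hmin p h
  omega

/-- Two half-infinite parts that end and start with zeros give a run of ones. -/
theorem run_of_ends {x y z : ℤ → Fin 2} {ρ μ c : ℤ} (hy : EndsAt y ρ) (hz : StartsAt z μ)
    (hxy : ∀ p, p ≤ c → x p = y p) (hxz : ∀ p, c < p → x p = z p) (h1 : ρ ≤ c) (h2 : c < μ) :
    Run x ρ (μ - ρ - 1).toNat := by
  refine ⟨by rw [hxy _ h1, hy.1], fun p h3 h4 => ?_, ?_⟩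
  · rcases le_or_gt p c with h | h
    · rw [hxy _ h, hy.2 p h3]
    · rw [hxz _ h, hz.2 p (by omega)]
  · have : ρ + ((μ - ρ - 1).toNat : ℤ) + 1 = μ := by omega
    rw [this, hxz _ h2, hz.1]

end Ends

variable {S : Set ℕ}

section Points

variable (hS : S.Infinite)

include hS

theorem truncRight_mem {x : ℤ → Fin 2} (hx : x ∈ (gapShift S).carrier) (i : ℤ) :
    (fun p => if p ≤ i then x p else 1) ∈ (gapShift S).carrier := by
  rw [mem_gapShift hS] at hx ⊢
  rintro j n ⟨h0, h1, h2⟩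
  dsimp only at h0 h1 h2
  have h3 : j + n + 1 ≤ i := by
    by_contra hc
    rw [if_neg hc] at h2
    simp at h2
  refine hx j n ⟨?_, fun p h4 h5 => ?_, ?_⟩
  · rwa [if_pos (by omega)] at h0
  · have := h1 p h4 h5
    rwa [if_pos (by omega)] at this
  · rwa [if_pos h3] at h2

theorem truncLeft_mem {x : ℤ → Fin 2} (hx : x ∈ (gapShift S).carrier) (i : ℤ) :
    (fun p => if i ≤ p then x p else 1) ∈ (gapShift S).carrier := by
  rw [mem_gapShift hS] at hx ⊢
  rintro j n ⟨h0, h1, h2⟩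
  dsimp only at h0 h1 h2
  have h3 : i ≤ j := by
    by_contra hc
    rw [if_neg hc] at h0
    simp at h0
  refine hx j n ⟨?_, fun p h4 h5 => ?_, ?_⟩
  · rwa [if_pos (by omega)] at h0
  · have := h1 p h4 h5
    rwa [if_pos (by omega)] at this
  · rwa [if_pos (by omega)] at h2

/-- Gluing creates exactly one new run, of length `n ∈ S`. -/
theorem glueRun_mem {x y : ℤ → Fin 2} (hx : x ∈ (gapShift S).carrier)
    (hy : y ∈ (gapShift S).carrier) {n : ℕ} (hn : n ∈ S) (hx0 : EndsAt x 0)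
    (hy0 : StartsAt y (n + 1)) :
    (fun p : ℤ => if p ≤ n then x p else y p) ∈ (gapShift S).carrier := by
  rw [mem_gapShift hS] at hx hy ⊢
  rintro j m ⟨h0, h1, h2⟩
  dsimp only at h0 h1 h2
  by_cases h3 : j + m + 1 ≤ n
  · refine hx j m ⟨?_, fun p h4 h5 => ?_, ?_⟩
    · rwa [if_pos (by omega)] at h0
    · have := h1 p h4 h5
      rwa [if_pos (by omega)] at this
    · rwa [if_pos h3] at h2
  by_cases h4 : j ≤ n
  · rw [if_pos h4] at h0
    rw [if_neg h3] at h2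
    have h5 : j ≤ 0 := by
      by_contra hc
      have := hx0.2 j (by omega)
      rw [h0] at this
      simp at this
    have h6 : n + 1 ≤ j + m + 1 := by omega
    have h7 : j = 0 := by
      by_contra hc
      have := h1 0 (by omega) (by omega)
      rw [if_pos (by omega), hx0.1] at this
      simp at this
    have h8 : j + m = n := by
      by_contra hc
      have := h1 (n + 1) (by omega) (by omega)
      rw [if_neg (by omega), hy0.1] at this
      simp at this
    have : m = n := by omega
    rwa [this]
  · refine hy j m ⟨?_, fun p h5 h6 => ?_, ?_⟩
    · rwa [if_neg (by omega)] at h0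
    · have := h1 p h5 h6
      rwa [if_neg (by omega)] at this
    · rwa [if_neg (by omega)] at h2

theorem ones_mem : (fun _ => 1) ∈ (gapShift S).carrier := by
  rw [mem_gapShift hS]
  rintro i n ⟨h, -⟩
  simp at h

theorem dot_mem (c : ℤ) : (fun p => if p = c then 0 else 1) ∈ (gapShift S).carrier := by
  rw [mem_gapShift hS]
  rintro i n ⟨h, -, h2⟩
  dsimp only at h h2
  split_ifs at h h2 <;> omega

end Points

section Rigid

theorem const_of_shift {X : Subshift (Fin 2) ℤ} {x : X.carrier} (h : shiftOn X 1 x = x) :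
    (∀ p, x.1 p = 0) ∨ ∀ p, x.1 p = 1 := by
  have hstep : ∀ p, x.1 (1 + p) = x.1 p := fun p => congrFun (congrArg Subtype.val h) p
  have hall : ∀ p : ℤ, x.1 p = x.1 0 := by
    intro p
    induction p with
    | zero => rfl
    | succ n ih => rw [add_comm, hstep, ih]
    | pred n ih =>
      rw [← ih, ← hstep]
      exact congrArg x.1 (by ring)
  rcases eq_zero_or_one (x.1 0) with h0 | h0
  · exact Or.inl fun p => (hall p).trans h0
  · exact Or.inr fun p => (hall p).trans h0

variable (hS : S.Infinite) (hX : ¬ IsSofic (gapShift S))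

include hX in
-- The image is constant. Were it zero, `F` would exchange the two constant points and turn a block
-- of `n` zeros among ones into a run of ones whose length is `n` up to a constant. Then `S` would
-- contain all large integers, against non-soficity.
theorem map_ones (F : Aut (gapShift S)) (p : ℤ) : (F.1 ⟨_, ones_mem hS⟩).1 p = 1 := by
  obtain ⟨R, hR⟩ := Aut.exists_isLocal F
  set one : (gapShift S).carrier := ⟨_, ones_mem hS⟩ with hone
  have hfix : ∀ x : (gapShift S).carrier, shiftOn _ 1 x = x → shiftOn _ 1 (F.1 x) = F.1 x := by
    intro x hx
    rw [← Aut.shift_comm, hx]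
  have h1 : shiftOn _ 1 one = one := rfl
  rcases const_of_shift (hfix one h1) with h0 | h0
  swap
  · exact h0 p
  exfalso
  set zero := F.1 one with hzero
  have h2 := hfix zero (hfix one h1)
  have h3 : ∀ p, (F.1 zero).1 p = 1 := by
    refine (const_of_shift h2).resolve_left fun h => ?_
    have h4 : F.1 zero = zero := by
      apply Subtype.ext
      funext p
      rw [h, h0]
    have h5 := F.1.injective h4
    have := congrFun (congrArg Subtype.val h5) 0
    rw [h0] at this
    simp [hone] at this
  have hS0 : 0 ∈ S := (mem_gapShift hS).1 zero.2 0 0 ⟨h0 _, fun p _ _ => by omega, h0 _⟩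
  have hconv : ∀ x : ℤ → Fin 2, (∀ i j k, i < j → j < k → x i = 0 → x k = 0 → x j = 0) →
      x ∈ (gapShift S).carrier := by
    intro x hx
    rw [mem_gapShift hS]
    rintro i n ⟨h4, h5, h6⟩
    rcases Nat.eq_zero_or_pos n with rfl | hn
    · exact hS0
    · have h7 := hx i (i + 1) (i + n + 1) (by omega) (by omega) h4 h6
      rw [h5 (i + 1) (by omega) (by omega)] at h7
      simp at h7
  let xl : (gapShift S).carrier := ⟨fun p => if 0 ≤ p then 0 else 1,
    hconv _ fun i j k h4 h5 h6 h7 => by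
    split_ifs at * <;> first | rfl | omega⟩
  let xr : (gapShift S).carrier := ⟨fun p => if p < 0 then 0 else 1,
    hconv _ fun i j k h4 h5 h6 h7 => by
    split_ifs at * <;> first | rfl | omega⟩
  obtain ⟨ρ, hρ, hρ1, hρ2⟩ : ∃ ρ, EndsAt (F.1 xl).1 ρ ∧ -(R : ℤ) - 1 ≤ ρ ∧ ρ ≤ R := by
    refine exists_endsAt (fun p hp => ?_) ?_
    · rw [hR xl zero p fun q h4 h5 => ?_, h3]
      rw [h0]
      exact if_pos (by omega)
    · rw [hR xl one _ fun q h4 h5 => ?_]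
      · exact h0 _
      · exact if_neg (by omega)
  obtain ⟨μ, hμ, hμ1, hμ2⟩ : ∃ μ, StartsAt (F.1 xr).1 μ ∧ μ ≤ R ∧ -(R : ℤ) ≤ μ := by
    refine exists_startsAt (fun p hp => ?_) ?_
    · rw [hR xr zero p fun q h4 h5 => ?_, h3]
      rw [h0]
      exact if_pos (by omega)
    · rw [hR xr one _ fun q h4 h5 => ?_]
      · exact h0 _
      · exact if_neg (by omega)
  have hall : ∀ n : ℤ, 2 * R + 1 ≤ n → (μ + n - ρ - 1).toNat ∈ S := by
    intro n hn
    let x : (gapShift S).carrier := ⟨fun p => if 0 ≤ p ∧ p < n then 0 else 1,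
      hconv _ fun i j k h4 h5 h6 h7 => by
        split_ifs at * <;> first | rfl | omega⟩
    refine (mem_gapShift hS).1 (F.1 x).2 ρ _ (run_of_ends (c := n - R - 1) hρ
      (z := (F.1 (shiftOn _ (-n) xr)).1)
      ?_ (fun p hp => ?_) (fun p hp => ?_) (by omega) (by omega))
    · rw [Aut.shift_comm]
      refine ⟨?_, fun p hp => ?_⟩
      · rw [← hμ.1]
        exact congrArg (F.1 xr).1 (by ring)
      · exact hμ.2 (-n + p) (by omega)
    · refine hR _ _ _ fun q h4 h5 => ?_
      change (if 0 ≤ q ∧ q < n then (0 : Fin 2) else 1) = if 0 ≤ q then 0 else 1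
      split_ifs <;> first | rfl | omega
    · refine hR _ _ _ fun q h4 h5 => ?_
      change (if 0 ≤ q ∧ q < n then (0 : Fin 2) else 1) = if -n + q < 0 then 0 else 1
      split_ifs <;> first | rfl | omega
  have := eq_zero_of_add_mem hS.nonempty hX (d := 1) (N := 5 * R + 5) fun n _ hn => by
    have h4 := hall (n + 2 + ρ - μ) (by omega)
    convert h4 using 2
    ring
  simp at this

variable {F : Aut (gapShift S)} {R : ℕ} (hR : IsLocal R F.1) (hR' : IsLocal R (F⁻¹).1)

include hS hX hR hR' in
-- Far to the right the image looks like the image of the all-ones point, hence is 1. A zero must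
-- survive near `i` or to its right, for otherwise `F⁻¹` would see only ones around `i`.
theorem exists_map_endsAt {x : (gapShift S).carrier} {i : ℤ} (hx : EndsAt x.1 i) :
    ∃ ρ, EndsAt (F.1 x).1 ρ ∧ i - R ≤ ρ ∧ ρ ≤ i + R := by
  have h1 := map_ones hS hX F
  have h2 := map_ones hS hX F⁻¹
  obtain ⟨p₀, hp₀, h0⟩ : ∃ p₀, i - R ≤ p₀ ∧ (F.1 x).1 p₀ = 0 := by
    by_contra hcon
    push Not at hcon
    have h3 : x.1 i = 1 := by
      have h4 : (F⁻¹).1 (F.1 x) = x := F.1.symm_apply_apply x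
      rw [← h2 i]
      conv_lhs => rw [← h4]
      exact hR' _ _ _ fun q h5 h6 => (eq_zero_or_one _).resolve_left (hcon q h5)
    rw [hx.1] at h3
    simp at h3
  obtain ⟨ρ, h3, h4, h5⟩ := exists_endsAt (x := (F.1 x).1) (b := i + R) (p₀ := p₀) (fun p hp => by
    rw [← h1 p]
    exact hR _ _ _ fun q h5 h6 => hx.2 q (by omega)) h0
  exact ⟨ρ, h3, by omega, h5⟩

include hS hX hR hR' in
theorem exists_map_startsAt {x : (gapShift S).carrier} {i : ℤ} (hx : StartsAt x.1 i) :
    ∃ ρ, StartsAt (F.1 x).1 ρ ∧ i - R ≤ ρ ∧ ρ ≤ i + R := by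
  have h1 := map_ones hS hX F
  have h2 := map_ones hS hX F⁻¹
  obtain ⟨p₀, hp₀, h0⟩ : ∃ p₀, p₀ ≤ i + R ∧ (F.1 x).1 p₀ = 0 := by
    by_contra hcon
    push Not at hcon
    have h3 : x.1 i = 1 := by
      have h4 : (F⁻¹).1 (F.1 x) = x := F.1.symm_apply_apply x
      rw [← h2 i]
      conv_lhs => rw [← h4]
      exact hR' _ _ _ fun q h5 h6 => (eq_zero_or_one _).resolve_left (hcon q h6)
    rw [hx.1] at h3
    simp at h3
  obtain ⟨ρ, h3, h4, h5⟩ := exists_startsAt (x := (F.1 x).1) (b := i - R) (p₀ := p₀) (fun p hp => by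
    rw [← h1 p]
    exact hR _ _ _ fun q h5 h6 => hx.2 q (by omega)) h0
  exact ⟨ρ, h3, h5, by omega⟩

include hR in
/-- The image of a long run between a left part and a right part. -/
theorem run_map {x y z : (gapShift S).carrier} {i j ρ μ : ℤ}
    (hxy : ∀ p, p < j → x.1 p = y.1 p) (hxz : ∀ p, i < p → x.1 p = z.1 p)
    (hρ : EndsAt (F.1 y).1 ρ) (hμ : StartsAt (F.1 z).1 μ) (hρi : ρ ≤ i + R) (hμj : j - R ≤ μ)
    (hij : i + 2 * R + 1 ≤ j) : Run (F.1 x).1 ρ (μ - ρ - 1).toNat :=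
  run_of_ends (c := j - R - 1) hρ hμ
    (fun p hp => hR _ _ _ fun q h1 h2 => hxy q (by omega))
    (fun p hp => hR _ _ _ fun q h1 h2 => hxz q (by omega)) (by omega) (by omega)

include hS hX in
/-- Up to a shift, an automorphism preserves all long runs. -/
theorem exists_shift_runs (F : Aut (gapShift S)) : ∃ s : ℤ, ∃ N : ℕ,
    (∀ x : (gapShift S).carrier, ∀ i, EndsAt x.1 i → EndsAt (F.1 x).1 (i + s)) ∧
    ∀ x : (gapShift S).carrier, ∀ i n, N ≤ n → Run x.1 i n → Run (F.1 x).1 (i + s) n := by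
  obtain ⟨R₁, h1⟩ := Aut.exists_isLocal F
  obtain ⟨R₂, h2⟩ := Aut.exists_isLocal F⁻¹
  have hR := h1.mono (Nat.le_add_right R₁ R₂)
  have hR' := h2.mono (Nat.le_add_left R₂ R₁)
  set R := R₁ + R₂ with hRdef
  -- Glue `x` and a translate of `y` by a run of length `n ∈ S`. The image has a run of length `n +
  -- μ - ρ`, which must lie in `S` for all large `n ∈ S`; so `μ = ρ`.
  have key : ∀ (x y : (gapShift S).carrier) (ρ μ : ℤ), EndsAt x.1 0 → StartsAt y.1 0 →
      EndsAt (F.1 x).1 ρ → StartsAt (F.1 y).1 μ → ρ = μ := by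
    intro x y ρ μ hx hy hρ hμ
    obtain ⟨ρ', hρ', hρ1, hρ2⟩ := exists_map_endsAt hS hX hR hR' hx
    obtain rfl := hρ.unique hρ'
    have hy' : ∀ n : ℕ, StartsAt (shiftOn _ (-(n + 1)) y).1 (n + 1) := fun n =>
      ⟨by rw [← hy.1]; exact congrArg y.1 (by ring), fun p hp => hy.2 (-(n + 1) + p) (by omega)⟩
    have hFy : ∀ n : ℕ, StartsAt (F.1 (shiftOn _ (-(n + 1)) y)).1 (μ + n + 1) := by
      intro n
      rw [Aut.shift_comm]
      exact ⟨by rw [← hμ.1]; exact congrArg (F.1 y).1 (by ring),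
        fun p hp => hμ.2 (-(n + 1) + p) (by omega)⟩
    obtain ⟨μ', hμ', hμ1, hμ2⟩ := exists_map_startsAt hS hX hR hR' hy
    have hμμ : μ = μ' := by
      rcases lt_trichotomy μ μ' with hlt | heq | hlt
      · have := hμ'.2 _ hlt
        rw [hμ.1] at this
        simp at this
      · exact heq
      · have := hμ.2 _ hlt
        rw [hμ'.1] at this
        simp at this
    have := eq_zero_of_add_mem hS.nonempty hX (d := μ - ρ) (N := 4 * R + 4) fun n hn hnN => by
      have hmem := glueRun_mem hS x.2 (shiftOn _ (-(n + 1)) y).2 hn hx (hy' n)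
      have h3 := run_map hR (x := ⟨_, hmem⟩) (y := x) (z := shiftOn _ (-(n + 1)) y) (i := 0)
        (j := n + 1) (fun p hp => if_pos (by omega)) (fun p hp => by
          dsimp only
          split_ifs with h
          · rw [hx.2 p hp, (hy' n).2 p (by omega)]
          · rfl) hρ (hFy n) (by omega) (by omega) (by omega)
      have h4 := (mem_gapShift hS).1 (F.1 ⟨_, hmem⟩).2 _ _ h3
      convert h4 using 2
      ring
    omega
  have hdot1 : ∀ c : ℤ, EndsAt (fun p => if p = c then (0 : Fin 2) else 1) c := fun c =>
    ⟨if_pos rfl, fun p hp => if_neg (by omega)⟩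
  have hdot2 : ∀ c : ℤ, StartsAt (fun p => if p = c then (0 : Fin 2) else 1) c := fun c =>
    ⟨if_pos rfl, fun p hp => if_neg (by omega)⟩
  -- A single zero is both an end and a start. Comparing every other end and start with it shows
  -- that all have the same displacement `s`.
  obtain ⟨s, hs, hs1, hs2⟩ := exists_map_endsAt hS hX hR hR'
    (x := ⟨_, dot_mem hS 0⟩) (hdot1 0)
  obtain ⟨s', hs', -, -⟩ := exists_map_startsAt hS hX hR hR'
    (x := ⟨_, dot_mem hS 0⟩) (hdot2 0)
  obtain rfl := key _ _ s s' (hdot1 0) (hdot2 0) hs hs'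
  have hE : ∀ x : (gapShift S).carrier, ∀ i, EndsAt x.1 i → EndsAt (F.1 x).1 (i + s) := by
    intro x i hx
    have hx' : EndsAt (shiftOn _ i x).1 0 :=
      ⟨by rw [← hx.1]; exact congrArg x.1 (by ring), fun p hp => hx.2 (i + p) (by omega)⟩
    obtain ⟨ρ, hρ, -, -⟩ := exists_map_endsAt hS hX hR hR' hx'
    obtain rfl := key _ _ ρ s hx' (hdot2 0) hρ hs'
    rw [Aut.shift_comm] at hρ
    refine ⟨hρ.1, fun p hp => ?_⟩
    rw [← hρ.2 (p - i) (by omega)]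
    exact congrArg (F.1 x).1 (by ring)
  have hB : ∀ x : (gapShift S).carrier, ∀ i, StartsAt x.1 i → StartsAt (F.1 x).1 (i + s) := by
    intro x i hx
    have hx' : StartsAt (shiftOn _ i x).1 0 :=
      ⟨by rw [← hx.1]; exact congrArg x.1 (by ring), fun p hp => hx.2 (i + p) (by omega)⟩
    obtain ⟨ρ, hρ, -, -⟩ := exists_map_startsAt hS hX hR hR' hx'
    obtain rfl := key _ _ s ρ (hdot1 0) hx' hs hρ
    rw [Aut.shift_comm] at hρ
    refine ⟨hρ.1, fun p hp => ?_⟩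
    rw [← hρ.2 (p - i) (by omega)]
    exact congrArg (F.1 x).1 (by ring)
  refine ⟨s, 2 * R + 1, hE, fun x i n hn hrun => ?_⟩
  obtain ⟨hr0, hr1, hr2⟩ := hrun
  have h3 := run_map hR (x := x) (y := ⟨_, truncRight_mem hS x.2 i⟩)
    (z := ⟨_, truncLeft_mem hS x.2 (i + n + 1)⟩) (i := i) (j := i + n + 1)
    (fun p hp => by
      dsimp only
      split_ifs with h
      · rfl
      · exact hr1 p (by omega) (by omega))
    (fun p hp => by
      dsimp only
      split_ifs with h
      · rfl
      · exact hr1 p (by omega) (by omega))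
    (hE _ i ⟨by simpa using hr0, fun p hp => if_neg (by omega)⟩)
    (hB _ (i + n + 1) ⟨by simpa using hr2, fun p hp => if_neg (by omega)⟩)
    (by omega) (by omega) (by omega)
  convert h3 using 1
  omega

/-- Up to a shift, an automorphism preserves and reflects all long runs. -/
theorem exists_shift_run_iff (hS' : S.Nonempty) (hX : ¬ IsSofic (gapShift S))
    (F : Aut (gapShift S)) : ∃ s : ℤ, ∃ N : ℕ, ∀ x : (gapShift S).carrier, ∀ i n, N ≤ n →
      (Run x.1 i n ↔ Run (F.1 x).1 (i + s) n) := by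
  have hS := infinite_of_not_isSofic hS' hX
  obtain ⟨s, N, hE, hN⟩ := exists_shift_runs hS hX F
  obtain ⟨s', N', hE', hN'⟩ := exists_shift_runs hS hX F⁻¹
  have hinv : ∀ x, (F⁻¹).1 (F.1 x) = x := fun x => F.1.symm_apply_apply x
  have hss : s + s' = 0 := by
    have h1 : EndsAt (fun p : ℤ => if p = 0 then (0 : Fin 2) else 1) 0 :=
      ⟨if_pos rfl, fun p hp => if_neg (by omega)⟩
    have h2 := hE' _ _ (hE ⟨_, dot_mem hS 0⟩ 0 h1)
    rw [hinv] at h2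
    have := h1.unique h2
    omega
  refine ⟨s, N + N', fun x i n hn => ⟨hN x i n (by omega), fun h => ?_⟩⟩
  have := hN' _ _ n (by omega) h
  rwa [hinv, add_assoc, hss, add_zero] at this

end Rigid

end

/-! ### A code made of long runs -/

section GapWords

/-- The concatenation of the words `0 1^n` for the entries `n` of a list. -/
def gapsWord (gs : List ℕ) : List (Fin 2) := (gs.map gapWord).flatten

theorem gapsWord_cons (g : ℕ) (gs : List ℕ) : gapsWord (g :: gs) = gapWord g ++ gapsWord gs := rfl

theorem gapsWord_append (gs gs' : List ℕ) : gapsWord (gs ++ gs') = gapsWord gs ++ gapsWord gs' := by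
  simp [gapsWord]

theorem length_gapsWord (gs : List ℕ) : (gapsWord gs).length = gs.sum + gs.length := by
  induction gs with
  | nil => rfl
  | cons g gs ih =>
    rw [gapsWord_cons, List.length_append, ih]
    simp [gapWord]
    ring

theorem replicate_cons_inj {α : Type*} {y z : α} (hne : y ≠ z) {g g' : ℕ} {u u' : List α}
    (h : List.replicate g y ++ z :: u = List.replicate g' y ++ z :: u') : g = g' ∧ u = u' := by
  induction g generalizing g' with
  | zero =>
    cases g' with
    | zero => simpa using h
    | succ g' =>
      simp only [List.replicate_zero, List.nil_append, List.replicate_succ, List.cons_append,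
        List.cons.injEq] at h
      exact absurd h.1.symm hne
  | succ g ih =>
    cases g' with
    | zero =>
      simp only [List.replicate_zero, List.nil_append, List.replicate_succ, List.cons_append,
        List.cons.injEq] at h
      exact absurd h.1 hne
    | succ g' =>
      simp only [List.replicate_succ, List.cons_append, List.cons.injEq, true_and] at h
      obtain ⟨rfl, rfl⟩ := ih h
      exact ⟨rfl, rfl⟩

theorem gapsWord_inj {gs gs' : List ℕ} (h : gapsWord gs ++ [0] = gapsWord gs' ++ [0]) :
    gs = gs' := by
  have hhead : ∀ gs, ∃ u, gapsWord gs ++ [0] = 0 :: u := by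
    intro gs
    cases gs with
    | nil => exact ⟨[], rfl⟩
    | cons g gs => exact ⟨_, rfl⟩
  induction gs generalizing gs' with
  | nil =>
    cases gs' with
    | nil => rfl
    | cons g' gs' => simp [gapsWord, gapWord] at h
  | cons g gs ih =>
    cases gs' with
    | nil => simp [gapsWord, gapWord] at h
    | cons g' gs' =>
      rw [gapsWord_cons, gapsWord_cons, List.append_assoc, List.append_assoc] at h
      obtain ⟨u, hu⟩ := hhead gs
      obtain ⟨u', hu'⟩ := hhead gs'
      rw [hu, hu'] at h
      simp only [gapWord, List.cons_append, List.cons.injEq, true_and] at h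
      obtain ⟨rfl, rfl⟩ := replicate_cons_inj (by simp) h
      rw [ih (hu.trans hu'.symm)]

theorem at_gapWord {x : ℤ → Fin 2} {i : ℤ} {g : ℕ} :
    At x i (gapWord g) ↔ x i = 0 ∧ ∀ p, i < p → p ≤ i + g → x p = 1 := by
  constructor
  · intro h
    refine ⟨by simpa [gapWord] using h 0 (by simp [gapWord]), fun p h1 h2 => ?_⟩
    have h3 := h (p - i).toNat (by simp [gapWord]; omega)
    rw [show i + ((p - i).toNat : ℤ) = p by omega] at h3
    rw [h3]
    obtain ⟨q, hq⟩ : ∃ q, (p - i).toNat = q + 1 := ⟨(p - i).toNat - 1, by omega⟩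
    simp [hq, gapWord]
  · rintro ⟨h0, h1⟩ k hk
    cases k with
    | zero => simpa [gapWord] using h0
    | succ k =>
      simp only [gapWord, List.length_cons, List.length_replicate] at hk
      rw [h1 _ (by omega) (by omega)]
      simp [gapWord]

theorem at_gapsWord_zero {x : ℤ → Fin 2} {i : ℤ} {gs : List ℕ} (h : At x i (gapsWord gs ++ [0])) :
    x i = 0 := by
  cases gs with
  | nil => simpa [gapsWord] using h 0 (by simp)
  | cons g gs => simpa [gapsWord, gapWord] using h 0 (by simp)

theorem at_gapsWord_cons {x : ℤ → Fin 2} {i : ℤ} {g : ℕ} {gs : List ℕ} :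
    At x i (gapsWord (g :: gs) ++ [0]) ↔
      Run x i g ∧ At x (i + g + 1) (gapsWord gs ++ [0]) := by
  have hl : (i + (gapWord g).length : ℤ) = i + g + 1 := by
    simp [gapWord]
    ring
  rw [gapsWord_cons, List.append_assoc, at_append, hl, at_gapWord]
  constructor
  · rintro ⟨⟨h1, h2⟩, h3⟩
    exact ⟨⟨h1, h2, at_gapsWord_zero h3⟩, h3⟩
  · rintro ⟨⟨h1, h2, -⟩, h3⟩
    exact ⟨⟨h1, h2⟩, h3⟩

theorem Run.unique {x : ℤ → Fin 2} {i : ℤ} {n m : ℕ} (h : Run x i n) (h' : Run x i m) : n = m := by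
  rcases lt_trichotomy n m with hlt | heq | hlt
  · have := h'.2.1 (i + n + 1) (by omega) (by omega)
    rw [h.2.2] at this
    simp at this
  · exact heq
  · have := h.2.1 (i + m + 1) (by omega) (by omega)
    rw [h'.2.2] at this
    simp at this

/-- A run of length `c` cannot start among runs of other lengths. This makes the run `c` a reliable
marker for `gapCode`. -/
theorem le_of_run {x : ℤ → Fin 2} {c : ℕ} {gs : List ℕ} (hc : c ∉ gs) {i j : ℤ}
    (h : At x i (gapsWord gs ++ [0])) (hij : i ≤ j) (hj : Run x j c) :
    i + (gapsWord gs).length ≤ j := by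
  induction gs generalizing i with
  | nil => simpa [gapsWord] using hij
  | cons g gs ih =>
    rw [at_gapsWord_cons] at h
    simp only [List.mem_cons, not_or] at hc
    have hne : i ≠ j := by
      rintro rfl
      exact hc.1 (hj.unique h.1)
    have h1 : i + g + 1 ≤ j := by
      by_contra hcon
      have := h.1.2.1 j (by omega) (by omega)
      rw [hj.1] at this
      simp at this
    have h2 := ih hc.2 h.2 h1
    rw [gapsWord_cons, List.length_append]
    simp only [gapWord, List.length_cons, List.length_replicate]
    push_cast
    omega

theorem reads_gapsWord {S : Set ℕ} {n : ℕ} {gs : List ℕ} {v : List (Fin 2)} :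
    Reads S true n (gapsWord gs ++ 0 :: v) ↔
      n ∈ S ∧ (∀ g ∈ gs, g ∈ S) ∧ Reads S true 0 v := by
  induction gs generalizing n with
  | nil => simp [gapsWord, reads_true_zero]
  | cons g gs ih =>
    rw [gapsWord_cons, gapWord, List.cons_append, List.cons_append, reads_true_zero,
      List.append_assoc, reads_replicate, ih]
    simp [and_assoc]

end GapWords

section GapCode

variable {S : Set ℕ}

/-- A single entry `a` in position `j` among entries `b`. -/
def gapList (a b ℓ j : ℕ) : List ℕ := List.replicate j b ++ a :: List.replicate (ℓ - 1 - j) b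

theorem gapList_ne_nil (a b ℓ j : ℕ) : gapList a b ℓ j ≠ [] := by simp [gapList]

theorem mem_gapList {a b ℓ j g : ℕ} (h : g ∈ gapList a b ℓ j) : g = a ∨ g = b := by
  simp only [gapList, List.mem_append, List.mem_replicate, List.mem_cons] at h
  tauto

theorem gapList_inj {a b ℓ j j' : ℕ} (hab : b ≠ a) (h : gapList a b ℓ j = gapList a b ℓ j') :
    j = j' := (replicate_cons_inj hab h).1

theorem length_gapsWord_gapList {a b ℓ j : ℕ} (hj : j < ℓ) :
    (gapsWord (gapList a b ℓ j)).length = (ℓ - 1) * (b + 1) + a + 1 := by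
  obtain ⟨e, he⟩ : ∃ e, ℓ - 1 = j + e := ⟨ℓ - 1 - j, by omega⟩
  rw [length_gapsWord, gapList, he, Nat.add_sub_cancel_left]
  simp
  ring

theorem zero_cons_tail {gs : List ℕ} (h : gs ≠ []) :
    0 :: (gapsWord gs).tail = gapsWord gs := by
  cases gs with
  | nil => exact absurd rfl h
  | cons g gs => rfl

theorem markers_append {gs : List ℕ} (h : gs ≠ []) (c : ℕ) :
    gapWord c ++ [0] ++ (gapsWord gs).tail ++ (gapWord c ++ [0]) =
      gapsWord (c :: (gs ++ [c])) ++ [0] := by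
  have e : gapWord c ++ [0] ++ (gapsWord gs).tail = gapWord c ++ gapsWord gs := by
    rw [List.append_assoc, List.singleton_append, zero_cons_tail h]
  rw [e, gapsWord_cons, gapsWord_append]
  simp [gapsWord]

/-- The code words consist of a gap `a` and `ℓ - 1` gaps `b`, between two gaps `c`. -/
def gapCode (hS : S.Nonempty) {a b c : ℕ} (ha : a ∈ S) (hb : b ∈ S) (hc : c ∈ S) (hab : b ≠ a)
    (hca : c ≠ a) (hcb : c ≠ b) (ℓ : ℕ) [NeZero ℓ] : Code (language (gapShift S)) (ZMod ℓ) where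
  k := gapWord c ++ [0]
  z := gapWord c ++ [0]
  -- The first zero of the list word already belongs to the marker `k`, where it closes the run of
  -- length `c`. Adjacent code words may thus share a marker.
  m j := (gapsWord (gapList a b ℓ j.val)).tail
  n := (ℓ - 1) * (b + 1) + a
  length_m j := by
    rw [List.length_tail, length_gapsWord_gapList (ZMod.val_lt j), Nat.add_sub_cancel]
  length_z := rfl
  inj := by
    intro j j' h
    dsimp only at h
    have h1 : gapsWord (gapList a b ℓ j.val) = gapsWord (gapList a b ℓ j'.val) := by
      rw [← zero_cons_tail (gapList_ne_nil _ _ _ _), h, zero_cons_tail (gapList_ne_nil _ _ _ _)]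
    exact ZMod.val_injective ℓ (gapList_inj hab (gapsWord_inj (by rw [h1])))
  sep := by
    intro x i i' j j' hi hi' hii
    rw [markers_append (gapList_ne_nil _ _ _ _), at_gapsWord_cons] at hi hi'
    have h1 : i + c + 1 ≤ i' := by
      by_contra hcon
      have := hi.1.2.1 i' (by omega) (by omega)
      rw [hi'.1.1] at this
      simp at this
    have h2 : At x (i + c + 1) (gapsWord (gapList a b ℓ j.val) ++ [0]) := by
      have h3 := hi.2
      rw [gapsWord_append, List.append_assoc] at h3
      refine h3.of_prefix ((List.prefix_append_right_inj _).2 ?_)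
      exact ⟨List.replicate c 1 ++ [0], by simp [gapsWord, gapWord]⟩
    have h3 := le_of_run (c := c) (fun hmem => (mem_gapList hmem).elim hca hcb) h2 h1 hi'.1
    rw [length_gapsWord_gapList (ZMod.val_lt j)] at h3
    simp only [gapWord, List.length_append, List.length_cons, List.length_replicate,
      List.length_nil]
    push_cast at h3 ⊢
    omega
  swap := by
    intro u v j j' h
    rw [mem_language_gapShift hS, markers_append (gapList_ne_nil _ _ _ _), List.append_assoc] at h ⊢
    -- All runs strictly inside the code words are complete and have lengths in `S`, and the
    -- surroundings end and begin at zeros, so any two code words can be exchanged.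
    refine h.replace fun b' n h => ?_
    rw [gapsWord_cons, gapWord, List.cons_append, List.cons_append, List.cons_append, reads_zero,
      List.append_assoc, List.append_assoc, List.singleton_append, reads_replicate,
      reads_gapsWord] at h ⊢
    refine ⟨h.1, h.2.1, fun g hg => ?_, h.2.2.2⟩
    rcases List.mem_append.1 hg with hg | hg
    · rcases mem_gapList hg with rfl | rfl <;> assumption
    · rw [List.mem_singleton.1 hg]
      exact hc

variable (hS : S.Nonempty) {a b c : ℕ} (ha : a ∈ S) (hb : b ∈ S) (hc : c ∈ S) (hab : b ≠ a)
  (hca : c ≠ a) (hcb : c ≠ b) (ℓ : ℕ) [NeZero ℓ]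

theorem cw_gapCode (j : ZMod ℓ) : (gapCode hS ha hb hc hab hca hcb ℓ).cw j =
    gapsWord (c :: (gapList a b ℓ j.val ++ [c])) ++ [0] :=
  markers_append (gapList_ne_nil _ _ _ _) c

/-- Only long runs are transported, not single zeros; the closing zero is recovered from the last
run, so the list must be nonempty. -/
theorem at_gapsWord_iff {x y : ℤ → Fin 2} {s : ℤ} {N : ℕ}
    (h : ∀ i n, N ≤ n → (Run x i n ↔ Run y (i + s) n)) {g : ℕ} {gs : List ℕ} (hg : N ≤ g)
    (hgs : ∀ g ∈ gs, N ≤ g) {i : ℤ} :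
    At x i (gapsWord (g :: gs) ++ [0]) ↔ At y (i + s) (gapsWord (g :: gs) ++ [0]) := by
  induction gs generalizing g i with
  | nil =>
    have hnil : ∀ (x : ℤ → Fin 2) (i : ℤ), At x i (gapsWord [] ++ [0]) ↔ x i = 0 := fun x i =>
      ⟨at_gapsWord_zero, fun h k hk => by
        obtain rfl : k = 0 := by simpa [gapsWord] using hk
        simpa [gapsWord] using h⟩
    rw [at_gapsWord_cons, at_gapsWord_cons, hnil, hnil, h i g hg]
    exact and_congr_right fun h1 => iff_of_true ((h i g hg).2 h1).2.2 h1.2.2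
  | cons g' gs ih =>
    rw [at_gapsWord_cons, at_gapsWord_cons (gs := g' :: gs), h i g hg,
      ih (hgs g' (by simp)) fun g hg => hgs g (by simp [hg])]
    have : i + s + g + 1 = i + g + 1 + s := by ring
    rw [this]

/-- `F` translates all code words by `s`, as they are built from long runs, so both compositions
show the same code words. Off these they agree by locality: the gate changes only middle parts, and
the markers are longer than the radius plus the displacement. -/
theorem commute_gapCode {F : Aut (gapShift S)} {s : ℤ} {N R : ℕ}
    (hN : ∀ x : (gapShift S).carrier, ∀ i n, N ≤ n → (Run x.1 i n ↔ Run (F.1 x).1 (i + s) n))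
    (hR : IsLocal R F.1) (hNa : N ≤ a) (hNb : N ≤ b) (hNc : N ≤ c) (hRc : R + s.natAbs ≤ c)
    (π : Equiv.Perm (ZMod ℓ)) :
    Commute ((permRule π).gate (gapCode hS ha hb hc hab hca hcb ℓ)) F := by
  set C := gapCode hS ha hb hc hab hca hcb ℓ with hC
  have hty : ∀ (x : (gapShift S).carrier) i, C.ty (F.1 x).1 (i + s) = C.ty x.1 i := by
    intro x i
    refine Option.ext fun j => ?_
    rw [C.ty_eq_some, C.ty_eq_some, cw_gapCode]
    refine (at_gapsWord_iff (hN x) hNc fun g hg => ?_).symm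
    rcases List.mem_append.1 hg with hg | hg
    · rcases mem_gapList hg with rfl | rfl <;> assumption
    · rwa [List.mem_singleton.1 hg]
  have hk : C.k.length = c + 2 := by simp [hC, gapCode, gapWord]
  apply Subtype.ext
  refine Equiv.ext fun x => ?_
  change ((permRule π).gate C).1 (F.1 x) = F.1 (((permRule π).gate C).1 x)
  apply Subtype.ext
  funext p
  set y := ((permRule π).gate C).1 x with hy
  have hyx : y.1 = C.put x.1 ((permRule π).f (C.ty x.1)) := rfl
  have htyy : C.ty y.1 = (permRule π).f (C.ty x.1) := (permRule π).ty_gate C x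
  set v := ((permRule π).gate C).1 (F.1 x) with hv
  have hvx : v.1 = C.put (F.1 x).1 ((permRule π).f (C.ty (F.1 x).1)) := rfl
  have htyv : C.ty v.1 = (permRule π).f (C.ty (F.1 x).1) := (permRule π).ty_gate C (F.1 x)
  have hvy : ∀ i, C.ty v.1 (i + s) = C.ty (F.1 y).1 (i + s) := by
    intro i
    rw [hty, htyy, htyv]
    change (C.ty (F.1 x).1 (i + s)).map π = (C.ty x.1 i).map π
    rw [hty]
  by_cases hp : ∃ i, (C.ty x.1 i).isSome ∧ i + s ≤ p ∧
      p < i + s + C.k.length + C.n + C.k.length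
  · obtain ⟨i, hi, h1, h2⟩ := hp
    have h3 : (C.ty v.1 (i + s)).isSome := by
      rw [hvy, hty, htyy, (permRule π).dom]
      exact hi
    obtain ⟨j, hj⟩ := Option.isSome_iff_exists.1 h3
    have h4 := C.ty_eq_some.1 hj
    have h5 := C.ty_eq_some.1 (hvy i ▸ hj)
    have := h4.eq h5 (a := p - (i + s)) (by omega) (by rw [C.length_cw]; push_cast; omega)
    simpa using this
  · push Not at hp
    have h1 : v.1 p = (F.1 x).1 p := by
      rw [hvx]
      refine Code.put_off fun i hi => ?_
      have h2 := hi.2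
      have h3 := hi.1
      rw [← sub_add_cancel i s, hty] at h3
      have := hp _ h3 (by omega)
      omega
    rw [h1]
    refine hR _ _ _ fun q h2 h3 => ?_
    rw [hyx]
    refine (Code.put_off fun i hi => ?_).symm
    have h4 := hi.2
    have := hp i hi.1 (by omega)
    omega

end GapCode

/-- For a non-sofic gap shift, the centralizer of a finite set of automorphisms has elements of
every finite order. -/
theorem exists_pow_eq_one {S : Set ℕ} (hS : S.Nonempty) (hX : ¬ IsSofic (gapShift S))
    {T : Set (Aut (gapShift S))} (hT : T.Finite) {ℓ : ℕ} (hℓ : 2 ≤ ℓ) :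
    ∃ a : Aut (gapShift S), (∀ h ∈ T, Commute a h) ∧ a ^ ℓ = 1 ∧ a ≠ 1 := by
  have hinf := infinite_of_not_isSofic hS hX
  choose s N hN using exists_shift_run_iff hS hX
  choose R hR using fun F : Aut (gapShift S) => Aut.exists_isLocal F
  -- One bound serves all of `T`; the run lengths `a < b < c` are then taken in `S` beyond it,
  -- possible as `S` is infinite.
  obtain ⟨K, hK⟩ := (hT.image fun F => N F + R F + (s F).natAbs).bddAbove
  obtain ⟨a, ha, hKa⟩ := hinf.exists_gt K
  obtain ⟨b, hb, hab⟩ := hinf.exists_gt a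
  obtain ⟨c, hc, hbc⟩ := hinf.exists_gt b
  have : NeZero ℓ := ⟨by omega⟩
  have : Fact (1 < ℓ) := ⟨by omega⟩
  set C := gapCode hS ha hb hc (by omega) (by omega) (by omega) ℓ with hC
  -- Rotating the `ℓ` code words: the `ℓ`-th power is trivial, and a point containing a code word is
  -- moved.
  set π : Equiv.Perm (ZMod ℓ) := Equiv.addRight 1 with hπ
  refine ⟨(permRule π).gate C, fun F hF => ?_, ?_, fun h1 => ?_⟩
  · have := hK ⟨F, hF, rfl⟩
    dsimp only at this
    exact commute_gapCode hS ha hb hc _ _ _ ℓ (hN F) (hR F) (by omega) (by omega) (by omega)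
      (by omega) π
  · apply Subtype.ext
    refine Equiv.ext fun x => ?_
    change (((permRule π).gate C) ^ ℓ).1 x = x
    rw [Aut.pow_apply]
    apply Subtype.ext
    rw [(permRule π).gate_iterate_put C (Code.fits_ty _) (Code.put_self _).symm]
    have : ∀ n : ℕ, ∀ t : ℤ → Option (ZMod ℓ), (permRule π).f^[n] t = fun i =>
        (t i).map fun j => j + (n : ZMod ℓ) := by
      intro n t
      induction n with
      | zero => simp
      | succ n ih =>
        rw [Function.iterate_succ_apply', ih]
        funext i
        change ((t i).map fun j => j + (n : ZMod ℓ)).map π = _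
        rw [Option.map_map]
        congr 1
        funext j
        simp [hπ, add_assoc]
    rw [this]
    simp only [CharP.cast_eq_zero, add_zero, Option.map_id']
    exact Code.put_self _
  · obtain ⟨x, hx, i, hi⟩ : C.cw 0 ∈ language (gapShift S) := by
      rw [mem_language_gapShift hS, cw_gapCode, gapsWord_cons, gapWord, List.cons_append,
        List.cons_append, reads_zero, List.append_assoc, reads_replicate, reads_gapsWord]
      refine ⟨⟨a, ha, by omega, by simp⟩, by simpa using hc, fun g hg => ?_, a, ha, by omega⟩
      rcases List.mem_append.1 hg with hg | hg
      · rcases mem_gapList hg with rfl | rfl <;> assumption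
      · rw [List.mem_singleton.1 hg]
        exact hc
    have h2 := (permRule π).ty_gate C ⟨x, hx⟩
    rw [h1] at h2
    have h3 := congrFun h2 i
    change C.ty x i = (C.ty x i).map π at h3
    rw [C.ty_eq_some.2 hi] at h3
    simp [hπ] at h3

end SoficAut

/-! ### The two groups are not isomorphic -/

theorem mainTheorem8 (S : Set ℕ) (hS : S.Nonempty)
    (hX : ¬ SoficAut.IsSofic (SoficAut.gapShift S))
    {B : Type*} [Finite B] [TopologicalSpace B] [DiscreteTopology B]
    (Z : SymbolicDynamics.FullShift.Subshift B ℤ)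
    (hZt : SoficAut.IsTransitive Z) (hZs : SoficAut.IsSofic Z) :
    IsEmpty (SoficAut.Aut (SoficAut.gapShift S) ≃* SoficAut.Aut Z) := by
  refine ⟨fun φ => ?_⟩
  rcases Z.carrier.finite_or_infinite with hfin | hinf
  · have := SoficAut.finite_aut hfin
    have : Finite (SoficAut.Aut (SoficAut.gapShift S)) := Finite.of_equiv _ φ.symm.toEquiv
    -- A finite group has no element of prime order exceeding its cardinality, by Lagrange.
    obtain ⟨ℓ, hle, hℓ⟩ :=
      Nat.exists_infinite_primes (Nat.card (SoficAut.Aut (SoficAut.gapShift S)) + 1)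
    obtain ⟨a, -, ha, ha1⟩ := SoficAut.exists_pow_eq_one hS hX Set.finite_empty hℓ.two_le
    have : Fact ℓ.Prime := ⟨hℓ⟩
    have h1 := orderOf_dvd_natCard a
    rw [orderOf_eq_prime ha ha1] at h1
    have := Nat.le_of_dvd Nat.card_pos h1
    omega
  · obtain ⟨T, hT, N, hN⟩ := SoficAut.exists_finite_centralizer hZt hZs hinf
    obtain ⟨ℓ, hle, hℓ⟩ := Nat.exists_infinite_primes (N + 1)
    -- Pull the finite set `T` back along `φ`; an element of prime order `ℓ > N` centralizing it
    -- maps into the centralizer of `T`, where it must be trivial.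
    obtain ⟨a, haT, ha, ha1⟩ :=
      SoficAut.exists_pow_eq_one hS hX (hT.image φ.symm) hℓ.two_le
    refine ha1 (φ.injective ?_)
    rw [map_one]
    refine hN (φ a) (fun h hh => ?_) ℓ hℓ (by omega) (by rw [← map_pow, ha, map_one])
    have := (haT _ ⟨h, hh, rfl⟩).map φ
    rwa [MulEquiv.apply_symm_apply] at this
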